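/- All rings are $\mathbb Z$-graded, associative and unital, and graded commutative means $ab=(-1)^{|a||b|}ba$ for homogeneous $a,b$. A module over a graded ring $R$ is a graded right $R$-module; $M[n]$ denotes the shifted module with $M[n]_i=M_{i-n}$. For $n\in\mathbb Z$, a graded ring $R$ is called a $\Delta^n$-ring if the category of projective graded $R$-modules (and module maps of degree $0$) admits the structure of a triangulated category with suspension functor $\Sigma=(-)[n]$. A graded field is a nonzero graded commutative ring in which every nonzero homogeneous element is invertible. **Proposition.** Let $k$ be a graded field. 1. For every $n\in\mathbb Z$, $k$ is a $\Delta^n$-ring. 2. Let $n,i\in\mathbb Z$ and let $R=k[x]/(x^2)$ be the exterior algebra over $k$ on one generator $x$ of degree $|x|=i$. If $R$ contains a homogeneous unit of degree $3|x|+n$, and if it is not the case that $n$ and $|x|$ are both even while $\operatorname{char}k\neq 2$, then $R$ is a $\Delta^n$-ring. -/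

import Mathlib

open CategoryTheory CategoryTheory.Limits

universe u

/-! ### Graded right modules over a `ℤ`-graded ring -/

/-- A reindexed internal direct sum decomposition is again one. -/
theorem isInternal_sub {M : Type u} [AddCommGroup M] {deg : ℤ → AddSubgroup M}
    (h : DirectSum.IsInternal deg) (n : ℤ) :
    DirectSum.IsInternal fun i => deg (i - n) := by
  let e : (DirectSum ℤ fun i => deg i) ≃+ DirectSum ℤ fun i => deg (i - n) :=
    DirectSum.equivCongrLeft (β := fun i => deg i) (Equiv.addRight n)
  have key : (DirectSum.coeAddMonoidHom fun i => deg (i - n)).comp e.toAddMonoidHom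
      = DirectSum.coeAddMonoidHom deg := by
    refine DirectSum.addHom_ext' fun i => AddMonoidHom.ext fun x => ?_
    obtain ⟨j, rfl⟩ := (Equiv.addRight n).symm.surjective i
    have he : e (DirectSum.of (fun i => deg i) ((Equiv.addRight n).symm j) x)
        = DirectSum.of (fun i => deg (i - n)) j x :=
      DirectSum.equivCongrLeft_of (β := fun i => deg i) (Equiv.addRight n) j x
    refine (congrArg (DirectSum.coeAddMonoidHom fun i => deg (i - n)) he).trans ?_
    exact (DirectSum.coeAddMonoidHom_of (fun i => deg (i - n)) j x).trans
      (DirectSum.coeAddMonoidHom_of deg _ x).symm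
  have key' : (DirectSum.coeAddMonoidHom fun i => deg (i - n)) ∘ e
      = DirectSum.coeAddMonoidHom deg := funext fun z => DFunLike.congr_fun key z
  have h' : Function.Bijective ((DirectSum.coeAddMonoidHom fun i => deg (i - n)) ∘ e) := by
    rw [key']; exact h
  exact (Function.Bijective.of_comp_iff _ e.bijective).1 h'

theorem isInternal_punit :
    DirectSum.IsInternal fun _ : ℤ => (⊥ : AddSubgroup PUnit.{u + 1}) :=
  ⟨fun _ _ _ => DFinsupp.ext fun _ => Subsingleton.elim _ _,
    fun _ => ⟨DirectSum.of (fun _ : ℤ => (⊥ : AddSubgroup PUnit.{u + 1})) 0 ⟨0, rfl⟩,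
      Subsingleton.elim _ _⟩⟩

/-- A `ℤ`-graded right module over the graded ring `R = ⨁ 𝒜 i`; right modules over `R` are
modules over `Rᵐᵒᵖ`, and `deg i` is the subgroup of elements of degree `i`. -/
structure GrMod {R : Type u} [Ring R] (𝒜 : ℤ → AddSubgroup R) where
  carrier : Type u
  [addCommGroup : AddCommGroup carrier]
  [module : Module Rᵐᵒᵖ carrier]
  deg : ℤ → AddSubgroup carrier
  isInternal : DirectSum.IsInternal deg
  smul_mem : ∀ {i j : ℤ} {m : carrier} {r : R}, m ∈ deg i → r ∈ 𝒜 j →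
    MulOpposite.op r • m ∈ deg (i + j)

namespace GrMod

attribute [instance] GrMod.addCommGroup GrMod.module

variable {R : Type u} [Ring R] {𝒜 : ℤ → AddSubgroup R}

/-- The group of degree `0` homomorphisms of graded right modules. -/
def homs (M N : GrMod 𝒜) : AddSubgroup (M.carrier →ₗ[Rᵐᵒᵖ] N.carrier) where
  carrier := {f | ∀ (i : ℤ) (m : M.carrier), m ∈ M.deg i → f m ∈ N.deg i}
  add_mem' hf hg i m hm := add_mem (hf i m hm) (hg i m hm)
  zero_mem' _ _ _ := zero_mem _
  neg_mem' hf i m hm := neg_mem (hf i m hm)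

/-- The category of graded right modules and homomorphisms of degree `0`. -/
instance category : Category (GrMod 𝒜) where
  Hom M N := homs M N
  id M := ⟨LinearMap.id, fun _ _ hm => hm⟩
  comp f g := ⟨g.1.comp f.1, fun i m hm => g.2 i _ (f.2 i m hm)⟩

theorem hom_ext {M N : GrMod 𝒜} {f g : M ⟶ N} (h : ∀ m, f.1 m = g.1 m) : f = g :=
  Subtype.ext (LinearMap.ext h)

@[simp] theorem id_val {M : GrMod 𝒜} (m : M.carrier) : (𝟙 M : M ⟶ M).1 m = m := rfl

@[simp] theorem comp_val {M N P : GrMod 𝒜} (f : M ⟶ N) (g : N ⟶ P) (m : M.carrier) :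
    (f ≫ g).1 m = g.1 (f.1 m) := rfl

instance preadditive : Preadditive (GrMod 𝒜) where
  homGroup M N := inferInstanceAs (AddCommGroup (homs M N))
  add_comp _ _ _ f f' g := hom_ext fun m => map_add g.1 (f.1 m) (f'.1 m)
  comp_add _ _ _ _ _ _ := rfl

/-- The zero module. -/
def zeroObj (𝒜 : ℤ → AddSubgroup R) : GrMod 𝒜 where
  carrier := PUnit
  deg _ := ⊥
  isInternal := isInternal_punit
  smul_mem _ _ := Subsingleton.elim _ _

theorem isZero_zeroObj : IsZero (zeroObj 𝒜) :=
  (IsZero.iff_id_eq_zero _).2 (hom_ext fun _ => rfl)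

instance : HasZeroObject (GrMod 𝒜) := ⟨⟨_, isZero_zeroObj⟩⟩

/-- The shifted module `M[n]`, with `M[n]_i = M_{i-n}` and the same right action. -/
def shiftObj (M : GrMod 𝒜) (n : ℤ) : GrMod 𝒜 where
  carrier := M.carrier
  deg i := M.deg (i - n)
  isInternal := isInternal_sub M.isInternal n
  smul_mem {i j m r} hm hr := by
    have h := M.smul_mem hm hr
    rwa [show i - n + j = i + j - n by ring] at h

/-- The functor `(-)[n]`; it does not change the underlying maps. -/
def shiftBy (n : ℤ) : GrMod 𝒜 ⥤ GrMod 𝒜 where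
  obj M := M.shiftObj n
  map f := ⟨f.1, fun i m hm => f.2 (i - n) m hm⟩

theorem eqToHom_shiftObj (M : GrMod 𝒜) {a b : ℤ} (h : a = b)
    (h' : M.shiftObj a = M.shiftObj b) (m : M.carrier) :
    (eqToHom h' : M.shiftObj a ⟶ M.shiftObj b).1 m = m := by
  subst h; rfl

/-- The canonical isomorphism `M[0] ≅ M`, the identity on elements. -/
def shiftZeroIso : shiftBy (𝒜 := 𝒜) 0 ≅ 𝟭 (GrMod 𝒜) where
  hom := { app := fun M => ⟨LinearMap.id, fun i m hm => by
    change m ∈ M.deg (i - 0) at hm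
    rwa [sub_zero] at hm⟩ }
  inv := { app := fun M => ⟨LinearMap.id, fun i m hm => by
    change m ∈ M.deg (i - 0)
    rwa [sub_zero]⟩ }

/-- The canonical isomorphism `M[a + b] ≅ M[a][b]`, the identity on elements. -/
def shiftAddIso (a b : ℤ) : shiftBy (𝒜 := 𝒜) (a + b) ≅ shiftBy a ⋙ shiftBy b where
  hom := { app := fun M => ⟨LinearMap.id, fun i m hm => by
    change m ∈ M.deg (i - (a + b)) at hm
    change m ∈ M.deg (i - b - a)
    rwa [show i - b - a = i - (a + b) by ring]⟩ }
  inv := { app := fun M => ⟨LinearMap.id, fun i m hm => by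
    change m ∈ M.deg (i - b - a) at hm
    change m ∈ M.deg (i - (a + b))
    rwa [show i - (a + b) = i - b - a by ring]⟩ }

/-- The shift of the category of graded modules by `ℤ`: `M⟦n⟧` is `M[n]`. -/
instance hasShift : HasShift (GrMod 𝒜) ℤ :=
  hasShiftMk _ _
    { F := shiftBy
      zero := shiftZeroIso
      add := shiftAddIso
      assoc_hom_app := fun a b c M => hom_ext fun m =>
        (eqToHom_shiftObj M (add_assoc a b c) _ m).symm
      zero_add_hom_app := fun n M => hom_ext fun m =>
        (eqToHom_shiftObj M (zero_add n) _ m).symm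
      add_zero_hom_app := fun n M => hom_ext fun m =>
        (eqToHom_shiftObj M (add_zero n) _ m).symm }

instance (n : ℤ) : (shiftFunctor (GrMod 𝒜) n).Additive where
  map_add := rfl

instance : (isProjective (GrMod 𝒜)).ContainsZero :=
  ⟨zeroObj 𝒜, isZero_zeroObj, ⟨fun _ _ _ => ⟨0, isZero_zeroObj.eq_of_src _ _⟩⟩⟩

instance : (isProjective (GrMod 𝒜)).IsStableUnderShift ℤ where
  isStableUnderShiftBy n :=
    ⟨fun M hM => ((shiftFunctor (GrMod 𝒜) n).asEquivalence.map_projective_iff M).2 hM⟩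

end GrMod

/-- The category `𝒫` of projective graded right modules (the projective objects of the category of
graded right modules), with the shift functors `M ↦ M[n]`. -/
abbrev ProjGrMod {R : Type u} [Ring R] (𝒜 : ℤ → AddSubgroup R) :=
  (isProjective (GrMod 𝒜)).FullSubcategory

/-- `R = ⨁ 𝒜 i` is a `Δⁿ`-ring: the category of projective graded right `R`-modules admits a
triangulation (including the octahedral axiom) with suspension `(-)[n]`. In `PullbackShift`, the
integer `m` acts by `(-)[m • n]`, so that the suspension, the action of `1`, is `(-)[n]`. -/
def IsDeltaRing {R : Type u} [Ring R] (𝒜 : ℤ → AddSubgroup R) [GradedRing 𝒜] (n : ℤ) : Prop :=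
  ∃ _ : Pretriangulated (PullbackShift (ProjGrMod 𝒜) (zmultiplesHom ℤ n)),
    IsTriangulated (PullbackShift (ProjGrMod 𝒜) (zmultiplesHom ℤ n))

/-! ### Graded fields and exterior algebras on one generator -/

/-- Graded commutativity: `ab = (-1)^{|a||b|}ba` for homogeneous `a`, `b`. -/
def IsGradedCommutative {R : Type u} [Ring R] (𝒜 : ℤ → AddSubgroup R) : Prop :=
  ∀ (i j : ℤ) (a b : R), a ∈ 𝒜 i → b ∈ 𝒜 j → a * b = Int.negOnePow (i * j) • (b * a)

/-- A graded field: a nonzero graded commutative ring in which every nonzero homogeneous element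
is invertible. -/
structure IsGradedField {k : Type u} [Ring k] (𝒦 : ℤ → AddSubgroup k) [GradedRing 𝒦] : Prop where
  nontrivial : Nontrivial k
  gradedCommutative : IsGradedCommutative 𝒦
  isUnit : ∀ (i : ℤ) (a : k), a ∈ 𝒦 i → a ≠ 0 → IsUnit a

/-- The grading of `k[x]/(x²) = k ⊕ kx` (as a ring, the dual numbers over `k`, with `x` commuting
with `k`) in which `x` has degree `i`: the element `a + bx` has degree `j` when `a` has degree `j`
and `b` has degree `j - i`. -/
def exteriorGrading {k : Type u} [Ring k] (𝒦 : ℤ → AddSubgroup k) (i j : ℤ) :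
    AddSubgroup (DualNumber k) where
  carrier := {z | z.fst ∈ 𝒦 j ∧ z.snd ∈ 𝒦 (j - i)}
  add_mem' hz hw := ⟨add_mem hz.1 hw.1, add_mem hz.2 hw.2⟩
  zero_mem' := ⟨zero_mem _, zero_mem _⟩
  neg_mem' hz := ⟨neg_mem hz.1, neg_mem hz.2⟩

theorem exterior_of_congr {k : Type u} [Ring k] (𝒦 : ℤ → AddSubgroup k) (i : ℤ) {j l : ℤ} (h : j = l) (z : exteriorGrading 𝒦 i j)
    (w : exteriorGrading 𝒦 i l) (hzw : (z : DualNumber k) = w) :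
    DirectSum.of (fun j => exteriorGrading 𝒦 i j) j z
      = DirectSum.of (fun j => exteriorGrading 𝒦 i j) l w := by
  subst h
  rw [Subtype.ext hzw]

section exterior

variable {k : Type u} [Ring k] (𝒦 : ℤ → AddSubgroup k) [GradedRing 𝒦] (i : ℤ)

/-- The inclusion of the degree `j` part of `k`. -/
def exteriorInl (j : ℤ) : 𝒦 j →+ exteriorGrading 𝒦 i j where
  toFun a := ⟨TrivSqZeroExt.inl (a : k), a.2, zero_mem _⟩
  map_zero' := Subtype.ext (TrivSqZeroExt.inl_zero _)
  map_add' _ _ := Subtype.ext (TrivSqZeroExt.inl_add _ _ _)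

/-- The inclusion `b ↦ bx` of the degree `j` part of `k`. -/
def exteriorInr (j : ℤ) : 𝒦 j →+ exteriorGrading 𝒦 i (j + i) where
  toFun b := ⟨TrivSqZeroExt.inr (b : k), zero_mem _, by simp⟩
  map_zero' := Subtype.ext (TrivSqZeroExt.inr_zero _)
  map_add' _ _ := Subtype.ext (TrivSqZeroExt.inr_add _ _ _)

/-- The homogeneous parts of `a`, for `a` in `k`. -/
noncomputable def exteriorDecomposeInl : k →+ DirectSum ℤ fun j => exteriorGrading 𝒦 i j :=
  (DirectSum.toAddMonoid fun j =>
      (DirectSum.of (fun j => exteriorGrading 𝒦 i j) j).comp (exteriorInl 𝒦 i j)).comp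
    (DirectSum.decomposeAddEquiv 𝒦).toAddMonoidHom

/-- The homogeneous parts of `bx`, for `b` in `k`. -/
noncomputable def exteriorDecomposeInr : k →+ DirectSum ℤ fun j => exteriorGrading 𝒦 i j :=
  (DirectSum.toAddMonoid fun j =>
      (DirectSum.of (fun j => exteriorGrading 𝒦 i j) (j + i)).comp (exteriorInr 𝒦 i j)).comp
    (DirectSum.decomposeAddEquiv 𝒦).toAddMonoidHom

theorem exteriorDecomposeInl_of_mem {j : ℤ} {a : k} (ha : a ∈ 𝒦 j) :
    exteriorDecomposeInl 𝒦 i a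
      = DirectSum.of (fun j => exteriorGrading 𝒦 i j) j (exteriorInl 𝒦 i j ⟨a, ha⟩) := by
  change DirectSum.toAddMonoid _ (DirectSum.decompose 𝒦 a) = _
  rw [DirectSum.decompose_of_mem 𝒦 ha, DirectSum.toAddMonoid_of]
  rfl

theorem exteriorDecomposeInr_of_mem {j : ℤ} {b : k} (hb : b ∈ 𝒦 j) :
    exteriorDecomposeInr 𝒦 i b
      = DirectSum.of (fun j => exteriorGrading 𝒦 i j) (j + i) (exteriorInr 𝒦 i j ⟨b, hb⟩) := by
  change DirectSum.toAddMonoid _ (DirectSum.decompose 𝒦 b) = _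
  rw [DirectSum.decompose_of_mem 𝒦 hb, DirectSum.toAddMonoid_of]
  rfl

/-- The decomposition of `a + bx` into its homogeneous parts. -/
noncomputable def exteriorDecompose :
    DualNumber k →+ DirectSum ℤ fun j => exteriorGrading 𝒦 i j where
  toFun z := exteriorDecomposeInl 𝒦 i z.fst + exteriorDecomposeInr 𝒦 i z.snd
  map_zero' := by simp
  map_add' z w := by
    simp only [TrivSqZeroExt.fst_add, TrivSqZeroExt.snd_add, map_add]
    abel

theorem coe_exteriorDecomposeInl (a : k) :
    DirectSum.coeAddMonoidHom (exteriorGrading 𝒦 i) (exteriorDecomposeInl 𝒦 i a)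
      = TrivSqZeroExt.inl a := by
  induction a using DirectSum.Decomposition.inductionOn 𝒦 with
  | zero => simp
  | homogeneous a =>
    rw [exteriorDecomposeInl_of_mem 𝒦 i a.2]
    exact DirectSum.coeAddMonoidHom_of (exteriorGrading 𝒦 i) _ _
  | add a b ha hb => rw [map_add, map_add, ha, hb, TrivSqZeroExt.inl_add]

theorem coe_exteriorDecomposeInr (b : k) :
    DirectSum.coeAddMonoidHom (exteriorGrading 𝒦 i) (exteriorDecomposeInr 𝒦 i b)
      = TrivSqZeroExt.inr b := by
  induction b using DirectSum.Decomposition.inductionOn 𝒦 with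
  | zero => simp
  | homogeneous b =>
    rw [exteriorDecomposeInr_of_mem 𝒦 i b.2]
    exact DirectSum.coeAddMonoidHom_of (exteriorGrading 𝒦 i) _ _
  | add a b ha hb => rw [map_add, map_add, ha, hb, TrivSqZeroExt.inr_add]

noncomputable instance exteriorDecomposition :
    DirectSum.Decomposition (exteriorGrading 𝒦 i) :=
  DirectSum.Decomposition.ofAddHom _ (exteriorDecompose 𝒦 i)
    (AddMonoidHom.ext fun z => by
      change DirectSum.coeAddMonoidHom (exteriorGrading 𝒦 i)
        (exteriorDecomposeInl 𝒦 i z.fst + exteriorDecomposeInr 𝒦 i z.snd) = z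
      rw [map_add, coe_exteriorDecomposeInl, coe_exteriorDecomposeInr,
        TrivSqZeroExt.inl_fst_add_inr_snd_eq])
    (DirectSum.addHom_ext' fun j => AddMonoidHom.ext fun z => by
      change exteriorDecompose 𝒦 i (DirectSum.coeAddMonoidHom (exteriorGrading 𝒦 i)
        (DirectSum.of (fun j => exteriorGrading 𝒦 i j) j z)) = DirectSum.of _ j z
      rw [DirectSum.coeAddMonoidHom_of]
      change exteriorDecomposeInl 𝒦 i (z : DualNumber k).fst
        + exteriorDecomposeInr 𝒦 i (z : DualNumber k).snd = _
      rw [exteriorDecomposeInl_of_mem 𝒦 i z.2.1, exteriorDecomposeInr_of_mem 𝒦 i z.2.2,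
        exterior_of_congr 𝒦 i (sub_add_cancel j i) _
          ⟨TrivSqZeroExt.inr (z : DualNumber k).snd, zero_mem _, z.2.2⟩ rfl, ← map_add]
      congr 1
      exact Subtype.ext (TrivSqZeroExt.inl_fst_add_inr_snd_eq _))

/-- `k[x]/(x²)` with `x` in degree `i` is a graded ring. -/
noncomputable instance exteriorGradedRing : GradedRing (exteriorGrading 𝒦 i) where
  one_mem := ⟨SetLike.GradedOne.one_mem, zero_mem _⟩
  mul_mem j l z w hz hw := by
    refine ⟨SetLike.GradedMul.mul_mem hz.1 hw.1, ?_⟩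
    have h₁ : z.fst * w.snd ∈ 𝒦 (j + (l - i)) := SetLike.GradedMul.mul_mem hz.1 hw.2
    have h₂ : z.snd * w.fst ∈ 𝒦 (j - i + l) := SetLike.GradedMul.mul_mem hz.2 hw.1
    rw [show j + (l - i) = j + l - i by ring] at h₁
    rw [show j - i + l = j + l - i by ring] at h₂
    exact add_mem h₁ h₂

end exterior

section gradedField

variable {k : Type u} [Ring k] {𝒦 : ℤ → AddSubgroup k} [GradedRing 𝒦]

/-- In a graded field the sign in the graded commutativity law is invisible: an element of odd
degree can be nonzero only in characteristic two. -/
theorem IsGradedField.sign_smul (hk : IsGradedField 𝒦) {p : ℤ} {a : k} (ha : a ∈ 𝒦 p)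
    (m : ℤ) (y : k) : Int.negOnePow (p * m) • (a * y) = a * y := by
  rcases Int.even_or_odd (p * m) with he | ho
  · rw [Int.negOnePow_even _ he, one_smul]
  have hp : Odd p := (Int.odd_mul.1 ho).1
  suffices h : a * y + a * y = 0 by
    rw [Int.negOnePow_odd _ ho, Units.neg_smul, one_smul]
    exact neg_eq_of_add_eq_zero_left h
  by_cases h0 : a = 0
  · simp [h0]
  have hsq := hk.gradedCommutative p p a a ha ha
  rw [Int.negOnePow_odd _ (hp.mul hp), Units.neg_smul, one_smul] at hsq
  have h2 : a * (a + a) = 0 := by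
    rw [mul_add]; exact add_eq_zero_iff_eq_neg.2 hsq
  have h3 : a + a = 0 := (hk.isUnit p a ha h0).mul_right_eq_zero.1 h2
  rw [← add_mul, h3, zero_mul]

theorem IsGradedField.comm (hk : IsGradedField 𝒦) {p q : ℤ} {a b : k} (ha : a ∈ 𝒦 p)
    (hb : b ∈ 𝒦 q) : a * b = b * a := by
  rw [hk.gradedCommutative p q a b ha hb, mul_comm p q]
  exact hk.sign_smul hb p a

/-- Over a graded field, `k[x]/(x²)` is graded commutative, whatever the degree of `x`: it is the
exterior algebra on `x`. -/
theorem IsGradedField.exterior_gradedCommutative (hk : IsGradedField 𝒦) (i : ℤ) :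
    IsGradedCommutative (exteriorGrading 𝒦 i) := by
  intro p q z w hz hw
  have hsmul : ∀ {r s : ℤ} {a b : k}, a ∈ 𝒦 r → b ∈ 𝒦 s → (r = p ∨ r = q) →
      Int.negOnePow (p * q) • (a * b) = a * b := by
    rintro r s a b ha - (rfl | rfl)
    · exact hk.sign_smul ha q b
    · rw [mul_comm p]; exact hk.sign_smul ha p b
  have hfst : ∀ (e : ℤˣ) (t : DualNumber k), (e • t).fst = e • t.fst := by
    intro e t
    rcases Int.units_eq_one_or e with rfl | rfl <;> simp [Units.neg_smul]
  have hsnd : ∀ (e : ℤˣ) (t : DualNumber k), (e • t).snd = e • t.snd := by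
    intro e t
    rcases Int.units_eq_one_or e with rfl | rfl <;> simp [Units.neg_smul]
  apply TrivSqZeroExt.ext
  · rw [hfst, TrivSqZeroExt.fst_mul, TrivSqZeroExt.fst_mul,
      hsmul hw.1 hz.1 (Or.inr rfl), hk.comm hz.1 hw.1]
  · rw [hsnd, TrivSqZeroExt.snd_mul, TrivSqZeroExt.snd_mul, smul_add]
    simp only [smul_eq_mul, MulOpposite.smul_eq_mul_unop, MulOpposite.unop_op]
    rw [hsmul hw.1 hz.2 (Or.inr rfl), hk.comm hw.2 hz.1, hsmul hz.1 hw.2 (Or.inl rfl),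
      hk.comm hz.2 hw.1, add_comm]

end gradedField

/-! A triangle is treated as a 3-periodic complex twisted by the suspension Σ, and the distinguished
triangles are specified up to homotopy by a class `𝒳` of models. A complex is elementary if it
deformation retracts onto a model, and distinguished if it is a deformation retract of an elementary
complex. `IsTriangleModel` collects what must be checked on the models: stability under rotation in
both directions, two exactness properties, an elementary triangle on every map, and fillings of
squares between models whose mapping cones are elementary.

Transport along retractions gives every pair of distinguished triangles fillings with distinguished
mapping cone (`exists_hom_of_mem`). This carries the octahedral axiom: when the filled square is the
identity on the first object, cancelling that object from the cone leaves a homotopy cartesian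
triangle, and doing this twice produces the octahedron.

Over a graded field, homogeneous submodules have homogeneous complements, so every map f of
projectives is von Neumann regular, f b f = f, and has split kernel and cokernel. The zero triangles
then suffice as models, and the distinguished triangles are contractible.

For R = k[x]/(x²) let τ = (-)[-|x|]. Multiplication by x, twisted by the sign (-1)^|m|, is a natural
map M ⟶ τM of square zero, with kernel equal to image on projectives. The unit of degree 3|x| + n
identifies τ³ with Σ = (-)[n], and the models are M ⟶ τM ⟶ τ²M ⟶ ΣM. Rotation introduces a sign, so
τ must send x to -x; this holds if |x| is odd or 2 = 0 in k. If |x| is even and the characteristic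
is not 2, the hypothesis makes n odd, so the unit has odd degree and forces 2 = 0 after all, a
contradiction. Finally, every map is a regular map plus a multiple of x (`exists_regular`, by
lifting idempotents). The regular part splits off kernels and cokernels, and the multiple of x only
produces models. -/

set_option linter.unusedSimpArgs false

/-! ### Triangles as twisted 3-periodic complexes: homotopies, deformation retracts, mapping cones
-/

namespace CategoryTheory.Pretriangulated

variable {C : Type*} [Category C] [Preadditive C] [HasShift C ℤ]

/-- The composites of consecutive maps in the triangle vanish. -/
structure IsComplex (T : Triangle C) : Prop where
  zero₁₂ : T.mor₁ ≫ T.mor₂ = 0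
  zero₂₃ : T.mor₂ ≫ T.mor₃ = 0
  zero₃₁ : T.mor₃ ≫ T.mor₁⟦(1 : ℤ)⟧' = 0

/-- A null-homotopy of a morphism of triangles, which are regarded as `3`-periodic complexes
up to the shift. -/
structure NullHomotopy {T T' : Triangle C} (φ : T ⟶ T') where
  s₁ : T.obj₂ ⟶ T'.obj₁
  s₂ : T.obj₃ ⟶ T'.obj₂
  s₃ : T.obj₁⟦(1 : ℤ)⟧ ⟶ T'.obj₃
  eq₁ : φ.hom₁⟦(1 : ℤ)⟧' = T.mor₁⟦(1 : ℤ)⟧' ≫ s₁⟦(1 : ℤ)⟧' + s₃ ≫ T'.mor₃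
  eq₂ : φ.hom₂ = T.mor₂ ≫ s₂ + s₁ ≫ T'.mor₁
  eq₃ : φ.hom₃ = T.mor₃ ≫ s₃ + s₂ ≫ T'.mor₂

/-- `X` is a deformation retract of the triangle `T`. -/
structure DefRetract (T X : Triangle C) where
  i : X ⟶ T
  p : T ⟶ X
  i_p : i ≫ p = 𝟙 X
  s₁ : T.obj₂ ⟶ T.obj₁
  s₂ : T.obj₃ ⟶ T.obj₂
  s₃ : T.obj₁⟦(1 : ℤ)⟧ ⟶ T.obj₃
  eq₁ : T.mor₁⟦(1 : ℤ)⟧' ≫ s₁⟦(1 : ℤ)⟧' + s₃ ≫ T.mor₃ + (p.hom₁ ≫ i.hom₁)⟦(1 : ℤ)⟧' = 𝟙 _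
  eq₂ : T.mor₂ ≫ s₂ + s₁ ≫ T.mor₁ + p.hom₂ ≫ i.hom₂ = 𝟙 _
  eq₃ : T.mor₃ ≫ s₃ + s₂ ≫ T.mor₂ + p.hom₃ ≫ i.hom₃ = 𝟙 _

lemma IsComplex.zero₁₂_assoc {T : Triangle C} (h : IsComplex T) {Z : C} (k : T.obj₃ ⟶ Z) :
    T.mor₁ ≫ T.mor₂ ≫ k = 0 := by rw [← Category.assoc, h.zero₁₂, zero_comp]

lemma IsComplex.zero₂₃_assoc {T : Triangle C} (h : IsComplex T) {Z : C}
    (k : T.obj₁⟦(1 : ℤ)⟧ ⟶ Z) : T.mor₂ ≫ T.mor₃ ≫ k = 0 := by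
  rw [← Category.assoc, h.zero₂₃, zero_comp]

lemma IsComplex.zero₃₁_assoc {T : Triangle C} (h : IsComplex T) {Z : C}
    (k : T.obj₂⟦(1 : ℤ)⟧ ⟶ Z) : T.mor₃ ≫ T.mor₁⟦(1 : ℤ)⟧' ≫ k = 0 := by
  rw [← Category.assoc, h.zero₃₁, zero_comp]

namespace DefRetract

variable {T X Y : Triangle C}

@[simp]
lemma i_p₁ (r : DefRetract T X) : r.i.hom₁ ≫ r.p.hom₁ = 𝟙 _ := by
  rw [← comp_hom₁, r.i_p, id_hom₁]

@[simp]
lemma i_p₂ (r : DefRetract T X) : r.i.hom₂ ≫ r.p.hom₂ = 𝟙 _ := by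
  rw [← comp_hom₂, r.i_p, id_hom₂]

@[simp]
lemma i_p₃ (r : DefRetract T X) : r.i.hom₃ ≫ r.p.hom₃ = 𝟙 _ := by
  rw [← comp_hom₃, r.i_p, id_hom₃]

@[simp]
lemma shift_i_p₁ (r : DefRetract T X) :
    r.i.hom₁⟦(1 : ℤ)⟧' ≫ r.p.hom₁⟦(1 : ℤ)⟧' = 𝟙 _ := by
  rw [← Functor.map_comp, i_p₁, Functor.map_id]

@[simp]
lemma i_p₁_assoc (r : DefRetract T X) {Z : C} (k : X.obj₁ ⟶ Z) :
    r.i.hom₁ ≫ r.p.hom₁ ≫ k = k := by rw [← Category.assoc, i_p₁, Category.id_comp]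

@[simp]
lemma i_p₂_assoc (r : DefRetract T X) {Z : C} (k : X.obj₂ ⟶ Z) :
    r.i.hom₂ ≫ r.p.hom₂ ≫ k = k := by rw [← Category.assoc, i_p₂, Category.id_comp]

@[simp]
lemma i_p₃_assoc (r : DefRetract T X) {Z : C} (k : X.obj₃ ⟶ Z) :
    r.i.hom₃ ≫ r.p.hom₃ ≫ k = k := by rw [← Category.assoc, i_p₃, Category.id_comp]

@[simp]
lemma shift_i_p₁_assoc (r : DefRetract T X) {Z : C} (k : X.obj₁⟦(1 : ℤ)⟧ ⟶ Z) :
    r.i.hom₁⟦(1 : ℤ)⟧' ≫ r.p.hom₁⟦(1 : ℤ)⟧' ≫ k = k := by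
  rw [← Category.assoc, shift_i_p₁, Category.id_comp]

/-- Deformation retracts of complexes are complexes. -/
lemma isComplex (r : DefRetract T X) (hT : IsComplex T) : IsComplex X where
  zero₁₂ := by
    rw [← Category.id_comp (X.mor₁ ≫ X.mor₂), ← r.i_p₁, Category.assoc,
      ← r.p.comm₁_assoc, ← r.p.comm₂, hT.zero₁₂_assoc, comp_zero]
  zero₂₃ := by
    rw [← Category.id_comp (X.mor₂ ≫ X.mor₃), ← r.i_p₂, Category.assoc,
      ← r.p.comm₂_assoc, ← r.p.comm₃, hT.zero₂₃_assoc, comp_zero]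
  zero₃₁ := by
    rw [← Category.id_comp (X.mor₃ ≫ _), ← r.i_p₃, Category.assoc,
      ← r.p.comm₃_assoc, ← Functor.map_comp, ← r.p.comm₁, Functor.map_comp, hT.zero₃₁_assoc,
      comp_zero]

section additive

variable [∀ n : ℤ, (shiftFunctor C n).Additive]

/-- A constructor for deformation retracts in terms of the objects and maps. -/
def ofMaps {A₁ A₂ A₃ B₁ B₂ B₃ : C} {f : A₁ ⟶ A₂} {g : A₂ ⟶ A₃} {h : A₃ ⟶ A₁⟦(1 : ℤ)⟧}
    {f' : B₁ ⟶ B₂} {g' : B₂ ⟶ B₃} {h' : B₃ ⟶ B₁⟦(1 : ℤ)⟧}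
    (i₁ : B₁ ⟶ A₁) (i₂ : B₂ ⟶ A₂) (i₃ : B₃ ⟶ A₃) (p₁ : A₁ ⟶ B₁) (p₂ : A₂ ⟶ B₂) (p₃ : A₃ ⟶ B₃)
    (s₁ : A₂ ⟶ A₁) (s₂ : A₃ ⟶ A₂) (s₃ : A₁⟦(1 : ℤ)⟧ ⟶ A₃)
    (ci₁ : f' ≫ i₂ = i₁ ≫ f) (ci₂ : g' ≫ i₃ = i₂ ≫ g) (ci₃ : h' ≫ i₁⟦(1 : ℤ)⟧' = i₃ ≫ h)
    (cp₁ : f ≫ p₂ = p₁ ≫ f') (cp₂ : g ≫ p₃ = p₂ ≫ g') (cp₃ : h ≫ p₁⟦(1 : ℤ)⟧' = p₃ ≫ h')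
    (ip₁ : i₁ ≫ p₁ = 𝟙 _) (ip₂ : i₂ ≫ p₂ = 𝟙 _) (ip₃ : i₃ ≫ p₃ = 𝟙 _)
    (e₁ : f⟦(1 : ℤ)⟧' ≫ s₁⟦(1 : ℤ)⟧' + s₃ ≫ h + p₁⟦(1 : ℤ)⟧' ≫ i₁⟦(1 : ℤ)⟧' = 𝟙 _)
    (e₂ : g ≫ s₂ + s₁ ≫ f + p₂ ≫ i₂ = 𝟙 _) (e₃ : h ≫ s₃ + s₂ ≫ g + p₃ ≫ i₃ = 𝟙 _) :
    DefRetract (Triangle.mk f g h) (Triangle.mk f' g' h') where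
  i := ⟨i₁, i₂, i₃, ci₁, ci₂, ci₃⟩
  p := ⟨p₁, p₂, p₃, cp₁, cp₂, cp₃⟩
  i_p := Triangle.hom_ext _ _ ip₁ ip₂ ip₃
  s₁ := s₁
  s₂ := s₂
  s₃ := s₃
  eq₁ := (congrArg (f⟦(1 : ℤ)⟧' ≫ s₁⟦(1 : ℤ)⟧' + s₃ ≫ h + ·)
    ((shiftFunctor C (1 : ℤ)).map_comp p₁ i₁)).trans e₁
  eq₂ := e₂
  eq₃ := e₃

/-- Isomorphic triangles are deformation retracts of each other. -/
def ofIso (e : T ≅ X) : DefRetract T X where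
  i := e.inv
  p := e.hom
  i_p := e.inv_hom_id
  s₁ := 0
  s₂ := 0
  s₃ := 0
  eq₁ := by simp
  eq₂ := by simp
  eq₃ := by simp

/-- Deformation retracts compose. -/
def trans (r : DefRetract T X) (r' : DefRetract X Y) : DefRetract T Y where
  i := r'.i ≫ r.i
  p := r.p ≫ r'.p
  i_p := by rw [Category.assoc, reassoc_of% r.i_p, r'.i_p]
  s₁ := r.s₁ + r.p.hom₂ ≫ r'.s₁ ≫ r.i.hom₁
  s₂ := r.s₂ + r.p.hom₃ ≫ r'.s₂ ≫ r.i.hom₂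
  s₃ := r.s₃ + r.p.hom₁⟦(1 : ℤ)⟧' ≫ r'.s₃ ≫ r.i.hom₃
  eq₁ := by
    have h : _ = r.p.hom₁⟦(1 : ℤ)⟧' ≫ 𝟙 _ ≫ r.i.hom₁⟦(1 : ℤ)⟧' :=
      congrArg (fun z => r.p.hom₁⟦(1 : ℤ)⟧' ≫ z ≫ r.i.hom₁⟦(1 : ℤ)⟧') r'.eq₁
    have h' := r.eq₁
    have h₁ : T.mor₁⟦(1 : ℤ)⟧' ≫ r.p.hom₂⟦(1 : ℤ)⟧'
      = r.p.hom₁⟦(1 : ℤ)⟧' ≫ X.mor₁⟦(1 : ℤ)⟧' := by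
      rw [← Functor.map_comp, ← Functor.map_comp, r.p.comm₁]
    rw [← h']
    simp only [Category.id_comp, Preadditive.add_comp, Preadditive.comp_add, Functor.map_add,
      Functor.map_comp, Category.assoc, comp_hom₁, ← r.i.comm₃, reassoc_of% h₁] at h ⊢
    rw [← h]
    abel
  eq₂ := by
    have h : _ = r.p.hom₂ ≫ 𝟙 _ ≫ r.i.hom₂ :=
      congrArg (fun z => r.p.hom₂ ≫ z ≫ r.i.hom₂) r'.eq₂
    rw [← r.eq₂]
    simp only [Category.id_comp, Preadditive.add_comp, Preadditive.comp_add,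
      Category.assoc, comp_hom₂, ← r.i.comm₁, r.p.comm₂_assoc] at h ⊢
    rw [← h]
    abel
  eq₃ := by
    have h : _ = r.p.hom₃ ≫ 𝟙 _ ≫ r.i.hom₃ :=
      congrArg (fun z => r.p.hom₃ ≫ z ≫ r.i.hom₃) r'.eq₃
    rw [← r.eq₃]
    simp only [Category.id_comp, Preadditive.add_comp, Preadditive.comp_add,
      Category.assoc, comp_hom₃, ← r.i.comm₂, r.p.comm₃_assoc] at h ⊢
    rw [← h]
    abel

/-- The homotopy of a deformation retract can be chosen such that it vanishes on the retract and
composes to zero with the projection. -/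
lemma exists_special (r : DefRetract T X) : ∃ r' : DefRetract T X, r'.i = r.i ∧ r'.p = r.p ∧
    r.i.hom₂ ≫ r'.s₁ = 0 ∧ r.i.hom₃ ≫ r'.s₂ = 0 ∧ r.i.hom₁⟦(1 : ℤ)⟧' ≫ r'.s₃ = 0 ∧
    r'.s₁ ≫ r.p.hom₁ = 0 ∧ r'.s₂ ≫ r.p.hom₂ = 0 ∧ r'.s₃ ≫ r.p.hom₃ = 0 := by
  -- The idempotent π = 1 - p ≫ i projects onto the contractible complement and commutes with the
  -- differentials. Sandwiching the homotopy s between two copies of π therefore keeps the homotopy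
  -- equations and enforces all the side conditions.
  let π₁ : T.obj₁ ⟶ T.obj₁ := 𝟙 _ - r.p.hom₁ ≫ r.i.hom₁
  let π₂ : T.obj₂ ⟶ T.obj₂ := 𝟙 _ - r.p.hom₂ ≫ r.i.hom₂
  let π₃ : T.obj₃ ⟶ T.obj₃ := 𝟙 _ - r.p.hom₃ ≫ r.i.hom₃
  have i₁ : r.i.hom₁ ≫ π₁ = 0 := by simp [π₁]
  have i₂ : r.i.hom₂ ≫ π₂ = 0 := by simp [π₂]
  have i₃ : r.i.hom₃ ≫ π₃ = 0 := by simp [π₃]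
  have p₁ : π₁ ≫ r.p.hom₁ = 0 := by simp [π₁]
  have p₂ : π₂ ≫ r.p.hom₂ = 0 := by simp [π₂]
  have p₃ : π₃ ≫ r.p.hom₃ = 0 := by simp [π₃]
  have q₁ : π₁ ≫ π₁ = π₁ := by
    nth_rw 2 [show π₁ = 𝟙 _ - r.p.hom₁ ≫ r.i.hom₁ from rfl]
    rw [Preadditive.comp_sub, reassoc_of% p₁]; simp
  have q₂ : π₂ ≫ π₂ = π₂ := by
    nth_rw 2 [show π₂ = 𝟙 _ - r.p.hom₂ ≫ r.i.hom₂ from rfl]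
    rw [Preadditive.comp_sub, reassoc_of% p₂]; simp
  have q₃ : π₃ ≫ π₃ = π₃ := by
    nth_rw 2 [show π₃ = 𝟙 _ - r.p.hom₃ ≫ r.i.hom₃ from rfl]
    rw [Preadditive.comp_sub, reassoc_of% p₃]; simp
  have c₁ : T.mor₁ ≫ π₂ = π₁ ≫ T.mor₁ := by simp [π₁, π₂]
  have c₂ : T.mor₂ ≫ π₃ = π₂ ≫ T.mor₂ := by simp [π₂, π₃]
  have c₃ : T.mor₃ ≫ π₁⟦(1 : ℤ)⟧' = π₃ ≫ T.mor₃ := by simp [π₁, π₃]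
  have e₁ : T.mor₁⟦(1 : ℤ)⟧' ≫ r.s₁⟦(1 : ℤ)⟧' + r.s₃ ≫ T.mor₃ = π₁⟦(1 : ℤ)⟧' := by
    rw [Functor.map_sub, Functor.map_id, ← r.eq₁]; abel
  have e₂ : T.mor₂ ≫ r.s₂ + r.s₁ ≫ T.mor₁ = π₂ := by
    simp only [π₂, ← r.eq₂]; abel
  have e₃ : T.mor₃ ≫ r.s₃ + r.s₂ ≫ T.mor₂ = π₃ := by
    simp only [π₃, ← r.eq₃]; abel
  have c₁' : T.mor₁⟦(1 : ℤ)⟧' ≫ π₂⟦(1 : ℤ)⟧' = π₁⟦(1 : ℤ)⟧' ≫ T.mor₁⟦(1 : ℤ)⟧' := by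
    rw [← Functor.map_comp, c₁, Functor.map_comp]
  refine ⟨{ r with
    s₁ := π₂ ≫ r.s₁ ≫ π₁
    s₂ := π₃ ≫ r.s₂ ≫ π₂
    s₃ := π₁⟦(1 : ℤ)⟧' ≫ r.s₃ ≫ π₃
    eq₁ := ?_
    eq₂ := ?_
    eq₃ := ?_ }, rfl, rfl, ?_, ?_, ?_, ?_, ?_, ?_⟩
  · have h := congrArg (fun z => π₁⟦(1 : ℤ)⟧' ≫ z ≫ π₁⟦(1 : ℤ)⟧') e₁
    simp only [Preadditive.add_comp, Preadditive.comp_add, Category.assoc,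
      ← Functor.map_comp, q₁] at h
    simp only [Functor.map_comp, Category.assoc] at h ⊢
    rw [reassoc_of% c₁', ← c₃, h]
    simp [π₁]
  · have h := congrArg (fun z => π₂ ≫ z ≫ π₂) e₂
    simp only [Preadditive.add_comp, Preadditive.comp_add, Category.assoc, q₂] at h
    simp only [Category.assoc]
    rw [reassoc_of% c₂, ← c₁, h]
    simp [π₂]
  · have h := congrArg (fun z => π₃ ≫ z ≫ π₃) e₃
    simp only [Preadditive.add_comp, Preadditive.comp_add, Category.assoc, q₃] at h
    simp only [Category.assoc]
    rw [reassoc_of% c₃, ← c₂, h]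
    simp [π₃]
  · simp [reassoc_of% i₂]
  · simp [reassoc_of% i₃]
  · rw [← Functor.map_comp_assoc, i₁]; simp
  · simp [p₁]
  · simp [p₂]
  · simp [p₃]

/-- Rotation preserves deformation retracts. -/
def rotate (r : DefRetract T X) : DefRetract T.rotate X.rotate where
  i := (Pretriangulated.rotate C).map r.i
  p := (Pretriangulated.rotate C).map r.p
  i_p := ((Pretriangulated.rotate C).map_comp r.i r.p).symm.trans
    ((congrArg _ r.i_p).trans ((Pretriangulated.rotate C).map_id X))
  s₁ := r.s₂
  s₂ := r.s₃
  s₃ := -r.s₁⟦(1 : ℤ)⟧'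
  eq₁ := by
    change T.mor₂⟦(1 : ℤ)⟧' ≫ r.s₂⟦(1 : ℤ)⟧' + (-r.s₁⟦(1 : ℤ)⟧') ≫ (-T.mor₁⟦(1 : ℤ)⟧')
      + (r.p.hom₂ ≫ r.i.hom₂)⟦(1 : ℤ)⟧' = 𝟙 (T.obj₂⟦(1 : ℤ)⟧)
    rw [← Functor.map_id, ← r.eq₂]
    simp only [Functor.map_add, Functor.map_comp, Preadditive.neg_comp, Preadditive.comp_neg,
      neg_neg]
  eq₂ := r.eq₃
  eq₃ := by
    change (-T.mor₁⟦(1 : ℤ)⟧') ≫ (-r.s₁⟦(1 : ℤ)⟧') + r.s₃ ≫ T.mor₃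
      + r.p.hom₁⟦(1 : ℤ)⟧' ≫ r.i.hom₁⟦(1 : ℤ)⟧' = 𝟙 (T.obj₁⟦(1 : ℤ)⟧)
    rw [← r.eq₁, Functor.map_comp, Preadditive.neg_comp, Preadditive.comp_neg, neg_neg]

/-- Deformation retracts can be rotated back. -/
lemma nonempty_of_rotate (r : DefRetract T.rotate X.rotate) : Nonempty (DefRetract T X) := by
  -- The first objects occur in the rotated triangles only after a shift; since the shift is an
  -- equivalence, the maps between them descend.
  obtain ⟨i₁, hi₁⟩ := (shiftFunctor C (1 : ℤ)).map_surjective (X := X.obj₁) (Y := T.obj₁) r.i.hom₃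
  obtain ⟨p₁, hp₁⟩ := (shiftFunctor C (1 : ℤ)).map_surjective (X := T.obj₁) (Y := X.obj₁) r.p.hom₃
  obtain ⟨s, hs⟩ := (shiftFunctor C (1 : ℤ)).map_surjective (X := T.obj₂) (Y := T.obj₁) r.s₃
  let i₂ : X.obj₂ ⟶ T.obj₂ := r.i.hom₁
  let i₃ : X.obj₃ ⟶ T.obj₃ := r.i.hom₂
  let p₂ : T.obj₂ ⟶ X.obj₂ := r.p.hom₁
  let p₃ : T.obj₃ ⟶ X.obj₃ := r.p.hom₂
  let s₂ : T.obj₃ ⟶ T.obj₂ := r.s₁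
  let s₃ : T.obj₁⟦(1 : ℤ)⟧ ⟶ T.obj₃ := r.s₂
  have ci₁ : X.mor₂ ≫ i₃ = i₂ ≫ T.mor₂ := r.i.comm₁
  have ci₂ : X.mor₃ ≫ i₁⟦(1 : ℤ)⟧' = i₃ ≫ T.mor₃ := by rw [hi₁]; exact r.i.comm₂
  have ci₃ : (-X.mor₁⟦(1 : ℤ)⟧') ≫ i₂⟦(1 : ℤ)⟧' = i₁⟦(1 : ℤ)⟧' ≫ (-T.mor₁⟦(1 : ℤ)⟧') := by
    rw [hi₁]; exact r.i.comm₃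
  have cp₁ : T.mor₂ ≫ p₃ = p₂ ≫ X.mor₂ := r.p.comm₁
  have cp₂ : T.mor₃ ≫ p₁⟦(1 : ℤ)⟧' = p₃ ≫ X.mor₃ := by rw [hp₁]; exact r.p.comm₂
  have cp₃ : (-T.mor₁⟦(1 : ℤ)⟧') ≫ p₂⟦(1 : ℤ)⟧' = p₁⟦(1 : ℤ)⟧' ≫ (-X.mor₁⟦(1 : ℤ)⟧') := by
    rw [hp₁]; exact r.p.comm₃
  have k₁ : i₁⟦(1 : ℤ)⟧' ≫ p₁⟦(1 : ℤ)⟧' = 𝟙 (X.obj₁⟦(1 : ℤ)⟧) := by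
    rw [hi₁, hp₁]; exact r.i_p₃
  have e₁ : T.mor₂⟦(1 : ℤ)⟧' ≫ s₂⟦(1 : ℤ)⟧' + s⟦(1 : ℤ)⟧' ≫ (-T.mor₁⟦(1 : ℤ)⟧') +
      (p₂ ≫ i₂)⟦(1 : ℤ)⟧' = 𝟙 (T.obj₂⟦(1 : ℤ)⟧) := by rw [hs]; exact r.eq₁
  have e₃ : (-T.mor₁⟦(1 : ℤ)⟧') ≫ s⟦(1 : ℤ)⟧' + s₃ ≫ T.mor₃ + p₁⟦(1 : ℤ)⟧' ≫ i₁⟦(1 : ℤ)⟧'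
      = 𝟙 (T.obj₁⟦(1 : ℤ)⟧) := by rw [hs, hi₁, hp₁]; exact r.eq₃
  rw [Preadditive.neg_comp, Preadditive.comp_neg, neg_inj, ← Functor.map_comp,
    ← Functor.map_comp] at ci₃ cp₃
  refine ⟨{
    i := ⟨i₁, i₂, i₃, (shiftFunctor C (1 : ℤ)).map_injective ci₃, ci₁, ci₂⟩
    p := ⟨p₁, p₂, p₃, (shiftFunctor C (1 : ℤ)).map_injective cp₃, cp₁, cp₂⟩
    i_p := Triangle.hom_ext _ _ ((shiftFunctor C (1 : ℤ)).map_injective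
      (((shiftFunctor C (1 : ℤ)).map_comp _ _).trans
        (k₁.trans ((shiftFunctor C (1 : ℤ)).map_id _).symm))) r.i_p₁ r.i_p₂
    s₁ := -s
    s₂ := s₂
    s₃ := s₃
    eq₁ := ?_
    eq₂ := (shiftFunctor C (1 : ℤ)).map_injective ?_
    eq₃ := r.eq₂ }⟩
  · rw [Functor.map_comp, ← e₃, Functor.map_neg, Preadditive.neg_comp, Preadditive.comp_neg]
  · rw [Functor.map_id, ← e₁, Functor.map_add, Functor.map_add, Functor.map_comp,
      Preadditive.neg_comp, Functor.map_neg, Functor.map_comp, Preadditive.comp_neg]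

end additive
end DefRetract

section cone

variable [HasBinaryBiproducts C] {T T' X X' : Triangle C}

@[simp]
lemma shift_lift_fst {A B Z : C} (f : Z ⟶ A) (g : Z ⟶ B) :
    (biprod.lift f g)⟦(1 : ℤ)⟧' ≫ biprod.fst⟦(1 : ℤ)⟧' = f⟦(1 : ℤ)⟧' := by
  rw [← Functor.map_comp, biprod.lift_fst]

@[simp]
lemma shift_lift_snd {A B Z : C} (f : Z ⟶ A) (g : Z ⟶ B) :
    (biprod.lift f g)⟦(1 : ℤ)⟧' ≫ biprod.snd⟦(1 : ℤ)⟧' = g⟦(1 : ℤ)⟧' := by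
  rw [← Functor.map_comp, biprod.lift_snd]

@[simp]
lemma shift_inl_desc {A B Z : C} (f : A ⟶ Z) (g : B ⟶ Z) :
    (biprod.inl)⟦(1 : ℤ)⟧' ≫ (biprod.desc f g)⟦(1 : ℤ)⟧' = f⟦(1 : ℤ)⟧' := by
  rw [← Functor.map_comp, biprod.inl_desc]

@[simp]
lemma shift_inr_desc {A B Z : C} (f : A ⟶ Z) (g : B ⟶ Z) :
    (biprod.inr)⟦(1 : ℤ)⟧' ≫ (biprod.desc f g)⟦(1 : ℤ)⟧' = g⟦(1 : ℤ)⟧' := by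
  rw [← Functor.map_comp, biprod.inr_desc]

@[simp]
lemma shift_inl_fst {A B : C} :
    (biprod.inl : A ⟶ A ⊞ B)⟦(1 : ℤ)⟧' ≫ (biprod.fst)⟦(1 : ℤ)⟧' = 𝟙 _ := by
  rw [← Functor.map_comp, biprod.inl_fst, Functor.map_id]

@[simp]
lemma shift_inr_snd {A B : C} :
    (biprod.inr : B ⟶ A ⊞ B)⟦(1 : ℤ)⟧' ≫ (biprod.snd)⟦(1 : ℤ)⟧' = 𝟙 _ := by
  rw [← Functor.map_comp, biprod.inr_snd, Functor.map_id]

/-- The mapping cone of a morphism of triangles. -/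
noncomputable def mappingCone (φ : T ⟶ T') : Triangle C :=
  Triangle.mk (X := T.obj₂ ⊞ T'.obj₁) (Y := T.obj₃ ⊞ T'.obj₂) (Z := T.obj₁⟦(1 : ℤ)⟧ ⊞ T'.obj₃)
    (biprod.desc (biprod.lift (-T.mor₂) φ.hom₂) (biprod.lift 0 T'.mor₁))
    (biprod.desc (biprod.lift (-T.mor₃) φ.hom₃) (biprod.lift 0 T'.mor₂))
    (biprod.desc ((biprod.lift (-T.mor₁) φ.hom₁)⟦(1 : ℤ)⟧') (T'.mor₃ ≫ biprod.inr⟦(1 : ℤ)⟧'))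

@[simp]
lemma shift_lift_fst_assoc {A B Z W : C} (f : Z ⟶ A) (g : Z ⟶ B) (k : A⟦(1 : ℤ)⟧ ⟶ W) :
    (biprod.lift f g)⟦(1 : ℤ)⟧' ≫ biprod.fst⟦(1 : ℤ)⟧' ≫ k = f⟦(1 : ℤ)⟧' ≫ k := by
  rw [← Category.assoc, shift_lift_fst]

@[simp]
lemma shift_lift_snd_assoc {A B Z W : C} (f : Z ⟶ A) (g : Z ⟶ B) (k : B⟦(1 : ℤ)⟧ ⟶ W) :
    (biprod.lift f g)⟦(1 : ℤ)⟧' ≫ biprod.snd⟦(1 : ℤ)⟧' ≫ k = g⟦(1 : ℤ)⟧' ≫ k := by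
  rw [← Category.assoc, shift_lift_snd]

@[simp]
lemma shift_inl_desc_assoc {A B Z W : C} (f : A ⟶ Z) (g : B ⟶ Z) (k : Z⟦(1 : ℤ)⟧ ⟶ W) :
    (biprod.inl)⟦(1 : ℤ)⟧' ≫ (biprod.desc f g)⟦(1 : ℤ)⟧' ≫ k = f⟦(1 : ℤ)⟧' ≫ k := by
  rw [← Category.assoc, shift_inl_desc]

@[simp]
lemma shift_inr_desc_assoc {A B Z W : C} (f : A ⟶ Z) (g : B ⟶ Z) (k : Z⟦(1 : ℤ)⟧ ⟶ W) :
    (biprod.inr)⟦(1 : ℤ)⟧' ≫ (biprod.desc f g)⟦(1 : ℤ)⟧' ≫ k = g⟦(1 : ℤ)⟧' ≫ k := by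
  rw [← Category.assoc, shift_inr_desc]

@[simp]
lemma shift_inl_fst_assoc {A B W : C} (k : A⟦(1 : ℤ)⟧ ⟶ W) :
    (biprod.inl : A ⟶ A ⊞ B)⟦(1 : ℤ)⟧' ≫ (biprod.fst)⟦(1 : ℤ)⟧' ≫ k = k := by
  rw [← Category.assoc, shift_inl_fst, Category.id_comp]

@[simp]
lemma shift_inr_snd_assoc {A B W : C} (k : B⟦(1 : ℤ)⟧ ⟶ W) :
    (biprod.inr : B ⟶ A ⊞ B)⟦(1 : ℤ)⟧' ≫ (biprod.snd)⟦(1 : ℤ)⟧' ≫ k = k := by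
  rw [← Category.assoc, shift_inr_snd, Category.id_comp]

@[simp]
lemma shift_map_fst {A B A' B' : C} (f : A ⟶ A') (g : B ⟶ B') :
    (biprod.map f g)⟦(1 : ℤ)⟧' ≫ (biprod.fst)⟦(1 : ℤ)⟧' = biprod.fst⟦(1 : ℤ)⟧' ≫ f⟦(1 : ℤ)⟧' := by
  rw [← Functor.map_comp, biprod.map_fst, Functor.map_comp]

@[simp]
lemma shift_map_snd {A B A' B' : C} (f : A ⟶ A') (g : B ⟶ B') :
    (biprod.map f g)⟦(1 : ℤ)⟧' ≫ (biprod.snd)⟦(1 : ℤ)⟧' = biprod.snd⟦(1 : ℤ)⟧' ≫ g⟦(1 : ℤ)⟧' := by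
  rw [← Functor.map_comp, biprod.map_snd, Functor.map_comp]

@[simp]
lemma shift_map_fst_assoc {A B A' B' W : C} (f : A ⟶ A') (g : B ⟶ B') (k : A'⟦(1 : ℤ)⟧ ⟶ W) :
    (biprod.map f g)⟦(1 : ℤ)⟧' ≫ (biprod.fst)⟦(1 : ℤ)⟧' ≫ k =
      biprod.fst⟦(1 : ℤ)⟧' ≫ f⟦(1 : ℤ)⟧' ≫ k := by
  rw [← Category.assoc, shift_map_fst, Category.assoc]

@[simp]
lemma shift_map_snd_assoc {A B A' B' W : C} (f : A ⟶ A') (g : B ⟶ B') (k : B'⟦(1 : ℤ)⟧ ⟶ W) :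
    (biprod.map f g)⟦(1 : ℤ)⟧' ≫ (biprod.snd)⟦(1 : ℤ)⟧' ≫ k =
      biprod.snd⟦(1 : ℤ)⟧' ≫ g⟦(1 : ℤ)⟧' ≫ k := by
  rw [← Category.assoc, shift_map_snd, Category.assoc]

variable [∀ n : ℤ, (shiftFunctor C n).Additive]

/-- An additive shift preserves the relation `biprod.total`, so the shifted projections are jointly
monic even though the shifted object is not literally a biproduct. -/
lemma shift_biprod_hom_ext {A B Z : C} {f g : Z ⟶ (A ⊞ B)⟦(1 : ℤ)⟧}
    (h₁ : f ≫ biprod.fst⟦(1 : ℤ)⟧' = g ≫ biprod.fst⟦(1 : ℤ)⟧')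
    (h₂ : f ≫ biprod.snd⟦(1 : ℤ)⟧' = g ≫ biprod.snd⟦(1 : ℤ)⟧') : f = g := by
  rw [← Category.comp_id f, ← Category.comp_id g, ← Functor.map_id, ← biprod.total,
    Functor.map_add, Functor.map_comp, Functor.map_comp, Preadditive.comp_add,
    Preadditive.comp_add, reassoc_of% h₁, reassoc_of% h₂]

lemma shift_biprod_hom_ext' {A B Z : C} {f g : (A ⊞ B)⟦(1 : ℤ)⟧ ⟶ Z}
    (h₁ : biprod.inl⟦(1 : ℤ)⟧' ≫ f = biprod.inl⟦(1 : ℤ)⟧' ≫ g)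
    (h₂ : biprod.inr⟦(1 : ℤ)⟧' ≫ f = biprod.inr⟦(1 : ℤ)⟧' ≫ g) : f = g := by
  rw [← Category.id_comp f, ← Category.id_comp g, ← Functor.map_id, ← biprod.total,
    Functor.map_add, Functor.map_comp, Functor.map_comp, Preadditive.add_comp,
    Preadditive.add_comp, Category.assoc, Category.assoc, Category.assoc, Category.assoc, h₁, h₂]

@[simp]
lemma shift_inl_snd {A B : C} :
    (biprod.inl : A ⟶ A ⊞ B)⟦(1 : ℤ)⟧' ≫ (biprod.snd)⟦(1 : ℤ)⟧' = 0 := by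
  rw [← Functor.map_comp, biprod.inl_snd, Functor.map_zero]

@[simp]
lemma shift_inr_fst {A B : C} :
    (biprod.inr : B ⟶ A ⊞ B)⟦(1 : ℤ)⟧' ≫ (biprod.fst)⟦(1 : ℤ)⟧' = 0 := by
  rw [← Functor.map_comp, biprod.inr_fst, Functor.map_zero]

@[simp]
lemma shift_lift_desc {A B Z W : C} (f : Z ⟶ A) (g : Z ⟶ B) (a : A ⟶ W) (b : B ⟶ W) :
    (biprod.lift f g)⟦(1 : ℤ)⟧' ≫ (biprod.desc a b)⟦(1 : ℤ)⟧' =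
      f⟦(1 : ℤ)⟧' ≫ a⟦(1 : ℤ)⟧' + g⟦(1 : ℤ)⟧' ≫ b⟦(1 : ℤ)⟧' := by
  rw [← Functor.map_comp, biprod.lift_desc, Functor.map_add, Functor.map_comp, Functor.map_comp]

@[simp]
lemma shift_lift_desc_assoc {A B Z W W' : C} (f : Z ⟶ A) (g : Z ⟶ B) (a : A ⟶ W) (b : B ⟶ W)
    (k : W⟦(1 : ℤ)⟧ ⟶ W') :
    (biprod.lift f g)⟦(1 : ℤ)⟧' ≫ (biprod.desc a b)⟦(1 : ℤ)⟧' ≫ k =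
      f⟦(1 : ℤ)⟧' ≫ a⟦(1 : ℤ)⟧' ≫ k + g⟦(1 : ℤ)⟧' ≫ b⟦(1 : ℤ)⟧' ≫ k := by
  rw [← Category.assoc, shift_lift_desc, Preadditive.add_comp, Category.assoc, Category.assoc]

@[simp]
lemma shift_inl_snd_assoc {A B W : C} (k : B⟦(1 : ℤ)⟧ ⟶ W) :
    (biprod.inl : A ⟶ A ⊞ B)⟦(1 : ℤ)⟧' ≫ (biprod.snd)⟦(1 : ℤ)⟧' ≫ k = 0 := by
  rw [← Functor.map_comp_assoc, biprod.inl_snd, Functor.map_zero, zero_comp]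

@[simp]
lemma shift_inr_fst_assoc {A B W : C} (k : A⟦(1 : ℤ)⟧ ⟶ W) :
    (biprod.inr : B ⟶ A ⊞ B)⟦(1 : ℤ)⟧' ≫ (biprod.fst)⟦(1 : ℤ)⟧' ≫ k = 0 := by
  rw [← Functor.map_comp_assoc, biprod.inr_fst, Functor.map_zero, zero_comp]

lemma mappingCone_isComplex (φ : T ⟶ T') (hT : IsComplex T) (hT' : IsComplex T') :
    IsComplex (mappingCone φ) where
  zero₁₂ := by
    change biprod.desc (biprod.lift (-T.mor₂) φ.hom₂) (biprod.lift 0 T'.mor₁) ≫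
      biprod.desc (biprod.lift (-T.mor₃) φ.hom₃) (biprod.lift 0 T'.mor₂) = 0
    ext <;> simp [hT.zero₂₃, hT'.zero₁₂]
  zero₂₃ := by
    change biprod.desc (biprod.lift (-T.mor₃) φ.hom₃) (biprod.lift 0 T'.mor₂) ≫
      biprod.desc ((biprod.lift (-T.mor₁) φ.hom₁)⟦(1 : ℤ)⟧') (T'.mor₃ ≫ biprod.inr⟦(1 : ℤ)⟧') = 0
    apply shift_biprod_hom_ext <;> ext <;> simp [hT.zero₃₁, hT'.zero₂₃]
  zero₃₁ := by
    change biprod.desc ((biprod.lift (-T.mor₁) φ.hom₁)⟦(1 : ℤ)⟧')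
      (T'.mor₃ ≫ biprod.inr⟦(1 : ℤ)⟧') ≫ (biprod.desc (biprod.lift (-T.mor₂) φ.hom₂)
        (biprod.lift 0 T'.mor₁))⟦(1 : ℤ)⟧' = 0
    ext
    · rw [biprod.inl_desc_assoc, ← Functor.map_comp, comp_zero,
        ← (shiftFunctor C (1 : ℤ)).map_zero]
      congr 1
      ext <;> simp [hT.zero₁₂, φ.comm₁]
    · apply shift_biprod_hom_ext <;> simp [hT'.zero₃₁]

/-- The mapping cones of homotopic morphisms are isomorphic. -/
noncomputable def mappingConeIso {φ ψ : T ⟶ T'} (h : NullHomotopy (φ - ψ)) :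
    mappingCone φ ≅ mappingCone ψ := by
  have e₁ : φ.hom₁⟦(1 : ℤ)⟧' = ψ.hom₁⟦(1 : ℤ)⟧' +
      (T.mor₁⟦(1 : ℤ)⟧' ≫ h.s₁⟦(1 : ℤ)⟧' + h.s₃ ≫ T'.mor₃) := by
    rw [← h.eq₁, Triangle.sub_hom₁, Functor.map_sub]; abel
  have e₂ : φ.hom₂ = ψ.hom₂ + (T.mor₂ ≫ h.s₂ + h.s₁ ≫ T'.mor₁) := by
    rw [← h.eq₂, Triangle.sub_hom₂]; abel
  have e₃ : φ.hom₃ = ψ.hom₃ + (T.mor₃ ≫ h.s₃ + h.s₂ ≫ T'.mor₂) := by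
    rw [← h.eq₃, Triangle.sub_hom₃]; abel
  refine Triangle.isoMk (mappingCone φ) (mappingCone ψ)
    { hom := biprod.desc (biprod.lift (𝟙 _) h.s₁) (biprod.lift 0 (𝟙 _))
      inv := biprod.desc (biprod.lift (𝟙 _) (-h.s₁)) (biprod.lift 0 (𝟙 _))
      hom_inv_id := ?_
      inv_hom_id := ?_ }
    { hom := biprod.desc (biprod.lift (𝟙 _) h.s₂) (biprod.lift 0 (𝟙 _))
      inv := biprod.desc (biprod.lift (𝟙 _) (-h.s₂)) (biprod.lift 0 (𝟙 _))
      hom_inv_id := ?_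
      inv_hom_id := ?_ }
    { hom := biprod.desc (biprod.lift (𝟙 _) h.s₃) (biprod.lift 0 (𝟙 _))
      inv := biprod.desc (biprod.lift (𝟙 _) (-h.s₃)) (biprod.lift 0 (𝟙 _))
      hom_inv_id := ?_
      inv_hom_id := ?_ } ?_ ?_ ?_
  iterate 6 · dsimp only [mappingCone, Triangle.mk]; ext <;> simp
  · dsimp only [mappingCone, Triangle.mk]
    ext <;> simp [e₂]
    abel
  · dsimp only [mappingCone, Triangle.mk]
    ext <;> simp [e₃]
    abel
  · dsimp only [mappingCone, Triangle.mk]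
    apply shift_biprod_hom_ext <;> ext <;> simp [e₁]
    abel

/-- The mapping cone construction preserves deformation retracts. -/
lemma DefRetract.mappingCone (r : DefRetract T X) (r' : DefRetract T' X') (ψ : X ⟶ X') :
    Nonempty (DefRetract (mappingCone (r.p ≫ ψ ≫ r'.i)) (mappingCone ψ)) := by
  -- The homotopy on the cone is diagonal, with entries -s and s'. Its cross terms are s ≫ p ≫ ψ ≫
  -- i' and p ≫ ψ ≫ i' ≫ s', and they vanish for special homotopies with s ≫ p = 0 and i' ≫ s' = 0.
  obtain ⟨r₀, hi, hp, -, -, -, a₁, a₂, a₃⟩ := r.exists_special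
  rw [← hp] at a₁ a₂ a₃ ⊢
  clear hi hp r
  obtain ⟨r₀', hi, hp, b₁, b₂, b₃, -, -, -⟩ := r'.exists_special
  rw [← hi] at b₁ b₂ b₃ ⊢
  clear hi hp r'
  refine ⟨DefRetract.ofMaps (biprod.map r₀.i.hom₂ r₀'.i.hom₁)
      (biprod.map r₀.i.hom₃ r₀'.i.hom₂) (biprod.map (r₀.i.hom₁⟦(1 : ℤ)⟧') r₀'.i.hom₃)
      (biprod.map r₀.p.hom₂ r₀'.p.hom₁)
      (biprod.map r₀.p.hom₃ r₀'.p.hom₂) (biprod.map (r₀.p.hom₁⟦(1 : ℤ)⟧') r₀'.p.hom₃)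
      (biprod.map (-r₀.s₂) r₀'.s₁) (biprod.map (-r₀.s₃) r₀'.s₂)
      (biprod.fst⟦(1 : ℤ)⟧' ≫ (-r₀.s₁⟦(1 : ℤ)⟧') ≫ biprod.inl +
      biprod.snd⟦(1 : ℤ)⟧' ≫ r₀'.s₃ ≫ biprod.inr) ?_ ?_ ?_ ?_ ?_ ?_ ?_ ?_ ?_ ?_ ?_ ?_⟩
  · ext <;> simp
  · ext <;> simp
  · apply shift_biprod_hom_ext <;> ext <;> simp [← Functor.map_comp]
  · ext <;> simp
  · ext <;> simp
  · apply shift_biprod_hom_ext <;> ext <;> simp [← Functor.map_comp]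
  · ext <;> simp
  · ext <;> simp
  · ext <;> simp
  · apply shift_biprod_hom_ext <;> apply shift_biprod_hom_ext' <;> simp
    · simpa using congrArg (fun z => z⟦(1 : ℤ)⟧') r₀.eq₂
    · rw [← Functor.map_comp _ r₀'.i.hom₂, b₁, ← Functor.map_comp_assoc _ r₀.s₁, a₁]
      simp
    · simpa using r₀'.eq₁
  · ext <;> simp
    · simpa using r₀.eq₃
    · rw [b₂, reassoc_of% a₂]
      simp
    · simpa using r₀'.eq₂
  · ext <;> simp
    · simpa using r₀.eq₁
    · rw [b₃, reassoc_of% a₃]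
      simp
    · simpa using r₀'.eq₃

end cone
end CategoryTheory.Pretriangulated

/-! ### Model classes and the morphisms between the triangles they generate -/

namespace CategoryTheory.Pretriangulated

variable {C : Type*} [Category C] [Preadditive C] [HasShift C ℤ]

section exactness

variable {T X : Triangle C}

/-- The homotopy writes w as a multiple of `T.mor₂` plus a map factoring through the retract, where
the weak cokernel property is assumed. So this property passes from X up to T. -/
lemma DefRetract.exists_desc (r : DefRetract T X)
    (hX : ∀ {P : C} (w : X.obj₂ ⟶ P), X.mor₁ ≫ w = 0 → ∃ v, X.mor₂ ≫ v = w)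
    {P : C} (w : T.obj₂ ⟶ P) (hw : T.mor₁ ≫ w = 0) : ∃ v, T.mor₂ ≫ v = w := by
  obtain ⟨v, hv⟩ := hX (r.i.hom₂ ≫ w) (by rw [r.i.comm₁_assoc, hw, comp_zero])
  refine ⟨r.s₂ ≫ w + r.p.hom₃ ≫ v, ?_⟩
  have h := congrArg (· ≫ w) r.eq₂
  simp only [Preadditive.add_comp, Category.assoc, hw, comp_zero, add_zero,
    Category.id_comp] at h
  rw [Preadditive.comp_add, r.p.comm₂_assoc, hv, h]

/-- Dual argument: the weak kernel property of the third map passes from the retract to the whole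
complex. -/
lemma DefRetract.exists_lift (r : DefRetract T X)
    (hX : ∀ {P : C} (w : P ⟶ X.obj₁⟦(1 : ℤ)⟧), w ≫ X.mor₁⟦(1 : ℤ)⟧' = 0 → ∃ v, v ≫ X.mor₃ = w)
    {P : C} (w : P ⟶ T.obj₁⟦(1 : ℤ)⟧) (hw : w ≫ T.mor₁⟦(1 : ℤ)⟧' = 0) : ∃ v, v ≫ T.mor₃ = w := by
  obtain ⟨v, hv⟩ := hX (w ≫ r.p.hom₁⟦(1 : ℤ)⟧') (by
    rw [Category.assoc, ← Functor.map_comp, ← r.p.comm₁, Functor.map_comp, reassoc_of% hw,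
      zero_comp])
  refine ⟨w ≫ r.s₃ + v ≫ r.i.hom₃, ?_⟩
  have h := congrArg (w ≫ ·) r.eq₁
  simp only [Preadditive.comp_add, reassoc_of% hw, zero_comp, zero_add, Functor.map_comp,
    Category.comp_id] at h
  rw [Preadditive.add_comp, Category.assoc, Category.assoc, ← r.i.comm₃, reassoc_of% hv, h]

end exactness

/-- A complex which has a deformation retract in the class `𝒳`. -/
def Elementary (𝒳 : Set (Triangle C)) (T : Triangle C) : Prop :=
  IsComplex T ∧ ∃ X ∈ 𝒳, Nonempty (DefRetract T X)

/-- The deformation retracts of complexes which have a deformation retract in the class `𝒳`. -/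
def modelTriangles (𝒳 : Set (Triangle C)) : Set (Triangle C) :=
  {T | ∃ T₀, Elementary 𝒳 T₀ ∧ Nonempty (DefRetract T₀ T)}

lemma isComplex_of_mem_modelTriangles {𝒳 : Set (Triangle C)} {T : Triangle C}
    (h : T ∈ modelTriangles 𝒳) : IsComplex T := by
  obtain ⟨T₀, h₀, ⟨r₀⟩⟩ := h
  exact r₀.isComplex h₀.1

variable [∀ n : ℤ, (shiftFunctor C n).Additive]

lemma Elementary.mem {𝒳 : Set (Triangle C)} {T : Triangle C} (h : Elementary 𝒳 T) :
    T ∈ modelTriangles 𝒳 :=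
  ⟨T, h, ⟨DefRetract.ofIso (Iso.refl T)⟩⟩

/-- Elementary complexes are closed upwards along retractions, and `modelTriangles` downwards; the
two-step definition is made to have both closures. -/
lemma Elementary.of_defRetract {𝒳 : Set (Triangle C)} {T T' : Triangle C} (hT : IsComplex T)
    (r : DefRetract T T') (h : Elementary 𝒳 T') : Elementary 𝒳 T := by
  obtain ⟨-, X, hX, ⟨r'⟩⟩ := h
  exact ⟨hT, X, hX, ⟨r.trans r'⟩⟩

lemma mem_modelTriangles_of_defRetract {𝒳 : Set (Triangle C)} {T T' : Triangle C}
    (h : T ∈ modelTriangles 𝒳) (r : DefRetract T T') : T' ∈ modelTriangles 𝒳 := by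
  obtain ⟨T₀, h₀, ⟨r₀⟩⟩ := h
  exact ⟨T₀, h₀, ⟨r₀.trans r⟩⟩

variable [HasBinaryBiproducts C]

/-- A class of triangles which are models, up to contractible complexes, for the distinguished
triangles of a triangulated structure. -/
structure IsTriangleModel (𝒳 : Set (Triangle C)) : Prop where
  exists_isZero : ∃ X ∈ 𝒳, IsZero X.obj₁ ∧ IsZero X.obj₂ ∧ IsZero X.obj₃
  rotate : ∀ X ∈ 𝒳, ∃ X' ∈ 𝒳, Nonempty (X.rotate ≅ X')
  exists_rotate_iso : ∀ X ∈ 𝒳, ∃ X' ∈ 𝒳, Nonempty (X ≅ X'.rotate)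
  lift : ∀ X ∈ 𝒳, ∀ {P : C} (w : P ⟶ X.obj₁⟦(1 : ℤ)⟧), w ≫ X.mor₁⟦(1 : ℤ)⟧' = 0 →
    ∃ v, v ≫ X.mor₃ = w
  desc : ∀ X ∈ 𝒳, ∀ {P : C} (w : X.obj₂ ⟶ P), X.mor₁ ≫ w = 0 → ∃ v, X.mor₂ ≫ v = w
  exists_triangle : ∀ {A B : C} (f : A ⟶ B), ∃ (E : C) (g : B ⟶ E) (h : E ⟶ A⟦(1 : ℤ)⟧),
    Elementary 𝒳 (Triangle.mk f g h)
  exists_hom : ∀ X ∈ 𝒳, ∀ X' ∈ 𝒳, ∀ (φ₁ : X.obj₁ ⟶ X'.obj₁) (φ₂ : X.obj₂ ⟶ X'.obj₂),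
    X.mor₁ ≫ φ₂ = φ₁ ≫ X'.mor₁ → ∃ ψ : X ⟶ X', ψ.hom₁ = φ₁ ∧ ψ.hom₂ = φ₂ ∧
      Elementary 𝒳 (mappingCone ψ)

namespace IsTriangleModel

variable {𝒳 : Set (Triangle C)} (h𝒳 : IsTriangleModel 𝒳)
include h𝒳

/-- The square is compressed to the models and filled there by ψ. The given maps differ from those
induced by ψ by a pair δ which is null on the models, and such a pair extends to a null-homotopic
morphism. The filling is thus homotopic to the one induced by ψ, and its cone retracts onto the cone
of ψ. -/
lemma exists_hom_of_elementary {T T' : Triangle C} (hT : Elementary 𝒳 T) (hT' : Elementary 𝒳 T')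
    (φ₁ : T.obj₁ ⟶ T'.obj₁) (φ₂ : T.obj₂ ⟶ T'.obj₂) (comm : T.mor₁ ≫ φ₂ = φ₁ ≫ T'.mor₁) :
    ∃ φ : T ⟶ T', φ.hom₁ = φ₁ ∧ φ.hom₂ = φ₂ ∧ Elementary 𝒳 (mappingCone φ) := by
  obtain ⟨cT, X, hX, ⟨r⟩⟩ := hT
  obtain ⟨cT', X', hX', ⟨r'⟩⟩ := hT'
  obtain ⟨ψ, hψ₁, hψ₂, hψ⟩ := h𝒳.exists_hom X hX X' hX' (r.i.hom₁ ≫ φ₁ ≫ r'.p.hom₁)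
    (r.i.hom₂ ≫ φ₂ ≫ r'.p.hom₂) (by
      rw [r.i.comm₁_assoc, reassoc_of% comm, r'.p.comm₁, Category.assoc, Category.assoc])
  obtain ⟨δ₁, hδ₁⟩ : ∃ δ, δ = φ₁ - r.p.hom₁ ≫ ψ.hom₁ ≫ r'.i.hom₁ := ⟨_, rfl⟩
  obtain ⟨δ₂, hδ₂⟩ : ∃ δ, δ = φ₂ - r.p.hom₂ ≫ ψ.hom₂ ≫ r'.i.hom₂ := ⟨_, rfl⟩
  have cδ : T.mor₁ ≫ δ₂ = δ₁ ≫ T'.mor₁ := by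
    rw [hδ₁, hδ₂, Preadditive.comp_sub, Preadditive.sub_comp, comm, r.p.comm₁_assoc,
      ψ.comm₁_assoc, r'.i.comm₁]
    simp only [Category.assoc]
  have z₁ : r.i.hom₁ ≫ δ₁ ≫ r'.p.hom₁ = 0 := by
    simp [hδ₁, hψ₁, Preadditive.sub_comp, Preadditive.comp_sub]
  have z₂ : r.i.hom₂ ≫ δ₂ ≫ r'.p.hom₂ = 0 := by
    simp [hδ₂, hψ₂, Preadditive.sub_comp, Preadditive.comp_sub]
  -- A homotopy for δ would involve a third component δ₃, which does not exist yet. The exactness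
  -- properties supply substitutes: t₃ for s₃ ≫ δ₃, and t₂ for p₃ ≫ i₃ ≫ δ₃ ≫ s₂'.
  obtain ⟨t₃, ht₃⟩ := r'.exists_lift (h𝒳.lift X' hX') (r.s₃ ≫ T.mor₃ ≫ δ₁⟦(1 : ℤ)⟧') (by
    rw [Category.assoc, Category.assoc, ← Functor.map_comp, ← cδ, Functor.map_comp,
      cT.zero₃₁_assoc, comp_zero])
  obtain ⟨t₂, ht₂⟩ := r.exists_desc (h𝒳.desc X hX)
    (r.p.hom₂ ≫ r.i.hom₂ ≫ δ₂ ≫ T'.mor₂ ≫ r'.s₂) (by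
      rw [r.p.comm₁_assoc, r.i.comm₁_assoc, reassoc_of% cδ, cT'.zero₁₂_assoc, comp_zero,
        comp_zero, comp_zero])
  let u₁ : T.obj₂ ⟶ T'.obj₁ := r.s₁ ≫ δ₁ + r.p.hom₂ ≫ r.i.hom₂ ≫ δ₂ ≫ r'.s₁
  let u₂ : T.obj₃ ⟶ T'.obj₂ := r.s₂ ≫ δ₂ + t₂
  let u₃ : T.obj₁⟦(1 : ℤ)⟧ ⟶ T'.obj₃ :=
    t₃ + r.p.hom₁⟦(1 : ℤ)⟧' ≫ r.i.hom₁⟦(1 : ℤ)⟧' ≫ δ₁⟦(1 : ℤ)⟧' ≫ r'.s₃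
  have e₁ : δ₁⟦(1 : ℤ)⟧' = T.mor₁⟦(1 : ℤ)⟧' ≫ u₁⟦(1 : ℤ)⟧' + u₃ ≫ T'.mor₃ := by
    have a := congrArg (· ≫ δ₁⟦(1 : ℤ)⟧') r.eq₁
    have b := congrArg (r.p.hom₁⟦(1 : ℤ)⟧' ≫ r.i.hom₁⟦(1 : ℤ)⟧' ≫ δ₁⟦(1 : ℤ)⟧' ≫ ·) r'.eq₁
    have z := congrArg (fun z => z⟦(1 : ℤ)⟧') z₁
    have c := congrArg (fun z => z⟦(1 : ℤ)⟧') cδ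
    have p₁ := congrArg (fun z => z⟦(1 : ℤ)⟧') r.p.comm₁
    have i₁ := congrArg (fun z => z⟦(1 : ℤ)⟧') r.i.comm₁
    simp only [Functor.map_comp, Functor.map_zero] at z c p₁ i₁
    simp only [Preadditive.add_comp, Preadditive.comp_add, Category.assoc, Category.id_comp,
      Category.comp_id, Functor.map_comp, reassoc_of% z, zero_comp, add_zero] at a b
    simp only [u₁, u₃, Preadditive.add_comp, Preadditive.comp_add, Functor.map_add,
      Functor.map_comp, Category.assoc, ht₃, reassoc_of% p₁, reassoc_of% i₁, reassoc_of% c]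
    rw [← b] at a
    refine a.symm.trans ?_
    abel
  have e₂ : δ₂ = T.mor₂ ≫ u₂ + u₁ ≫ T'.mor₁ := by
    have a := congrArg (· ≫ δ₂) r.eq₂
    have b := congrArg (r.p.hom₂ ≫ r.i.hom₂ ≫ δ₂ ≫ ·) r'.eq₂
    simp only [Preadditive.add_comp, Preadditive.comp_add, Category.assoc, Category.id_comp,
      Category.comp_id, reassoc_of% z₂, zero_comp, add_zero] at a b
    simp only [u₁, u₂, Preadditive.add_comp, Preadditive.comp_add, Category.assoc, ht₂]
    rw [← b] at a
    refine a.symm.trans ?_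
    rw [cδ]
    abel
  let φ : T ⟶ T' :=
    { hom₁ := φ₁
      hom₂ := φ₂
      -- The third component is the one dictated by the homotopy, so that its third equation holds
      -- by definition.
      hom₃ := r.p.hom₃ ≫ ψ.hom₃ ≫ r'.i.hom₃ + (T.mor₃ ≫ u₃ + u₂ ≫ T'.mor₂)
      comm₁ := comm
      comm₂ := by
        have h : φ₂ = δ₂ + r.p.hom₂ ≫ ψ.hom₂ ≫ r'.i.hom₂ := by rw [hδ₂]; abel
        rw [h, e₂]
        simp only [Preadditive.add_comp, Preadditive.comp_add, Category.assoc,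
          cT.zero₂₃_assoc, cT'.zero₁₂, comp_zero, r.p.comm₂_assoc, ψ.comm₂_assoc, r'.i.comm₂]
        abel
      comm₃ := by
        have h : φ₁ = δ₁ + r.p.hom₁ ≫ ψ.hom₁ ≫ r'.i.hom₁ := by rw [hδ₁]; abel
        rw [h, Functor.map_add, e₁]
        simp only [Preadditive.add_comp, Preadditive.comp_add, Category.assoc, Functor.map_comp,
          cT.zero₃₁_assoc, cT'.zero₂₃, comp_zero, r.p.comm₃_assoc, ψ.comm₃_assoc, r'.i.comm₃]
        abel }
  have H : NullHomotopy (φ - r.p ≫ ψ ≫ r'.i) :=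
    { s₁ := u₁
      s₂ := u₂
      s₃ := u₃
      eq₁ := by rw [← e₁, hδ₁]; rfl
      eq₂ := by rw [← e₂, hδ₂]; rfl
      eq₃ := add_sub_cancel_left _ _ }
  obtain ⟨ρ⟩ := r.mappingCone r' ψ
  exact ⟨φ, rfl, rfl, Elementary.of_defRetract (mappingCone_isComplex φ cT cT')
    ((DefRetract.ofIso (mappingConeIso H)).trans ρ) hψ⟩

/-- The square is extended to the ambient elementary complexes, filled by Φ, and compressed to φ = i
≫ Φ ≫ p'. Both p ≫ i and p' ≫ i' are homotopic to identities, so Φ is homotopic to p ≫ φ ≫ i', and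
the cone of Φ, up to isomorphism, retracts onto that of φ. -/
lemma exists_hom_of_mem {T T' : Triangle C} (hT : T ∈ modelTriangles 𝒳)
    (hT' : T' ∈ modelTriangles 𝒳)
    (φ₁ : T.obj₁ ⟶ T'.obj₁) (φ₂ : T.obj₂ ⟶ T'.obj₂) (comm : T.mor₁ ≫ φ₂ = φ₁ ≫ T'.mor₁) :
    ∃ φ : T ⟶ T', φ.hom₁ = φ₁ ∧ φ.hom₂ = φ₂ ∧ mappingCone φ ∈ modelTriangles 𝒳 := by
  obtain ⟨T₀, hT₀, ⟨r⟩⟩ := hT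
  obtain ⟨T₀', hT₀', ⟨r'⟩⟩ := hT'
  obtain ⟨Φ, hΦ₁, hΦ₂, hΦ⟩ := h𝒳.exists_hom_of_elementary hT₀ hT₀'
    (r.p.hom₁ ≫ φ₁ ≫ r'.i.hom₁) (r.p.hom₂ ≫ φ₂ ≫ r'.i.hom₂) (by
      rw [r.p.comm₁_assoc, reassoc_of% comm, r'.i.comm₁, Category.assoc, Category.assoc])
  have e₁ : r.i.hom₁ ≫ Φ.hom₁ ≫ r'.p.hom₁ = φ₁ := by simp [hΦ₁]
  have e₂ : r.i.hom₂ ≫ Φ.hom₂ ≫ r'.p.hom₂ = φ₂ := by simp [hΦ₂]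
  let φ : T ⟶ T' := r.i ≫ Φ ≫ r'.p
  have H : NullHomotopy (Φ - r.p ≫ φ ≫ r'.i) :=
    { s₁ := r.s₁ ≫ Φ.hom₁ + r.p.hom₂ ≫ r.i.hom₂ ≫ Φ.hom₂ ≫ r'.s₁
      s₂ := r.s₂ ≫ Φ.hom₂ + r.p.hom₃ ≫ r.i.hom₃ ≫ Φ.hom₃ ≫ r'.s₂
      s₃ := r.s₃ ≫ Φ.hom₃ + r.p.hom₁⟦(1 : ℤ)⟧' ≫ r.i.hom₁⟦(1 : ℤ)⟧' ≫ Φ.hom₁⟦(1 : ℤ)⟧' ≫ r'.s₃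
      eq₁ := by
        have a := congrArg (· ≫ Φ.hom₁⟦(1 : ℤ)⟧') r.eq₁
        have b := congrArg
          (r.p.hom₁⟦(1 : ℤ)⟧' ≫ r.i.hom₁⟦(1 : ℤ)⟧' ≫ Φ.hom₁⟦(1 : ℤ)⟧' ≫ ·) r'.eq₁
        have c := congrArg (fun z => z⟦(1 : ℤ)⟧') Φ.comm₁
        have p₁ := congrArg (fun z => z⟦(1 : ℤ)⟧') r.p.comm₁
        have i₁ := congrArg (fun z => z⟦(1 : ℤ)⟧') r.i.comm₁
        simp only [Functor.map_comp] at c p₁ i₁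
        simp only [Preadditive.add_comp, Preadditive.comp_add, Category.assoc, Category.id_comp,
          Category.comp_id, Functor.map_comp] at a b
        simp only [Preadditive.add_comp, Preadditive.comp_add, Functor.map_add, Triangle.sub_hom₁,
          comp_hom₁, φ, Functor.map_sub,
          Functor.map_comp, Category.assoc, reassoc_of% p₁, reassoc_of% i₁, reassoc_of% c]
        rw [← Φ.comm₃, sub_eq_iff_eq_add]
        rw [← b] at a
        refine a.symm.trans ?_
        abel
      eq₂ := by
        have a := congrArg (· ≫ Φ.hom₂) r.eq₂
        have b := congrArg (r.p.hom₂ ≫ r.i.hom₂ ≫ Φ.hom₂ ≫ ·) r'.eq₂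
        simp only [Preadditive.add_comp, Preadditive.comp_add, Category.assoc, Category.id_comp,
          Category.comp_id] at a b
        simp only [Preadditive.add_comp, Preadditive.comp_add, Triangle.sub_hom₂,
          comp_hom₂, φ, Category.assoc, r.p.comm₂_assoc, r.i.comm₂_assoc, Φ.comm₂_assoc]
        rw [← Φ.comm₁, sub_eq_iff_eq_add]
        rw [← b] at a
        refine a.symm.trans ?_
        abel
      eq₃ := by
        have a := congrArg (· ≫ Φ.hom₃) r.eq₃
        have b := congrArg (r.p.hom₃ ≫ r.i.hom₃ ≫ Φ.hom₃ ≫ ·) r'.eq₃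
        simp only [Preadditive.add_comp, Preadditive.comp_add, Category.assoc, Category.id_comp,
          Category.comp_id] at a b
        simp only [Preadditive.add_comp, Preadditive.comp_add, Triangle.sub_hom₃,
          comp_hom₃, φ, Category.assoc, r.p.comm₃_assoc, r.i.comm₃_assoc, Φ.comm₃_assoc]
        rw [← Φ.comm₂, sub_eq_iff_eq_add]
        rw [← b] at a
        refine a.symm.trans ?_
        abel }
  obtain ⟨ρ⟩ := r.mappingCone r' φ
  exact ⟨φ, e₁, e₂, mem_modelTriangles_of_defRetract hΦ.mem
    ((DefRetract.ofIso (mappingConeIso H)).trans ρ)⟩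

lemma rotate_mem {T : Triangle C} (hT : T ∈ modelTriangles 𝒳) : T.rotate ∈ modelTriangles 𝒳 := by
  obtain ⟨T₀, ⟨c, X, hX, ⟨r⟩⟩, ⟨r₀⟩⟩ := hT
  obtain ⟨X', hX', ⟨e⟩⟩ := h𝒳.rotate X hX
  refine ⟨T₀.rotate, ⟨⟨c.zero₂₃, ?_, ?_⟩, X', hX', ⟨r.rotate.trans (DefRetract.ofIso e)⟩⟩,
    ⟨r₀.rotate⟩⟩
  · change T₀.mor₃ ≫ (-T₀.mor₁⟦(1 : ℤ)⟧') = 0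
    rw [Preadditive.comp_neg, c.zero₃₁, neg_zero]
  · change (-T₀.mor₁⟦(1 : ℤ)⟧') ≫ T₀.mor₂⟦(1 : ℤ)⟧' = 0
    rw [Preadditive.neg_comp, ← Functor.map_comp, c.zero₁₂, Functor.map_zero, neg_zero]

/-- The ambient complex is rotated back, and both retractions are descended with
`nonempty_of_rotate`; models being rotations of models up to isomorphism makes the inverse rotation
elementary again. -/
lemma mem_of_rotate_mem {T : Triangle C} (hT : T.rotate ∈ modelTriangles 𝒳) :
    T ∈ modelTriangles 𝒳 := by
  obtain ⟨T₀, ⟨c, X, hX, ⟨r⟩⟩, ⟨r₀⟩⟩ := hT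
  obtain ⟨X', hX', ⟨e⟩⟩ := h𝒳.exists_rotate_iso X hX
  let e₀ : T₀.invRotate.rotate ≅ T₀ := invRotCompRot.app T₀
  let ρ : DefRetract T₀.invRotate.rotate T.rotate := (DefRetract.ofIso e₀).trans r₀
  let ρ' : DefRetract T₀.invRotate.rotate X'.rotate :=
    (DefRetract.ofIso e₀).trans (r.trans (DefRetract.ofIso e))
  obtain ⟨σ⟩ := ρ.nonempty_of_rotate
  obtain ⟨σ'⟩ := ρ'.nonempty_of_rotate
  have c' : IsComplex T₀.invRotate.rotate := (DefRetract.ofIso e₀.symm).isComplex c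
  refine ⟨T₀.invRotate, ⟨⟨(shiftFunctor C (1 : ℤ)).map_injective ?_, c'.zero₁₂, ?_⟩,
    X', hX', ⟨σ'⟩⟩, ⟨σ⟩⟩
  · have h : (-T₀.invRotate.mor₁⟦(1 : ℤ)⟧') ≫ T₀.invRotate.mor₂⟦(1 : ℤ)⟧' = 0 := c'.zero₃₁
    rw [Functor.map_comp, Functor.map_zero, ← neg_eq_zero, ← Preadditive.neg_comp]
    exact h
  · have h : T₀.invRotate.mor₃ ≫ (-T₀.invRotate.mor₁⟦(1 : ℤ)⟧') = 0 := c'.zero₂₃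
    rw [← neg_eq_zero, ← Preadditive.comp_neg]
    exact h

end IsTriangleModel
end CategoryTheory.Pretriangulated

/-! ### Homotopy cartesian squares, the octahedron and the triangulated structure -/

namespace CategoryTheory.Pretriangulated

variable {C : Type*} [Category C] [Preadditive C] [HasShift C ℤ]
  [∀ n : ℤ, (shiftFunctor C n).Additive]

/-- Contractible complexes are elementary. -/
lemma elementary_of_contraction {𝒳 : Set (Triangle C)}
    (h𝒳 : ∃ X ∈ 𝒳, IsZero X.obj₁ ∧ IsZero X.obj₂ ∧ IsZero X.obj₃) {T : Triangle C} (hT : IsComplex T)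
    (s₁ : T.obj₂ ⟶ T.obj₁) (s₂ : T.obj₃ ⟶ T.obj₂) (s₃ : T.obj₁⟦(1 : ℤ)⟧ ⟶ T.obj₃)
    (e₁ : T.mor₁⟦(1 : ℤ)⟧' ≫ s₁⟦(1 : ℤ)⟧' + s₃ ≫ T.mor₃ = 𝟙 _)
    (e₂ : T.mor₂ ≫ s₂ + s₁ ≫ T.mor₁ = 𝟙 _) (e₃ : T.mor₃ ≫ s₃ + s₂ ≫ T.mor₂ = 𝟙 _) :
    Elementary 𝒳 T := by
  obtain ⟨X, hX, z₁, z₂, z₃⟩ := h𝒳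
  let r : DefRetract T X :=
    { i := 0
      p := 0
      i_p := Triangle.hom_ext _ _ (z₁.eq_of_src _ _) (z₂.eq_of_src _ _) (z₃.eq_of_src _ _)
      s₁ := s₁
      s₂ := s₂
      s₃ := s₃
      eq₁ := by rw [Triangle.zero_hom₁, zero_comp, Functor.map_zero, add_zero, e₁]
      eq₂ := by rw [Triangle.zero_hom₂, zero_comp, add_zero, e₂]
      eq₃ := by rw [Triangle.zero_hom₃, zero_comp, add_zero, e₃] }
  exact ⟨hT, X, hX, ⟨r⟩⟩

lemma elementary_mk_of_contraction {𝒳 : Set (Triangle C)}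
    (h𝒳 : ∃ X ∈ 𝒳, IsZero X.obj₁ ∧ IsZero X.obj₂ ∧ IsZero X.obj₃)
    {A B E : C} {f : A ⟶ B} {g : B ⟶ E} {h : E ⟶ A⟦(1 : ℤ)⟧}
    (z₁ : f ≫ g = 0) (z₂ : g ≫ h = 0) (z₃ : h ≫ f⟦(1 : ℤ)⟧' = 0)
    (s₁ : B ⟶ A) (s₂ : E ⟶ B) (s₃ : A⟦(1 : ℤ)⟧ ⟶ E)
    (e₁ : f⟦(1 : ℤ)⟧' ≫ s₁⟦(1 : ℤ)⟧' + s₃ ≫ h = 𝟙 _)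
    (e₂ : g ≫ s₂ + s₁ ≫ f = 𝟙 _) (e₃ : h ≫ s₃ + s₂ ≫ g = 𝟙 _) :
    Elementary 𝒳 (Triangle.mk f g h) :=
  elementary_of_contraction h𝒳 ⟨z₁, z₂, z₃⟩ s₁ s₂ s₃ e₁ e₂ e₃

variable [HasBinaryBiproducts C]

namespace IsTriangleModel

variable {𝒳 : Set (Triangle C)} (h𝒳 : IsTriangleModel 𝒳)
include h𝒳

/-- Every commutative square from a map `f : X ⟶ Y` to a map `f' : X ⟶ Y'` which is the identity
on `X` can be completed to a homotopy cartesian square on the cones. -/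
lemma exists_homotopyCartesian {X Y Z Y' Z' : C} {f : X ⟶ Y} {g : Y ⟶ Z} {h : Z ⟶ X⟦(1 : ℤ)⟧}
    {f' : X ⟶ Y'} {g' : Y' ⟶ Z'} {h' : Z' ⟶ X⟦(1 : ℤ)⟧}
    (hT : Triangle.mk f g h ∈ modelTriangles 𝒳) (hT' : Triangle.mk f' g' h' ∈ modelTriangles 𝒳)
    (q : Y ⟶ Y') (hq : f ≫ q = f') :
    ∃ m : Z ⟶ Z', g ≫ m = q ≫ g' ∧ m ≫ h' = h ∧
      Triangle.mk (biprod.lift (-g) q) (biprod.desc m g') (h' ≫ f⟦(1 : ℤ)⟧') ∈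
        modelTriangles 𝒳 := by
  obtain ⟨m, c₂, c₃, hφ⟩ : ∃ m : Z ⟶ Z', g ≫ m = q ≫ g' ∧ h = m ≫ h' ∧
      Triangle.mk (X := Y ⊞ X) (Y := Z ⊞ Y') (Z := X⟦(1 : ℤ)⟧ ⊞ Z')
        (biprod.desc (biprod.lift (-g) q) (biprod.lift 0 f'))
        (biprod.desc (biprod.lift (-h) m) (biprod.lift 0 g'))
        (biprod.desc ((biprod.lift (-f) (𝟙 X))⟦(1 : ℤ)⟧') (h' ≫ biprod.inr⟦(1 : ℤ)⟧')) ∈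
          modelTriangles 𝒳 := by
    obtain ⟨⟨a, b, m, c₁, c₂, c₃⟩, ha, hb, hφ⟩ := h𝒳.exists_hom_of_mem hT hT' (𝟙 X) q
      (hq.trans (Category.id_comp f').symm)
    obtain rfl : a = 𝟙 X := ha
    obtain rfl : b = q := hb
    refine ⟨m, c₂, ?_, hφ⟩
    rw [← Category.comp_id h, ← Functor.map_id]
    exact c₃
  have z₁ : f ≫ g = 0 := (isComplex_of_mem_modelTriangles hT).zero₁₂
  have z₂ : g' ≫ h' = 0 := (isComplex_of_mem_modelTriangles hT').zero₂₃
  have z₃ : h ≫ f⟦(1 : ℤ)⟧' = 0 := (isComplex_of_mem_modelTriangles hT).zero₃₁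
  -- Gaussian elimination: the cone of (𝟙, q, m) contains an identity component on X⟦1⟧. Cancelling
  -- it removes X from the first object and X⟦1⟧ from the third.
  refine ⟨m, c₂, c₃.symm, mem_modelTriangles_of_defRetract hφ
    (DefRetract.ofMaps biprod.inl (𝟙 _) (biprod.lift (-h') (𝟙 _)) (biprod.desc (𝟙 _) f) (𝟙 _)
      biprod.snd 0 0 (biprod.snd⟦(1 : ℤ)⟧' ≫ biprod.inl) ?_ ?_ ?_ ?_ ?_ ?_ ?_ ?_ ?_ ?_ ?_ ?_)⟩
  · simp
  · ext <;> simp [c₃, z₂]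
  · apply shift_biprod_hom_ext <;> simp
  · ext <;> simp [hq, z₁]
  · ext <;> simp
  · ext <;> simp
  · simp
  · simp
  · simp
  · apply shift_biprod_hom_ext <;> apply shift_biprod_hom_ext' <;> simp
  · simp
  · ext <;> simp

/-- The composition of two maps can be completed to an octahedron. -/
lemma exists_octahedron {X₁ X₂ X₃ Z₁₂ Z₂₃ Z₁₃ : C}
    {u₁₂ : X₁ ⟶ X₂} {u₂₃ : X₂ ⟶ X₃} {u₁₃ : X₁ ⟶ X₃} (comm : u₁₂ ≫ u₂₃ = u₁₃)
    {v₁₂ : X₂ ⟶ Z₁₂} {w₁₂ : Z₁₂ ⟶ X₁⟦(1 : ℤ)⟧}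
    (h₁₂ : Triangle.mk u₁₂ v₁₂ w₁₂ ∈ modelTriangles 𝒳)
    {v₂₃ : X₃ ⟶ Z₂₃} {w₂₃ : Z₂₃ ⟶ X₂⟦(1 : ℤ)⟧}
    (h₂₃ : Triangle.mk u₂₃ v₂₃ w₂₃ ∈ modelTriangles 𝒳)
    {v₁₃ : X₃ ⟶ Z₁₃} {w₁₃ : Z₁₃ ⟶ X₁⟦(1 : ℤ)⟧}
    (h₁₃ : Triangle.mk u₁₃ v₁₃ w₁₃ ∈ modelTriangles 𝒳) :
    ∃ (m₁ : Z₁₂ ⟶ Z₁₃) (m₃ : Z₁₃ ⟶ Z₂₃), v₁₂ ≫ m₁ = u₂₃ ≫ v₁₃ ∧ m₁ ≫ w₁₃ = w₁₂ ∧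
      v₁₃ ≫ m₃ = v₂₃ ∧ w₁₃ ≫ u₁₂⟦(1 : ℤ)⟧' = m₃ ≫ w₂₃ ∧
      Triangle.mk m₁ m₃ (w₂₃ ≫ v₁₂⟦(1 : ℤ)⟧') ∈ modelTriangles 𝒳 := by
  obtain ⟨m₁, a₁, a₂, h₁⟩ := h𝒳.exists_homotopyCartesian h₁₂ h₁₃ u₂₃ comm
  -- The first square gives a triangle X₂ ⟶ Z₁₂ ⊞ X₃ ⟶ Z₁₃. Comparing it with the triangle on u₂₃
  -- along the projection to X₃ gives Z₁₂ ⊞ X₃ ⟶ Z₁₃ ⊞ X₃ ⟶ Z₂₃, and cancelling X₃ leaves the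
  -- required triangle.
  obtain ⟨m₃, b₁, b₂, h₃⟩ := h𝒳.exists_homotopyCartesian h₁ h₂₃ biprod.snd (by simp)
  have c₁ : m₁ ≫ m₃ = 0 := by simpa using biprod.inl ≫= b₁
  have c₂ : v₁₃ ≫ m₃ = v₂₃ := by simpa using biprod.inr ≫= b₁
  have z : w₂₃ ≫ u₂₃⟦(1 : ℤ)⟧' = 0 := (isComplex_of_mem_modelTriangles h₂₃).zero₃₁
  refine ⟨m₁, m₃, a₁, a₂, c₂, b₂.symm, mem_modelTriangles_of_defRetract h₃
    (DefRetract.ofMaps (-biprod.inl) biprod.inl (𝟙 _) (-biprod.fst) (biprod.desc (𝟙 _) v₁₃) (𝟙 _)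
      (biprod.snd ≫ biprod.inr) 0 0 ?_ ?_ ?_ ?_ ?_ ?_ ?_ ?_ ?_ ?_ ?_ ?_)⟩
  · ext <;> simp
  · simp
  · apply shift_biprod_hom_ext <;> simp [z]
  · ext <;> simp
  · ext <;> simp [c₂]
  · simp
  · simp
  · simp
  · simp
  · apply shift_biprod_hom_ext <;> apply shift_biprod_hom_ext' <;> simp
  · ext <;> simp
  · simp

lemma mk_id_mem (X : C) {Z : C} (hZ : IsZero Z) :
    Triangle.mk (𝟙 X) (0 : X ⟶ Z) 0 ∈ modelTriangles 𝒳 := by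
  refine (elementary_mk_of_contraction h𝒳.exists_isZero comp_zero comp_zero zero_comp (𝟙 X) 0 0
    ?_ ?_ (hZ.eq_of_src _ _)).mem <;> simp

variable (C) in
/-- A class of model triangles determines a triangulated structure. -/
theorem exists_isTriangulated [HasZeroObject C] :
    ∃ _ : Pretriangulated C, IsTriangulated C := by
  let P : Pretriangulated C :=
    { distinguishedTriangles := modelTriangles 𝒳
      isomorphic_distinguished := fun T₁ h₁ T₂ e =>
        mem_modelTriangles_of_defRetract h₁ (DefRetract.ofIso e.symm)
      contractible_distinguished := fun X => h𝒳.mk_id_mem X (isZero_zero C)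
      distinguished_cocone_triangle := fun f => by
        obtain ⟨E, g, h, hE⟩ := h𝒳.exists_triangle f
        exact ⟨E, g, h, hE.mem⟩
      rotate_distinguished_triangle := fun T =>
        ⟨fun hT => h𝒳.rotate_mem hT, fun hT => h𝒳.mem_of_rotate_mem hT⟩
      complete_distinguished_triangle_morphism := fun T₁ T₂ h₁ h₂ a b c => by
        obtain ⟨φ, rfl, rfl, -⟩ := h𝒳.exists_hom_of_mem h₁ h₂ a b c
        exact ⟨φ.hom₃, φ.comm₂, φ.comm₃⟩ }
  refine ⟨P, ⟨fun comm _ _ h₁₂ _ _ h₂₃ _ _ h₁₃ => ?_⟩⟩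
  obtain ⟨m₁, m₃, c₁, c₂, c₃, c₄, hm⟩ := h𝒳.exists_octahedron comm h₁₂ h₂₃ h₁₃
  exact ⟨⟨m₁, m₃, c₁, c₂, c₃, c₄, hm⟩⟩

end IsTriangleModel
end CategoryTheory.Pretriangulated

/-! ### The split case: every map von Neumann regular -/

namespace CategoryTheory.Pretriangulated

variable {C : Type*} [Category C] [Preadditive C] [HasBinaryBiproducts C]

lemma isZero_biprod {A B : C} (hA : IsZero A) (hB : IsZero B) : IsZero (A ⊞ B) := by
  rw [IsZero.iff_id_eq_zero]
  exact biprod.hom_ext' _ _ (hA.eq_of_src _ _) (hB.eq_of_src _ _)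

variable [HasShift C ℤ] [∀ n : ℤ, (shiftFunctor C n).Additive]

/-- If the idempotents split and every map is von Neumann regular, then the contractible complexes
are the distinguished triangles of a triangulated structure. -/
theorem isTriangleModel_of_regular [HasZeroObject C] [IsIdempotentComplete C]
    (reg : ∀ {A B : C} (f : A ⟶ B), ∃ b : B ⟶ A, f ≫ b ≫ f = f) :
    IsTriangleModel {X : Triangle C | IsZero X.obj₁ ∧ IsZero X.obj₂ ∧ IsZero X.obj₃} where
  exists_isZero := by
    obtain ⟨Z, hZ⟩ := HasZeroObject.zero (C := C)
    exact ⟨Triangle.mk (0 : Z ⟶ Z) (0 : Z ⟶ Z) 0, ⟨hZ, hZ, hZ⟩, hZ, hZ, hZ⟩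
  rotate := fun X ⟨h₁, h₂, h₃⟩ =>
    ⟨X.rotate, ⟨h₂, h₃, (shiftFunctor C (1 : ℤ)).map_isZero h₁⟩, ⟨Iso.refl _⟩⟩
  exists_rotate_iso := fun X ⟨h₁, h₂, h₃⟩ =>
    ⟨X.invRotate, ⟨(shiftFunctor C (-1 : ℤ)).map_isZero h₃, h₁, h₂⟩,
      ⟨(invRotCompRot.app X).symm⟩⟩
  lift := fun X ⟨h₁, _, _⟩ P w _ =>
    ⟨0, ((shiftFunctor C (1 : ℤ)).map_isZero h₁).eq_of_tgt _ _⟩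
  desc := fun X ⟨_, h₂, _⟩ P w _ => ⟨0, h₂.eq_of_src _ _⟩
  exists_triangle := fun {A B} f => by
    obtain ⟨b, hb⟩ := reg f
    -- The idempotents 1 - f ≫ b and 1 - b ≫ f cut out the kernel K and the cokernel D of f; the
    -- third object of the triangle is D ⊞ K⟦1⟧, and b provides the contraction on the rest.
    obtain ⟨K, iK, pK, hK, hK'⟩ := IsIdempotentComplete.idempotents_split A (𝟙 A - f ≫ b)
      (by simp [Preadditive.comp_sub, Preadditive.sub_comp, reassoc_of% hb])
    obtain ⟨D, iD, pD, hD, hD'⟩ := IsIdempotentComplete.idempotents_split B (𝟙 B - b ≫ f)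
      (by simp [Preadditive.comp_sub, Preadditive.sub_comp, hb])
    have z₁ : f ≫ pD = 0 := by
      rw [← Category.comp_id pD, ← hD, reassoc_of% hD']
      simp [Preadditive.sub_comp, reassoc_of% hb]
    have z₂ : iK ≫ f = 0 := by
      rw [← Category.id_comp iK, ← hK, Category.assoc, Category.assoc, reassoc_of% hK']
      simp [Preadditive.sub_comp, hb]
    have k := congrArg (fun z => z⟦(1 : ℤ)⟧') hK
    have k' := congrArg (fun z => z⟦(1 : ℤ)⟧') hK'
    have z₂' := congrArg (fun z => z⟦(1 : ℤ)⟧') z₂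
    simp only [Functor.map_comp, Functor.map_id, Functor.map_sub, Functor.map_zero] at k k' z₂'
    refine ⟨D ⊞ K⟦(1 : ℤ)⟧, biprod.lift pD 0, biprod.desc 0 (iK⟦(1 : ℤ)⟧'),
      elementary_mk_of_contraction ?_ ?_ ?_ ?_ b (biprod.fst ≫ iD) (pK⟦(1 : ℤ)⟧' ≫ biprod.inr)
      ?_ ?_ ?_⟩
    · obtain ⟨Z, hZ⟩ := HasZeroObject.zero (C := C)
      exact ⟨Triangle.mk (0 : Z ⟶ Z) (0 : Z ⟶ Z) 0, ⟨hZ, hZ, hZ⟩, hZ, hZ, hZ⟩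
    · ext <;> simp [z₁]
    · simp
    · ext <;> simp [z₂']
    · simp [k']
    · simp [hD']
    · ext <;> simp [hD, k]
  exists_hom := fun X ⟨h₁, h₂, h₃⟩ X' ⟨h₁', h₂', h₃'⟩ φ₁ φ₂ _ => by
    refine ⟨0, h₁.eq_of_src _ _, h₂.eq_of_src _ _, mappingCone_isComplex _ ?_ ?_,
      mappingCone 0, ⟨isZero_biprod h₂ h₁', isZero_biprod h₃ h₂',
        isZero_biprod ((shiftFunctor C (1 : ℤ)).map_isZero h₁) h₃'⟩,
      ⟨DefRetract.ofIso (Iso.refl _)⟩⟩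
    · exact ⟨h₁.eq_of_src _ _, h₂.eq_of_src _ _, h₃.eq_of_src _ _⟩
    · exact ⟨h₁'.eq_of_src _ _, h₂'.eq_of_src _ _, h₃'.eq_of_src _ _⟩

end CategoryTheory.Pretriangulated

/-! ### Triangles from a square-zero natural map to a cube root of the suspension -/

namespace CategoryTheory.Pretriangulated

/-- An autoequivalence `τ` with a natural map `x : M ⟶ τ M` of square zero such that the sequences
`M ⟶ τ M ⟶ τ (τ M)` are exact, such that every map is von Neumann regular modulo `x`, and such that
`τ` is a cube root of the shift. -/
structure SquareZeroTwist (C : Type*) [Category C] [Preadditive C] [HasShift C ℤ] where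
  τ : C ⥤ C
  [isEquivalence : τ.IsEquivalence]
  [additive : τ.Additive]
  x : ∀ M : C, M ⟶ τ.obj M
  η : ∀ M : C, τ.obj (τ.obj (τ.obj M)) ≅ M⟦(1 : ℤ)⟧
  x_nat : ∀ {M N : C} (f : M ⟶ N), f ≫ x N = x M ≫ τ.map f
  η_nat : ∀ {M N : C} (f : M ⟶ N),
    τ.map (τ.map (τ.map f)) ≫ (η N).hom = (η M).hom ≫ f⟦(1 : ℤ)⟧'
  x_τ : ∀ M : C, x (τ.obj M) = -τ.map (x M)
  x_x : ∀ M : C, x M ≫ x (τ.obj M) = 0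
  exists_lift : ∀ {P M : C} (w : P ⟶ τ.obj M), w ≫ x (τ.obj M) = 0 → ∃ v, v ≫ x M = w
  exists_regular_mod : ∀ {A B : C} (a : A ⟶ B), ∃ b : B ⟶ A, (a ≫ b ≫ a) ≫ x B = a ≫ x B

namespace SquareZeroTwist

attribute [instance] isEquivalence additive

variable {C : Type*} [Category C] [Preadditive C] [HasShift C ℤ] (t : SquareZeroTwist C)

lemma x_x_assoc (M : C) {P : C} (k : t.τ.obj (t.τ.obj M) ⟶ P) :
    t.x M ≫ t.x (t.τ.obj M) ≫ k = 0 := by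
  rw [← Category.assoc, t.x_x, zero_comp]

lemma x_nat_assoc {M N P : C} (f : M ⟶ N) (k : t.τ.obj N ⟶ P) :
    f ≫ t.x N ≫ k = t.x M ≫ t.τ.map f ≫ k := by
  rw [← Category.assoc, t.x_nat, Category.assoc]

lemma η_nat_assoc {M N P : C} (f : M ⟶ N) (k : N⟦(1 : ℤ)⟧ ⟶ P) :
    t.τ.map (t.τ.map (t.τ.map f)) ≫ (t.η N).hom ≫ k = (t.η M).hom ≫ f⟦(1 : ℤ)⟧' ≫ k := by
  rw [← Category.assoc, t.η_nat, Category.assoc]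

/-- The components of `x` at `τ³ M` and `M` agree up to the sign and the isomorphism of `τ³` with
the shift. -/
lemma x_τττ (M : C) : t.x (t.τ.obj (t.τ.obj (t.τ.obj M))) ≫ (t.η (t.τ.obj M)).hom =
    -(t.η M).hom ≫ (t.x M)⟦(1 : ℤ)⟧' := by
  rw [t.x_τ, t.x_τ, t.x_τ, Functor.map_neg, Functor.map_neg, Functor.map_neg, neg_neg,
    Preadditive.neg_comp, t.η_nat]

lemma x_τττ_assoc (M : C) {P : C} (k : (t.τ.obj M)⟦(1 : ℤ)⟧ ⟶ P) :
    t.x (t.τ.obj (t.τ.obj (t.τ.obj M))) ≫ (t.η (t.τ.obj M)).hom ≫ k =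
      -(t.η M).hom ≫ (t.x M)⟦(1 : ℤ)⟧' ≫ k := by
  rw [← Category.assoc, t.x_τττ, Preadditive.neg_comp, Category.assoc]

lemma η_shift_x (M : C) : (t.η M).hom ≫ (t.x M)⟦(1 : ℤ)⟧' =
    -t.x (t.τ.obj (t.τ.obj (t.τ.obj M))) ≫ (t.η (t.τ.obj M)).hom := by
  rw [t.x_τττ, neg_neg]

lemma x_η_shift_x (M : C) :
    t.x (t.τ.obj (t.τ.obj M)) ≫ (t.η M).hom ≫ (t.x M)⟦(1 : ℤ)⟧' = 0 := by
  rw [← neg_eq_zero, ← Preadditive.comp_neg, ← t.x_τττ, t.x_x_assoc]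

lemma x_η_shift_x_assoc (M : C) {P : C} (k : (t.τ.obj M)⟦(1 : ℤ)⟧ ⟶ P) :
    t.x (t.τ.obj (t.τ.obj M)) ≫ (t.η M).hom ≫ (t.x M)⟦(1 : ℤ)⟧' ≫ k = 0 := by
  have h := t.x_η_shift_x M
  rw [← Category.assoc, ← Category.assoc, Category.assoc (t.x _), h, zero_comp]

/-- Follows from the lifting property: writing P as τ²Q and w as τ of a map w₀, naturality of x
turns x ≫ w = 0 into w₀ ≫ x = 0. The lift of w₀ is then pushed forward by τ², with a sign from
`x_τ`. -/
lemma exists_desc {P M : C} (w : t.τ.obj M ⟶ P) (hw : t.x M ≫ w = 0) :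
    ∃ v, t.x (t.τ.obj M) ≫ v = w := by
  let Q := t.τ.objPreimage (t.τ.objPreimage P)
  let e : t.τ.obj (t.τ.obj Q) ≅ P :=
    t.τ.mapIso (t.τ.objObjPreimageIso (t.τ.objPreimage P)) ≪≫ t.τ.objObjPreimageIso P
  obtain ⟨w₀, hw₀⟩ := t.τ.map_surjective (w ≫ e.inv)
  obtain ⟨v, hv⟩ := t.exists_lift w₀ (by rw [t.x_nat, hw₀, reassoc_of% hw, zero_comp])
  refine ⟨-t.τ.map (t.τ.map v) ≫ e.hom, ?_⟩
  rw [Preadditive.comp_neg, ← t.x_nat_assoc, t.x_τ, Preadditive.neg_comp, Preadditive.comp_neg,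
    neg_neg, ← t.τ.map_comp_assoc, hv, hw₀, Category.assoc, e.inv_hom_id, Category.comp_id]

/-- With B written as τB', exactness factors d through x at its target, and naturality moves x to
the source. This makes "zero modulo x" the same as "divisible by x". -/
lemma exists_of_comp_eq {A B : C} (d : A ⟶ B) (hd : d ≫ t.x B = 0) :
    ∃ c : t.τ.obj A ⟶ B, d = t.x A ≫ c := by
  let e := t.τ.objObjPreimageIso B
  obtain ⟨v, hv⟩ := t.exists_lift (d ≫ e.inv) (by
    rw [Category.assoc, t.x_nat, reassoc_of% hd, zero_comp])
  refine ⟨t.τ.map v ≫ e.hom, ?_⟩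
  rw [← t.x_nat_assoc, reassoc_of% hv, Iso.inv_hom_id, Category.comp_id]

/-- The quasi-inverses modulo `x` can be improved by lifting idempotents. -/
lemma exists_regular {A B : C} (a : A ⟶ B) : ∃ (b : B ⟶ A) (c : t.τ.obj A ⟶ B),
    a = a ≫ b ≫ a + t.x A ≫ c ∧ b ≫ a ≫ b = b := by
  obtain ⟨b, hb⟩ := t.exists_regular_mod a
  obtain ⟨c, hc⟩ := t.exists_of_comp_eq (a - a ≫ b ≫ a) (by
    rw [Preadditive.sub_comp, hb, sub_self])
  let p : End A := a ≫ b
  let y : t.τ.obj A ⟶ A := c ≫ b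
  have hp : p * p - p = -(t.x A ≫ y) := by
    rw [← Category.assoc, ← hc]
    simp [p, End.mul_def, Preadditive.sub_comp]
  have hpp : (p * p - p) * (p * p - p) = 0 := by
    rw [hp, neg_mul_neg, End.mul_def, Category.assoc, t.x_nat_assoc, t.x_x_assoc]
  -- Here p ≫ s = 3p² - 2p³, the standard polynomial lifting an idempotent across a square-zero
  -- error: p² - p is divisible by x, so its square vanishes.
  let s : End A := 3 * p - 2 * p * p
  have hs : s * p = p * s := by simp only [s]; noncomm_ring
  have hq : (p * s) * (p * s) = p * s := by
    have h : (p * s) * (p * s) - p * s =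
        (p * p - p) * (p * p - p) * (4 * p * p - 4 * p - 3) := by
      simp only [s]
      noncomm_ring
    rw [hpp, zero_mul, sub_eq_zero] at h
    exact h
  have hq' : p * s = p + (1 - 2 * p) * (p * p - p) := by
    simp only [s]
    noncomm_ring
  obtain ⟨q, hqs⟩ : ∃ q : A ⟶ A, q = p * s := ⟨_, rfl⟩
  obtain ⟨r, hr⟩ : ∃ r : A ⟶ A, r = (1 - 2 * p : End A) := ⟨_, rfl⟩
  have e : a ≫ b ≫ s = q := by
    rw [hqs, ← hs, End.mul_def, Category.assoc]
  have hqq : q ≫ q = q := by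
    rw [hqs]
    exact hq
  have hqr : q = a ≫ b - t.x A ≫ y ≫ r := by
    rw [hqs, hq', hp, ← hr, mul_neg, ← sub_eq_add_neg, End.mul_def, Category.assoc]
  -- With b₁ = b ≫ s the product a ≫ b₁ is the idempotent q, so b₁ ≫ a ≫ b₁ satisfies the second
  -- identity. The difference between q and a ≫ b is a multiple of x, absorbed into c.
  refine ⟨(b ≫ s) ≫ a ≫ b ≫ s, c + y ≫ r ≫ a, ?_, ?_⟩
  · have h : a ≫ ((b ≫ s) ≫ a ≫ b ≫ s) ≫ a = q ≫ a := by
      simp only [Category.assoc, reassoc_of% e, reassoc_of% hqq]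
    rw [h, hqr, Preadditive.comp_add, ← hc]
    simp only [Preadditive.sub_comp, Category.assoc]
    abel
  · simp only [Category.assoc, reassoc_of% e, e, reassoc_of% hqq, hqq]

/-- The triangle `M ⟶ τ M ⟶ τ² M ⟶ M⟦1⟧`. -/
def model (M : C) : Triangle C :=
  Triangle.mk (t.x M) (t.x (t.τ.obj M)) (t.x (t.τ.obj (t.τ.obj M)) ≫ (t.η M).hom)

/-- The morphism of model triangles given by a map. -/
def modelMap {M N : C} (a : M ⟶ N) : t.model M ⟶ t.model N where
  hom₁ := a
  hom₂ := t.τ.map a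
  hom₃ := t.τ.map (t.τ.map a)
  comm₁ := (t.x_nat a).symm
  comm₂ := (t.x_nat _).symm
  comm₃ := by
    change (t.x (t.τ.obj (t.τ.obj M)) ≫ (t.η M).hom) ≫ a⟦(1 : ℤ)⟧' =
      t.τ.map (t.τ.map a) ≫ t.x (t.τ.obj (t.τ.obj N)) ≫ (t.η N).hom
    rw [t.x_nat_assoc, t.η_nat, Category.assoc]

lemma model_isComplex (M : C) : IsComplex (t.model M) where
  zero₁₂ := t.x_x M
  zero₂₃ := t.x_x_assoc _ _
  zero₃₁ := (Category.assoc _ _ _).trans (t.x_η_shift_x M)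

/-- Isomorphic objects have isomorphic model triangles. -/
def modelIso {M N : C} (e : M ≅ N) : t.model M ≅ t.model N where
  hom := t.modelMap e.hom
  inv := t.modelMap e.inv
  hom_inv_id := Triangle.hom_ext _ _ e.hom_inv_id
    ((t.τ.mapIso e).hom_inv_id) ((t.τ.mapIso (t.τ.mapIso e)).hom_inv_id)
  inv_hom_id := Triangle.hom_ext _ _ e.inv_hom_id
    ((t.τ.mapIso e).inv_hom_id) ((t.τ.mapIso (t.τ.mapIso e)).inv_hom_id)

/-- The rotation of a model triangle. -/
def modelRotateIso (M : C) : t.model (t.τ.obj M) ≅ (t.model M).rotate :=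
  Triangle.isoMk _ _ (Iso.refl _) (Iso.refl _) (t.η M)
    ((Category.comp_id _).trans (Category.id_comp _).symm)
    (Category.id_comp _).symm
    (by
      change (t.x (t.τ.obj (t.τ.obj (t.τ.obj M))) ≫ (t.η (t.τ.obj M)).hom) ≫
        (𝟙 (t.τ.obj M))⟦(1 : ℤ)⟧' = (t.η M).hom ≫ (-(t.x M)⟦(1 : ℤ)⟧')
      -- Moving x past τ three times yields an odd number of signs, matching the sign in the rotated
      -- triangle.
      rw [Functor.map_id, Category.comp_id, t.x_τττ, Preadditive.comp_neg])

variable [∀ n : ℤ, (shiftFunctor C n).Additive] [HasBinaryBiproducts C]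

section cone

variable {M N K D : C} {a : M ⟶ N} {b : N ⟶ M} {i : K ⟶ M} {p : M ⟶ K} {j : D ⟶ N} {q : N ⟶ D}

/-- The cone of the map of model triangles given by a von Neumann regular map. -/
lemma nonempty_defRetract_mappingCone (hi : i ≫ p = 𝟙 K) (hp : a ≫ b + p ≫ i = 𝟙 M)
    (hj : j ≫ q = 𝟙 D) (hq : b ≫ a + q ≫ j = 𝟙 N) (hia : i ≫ a = 0) (haq : a ≫ q = 0) :
    Nonempty (DefRetract (mappingCone (t.modelMap a)) (t.model (t.τ.obj K ⊞ D))) := by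
  -- K and D are the kernel and the cokernel of a. On their complements a is invertible and b
  -- contracts the cone. What remains is the model of D and, from the shifted source, that of τK; η
  -- identifies τ³K with K⟦1⟧, and the signs in the second components undo the negated differentials
  -- of the cone.
  refine ⟨DefRetract.ofMaps (A₁ := t.τ.obj M ⊞ N) (A₂ := t.τ.obj (t.τ.obj M) ⊞ t.τ.obj N)
    (A₃ := M⟦(1 : ℤ)⟧ ⊞ t.τ.obj (t.τ.obj N))
    (f := biprod.desc (biprod.lift (-t.x (t.τ.obj M)) (t.τ.map a)) (biprod.lift 0 (t.x N)))
    (g := biprod.desc (biprod.lift (-t.x (t.τ.obj (t.τ.obj M)) ≫ (t.η M).hom)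
      (t.τ.map (t.τ.map a))) (biprod.lift 0 (t.x (t.τ.obj N))))
    (h := biprod.desc ((biprod.lift (-t.x M) a)⟦(1 : ℤ)⟧')
      ((t.x (t.τ.obj (t.τ.obj N)) ≫ (t.η N).hom) ≫ biprod.inr⟦(1 : ℤ)⟧'))
    (biprod.map (t.τ.map i) j)
    (biprod.lift (-t.τ.map (biprod.fst ≫ t.τ.map i)) (t.τ.map (biprod.snd ≫ j)))
    (biprod.lift (t.τ.map (t.τ.map (biprod.fst ≫ t.τ.map i)) ≫ (t.η M).hom)
      (t.τ.map (t.τ.map (biprod.snd ≫ j))))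
    (biprod.map (t.τ.map p) q)
    (biprod.desc (-t.τ.map (t.τ.map p ≫ biprod.inl)) (t.τ.map (q ≫ biprod.inr)))
    (biprod.desc ((t.η M).inv ≫ t.τ.map (t.τ.map (t.τ.map p ≫ biprod.inl)))
      (t.τ.map (t.τ.map (q ≫ biprod.inr))))
    (biprod.snd ≫ t.τ.map b ≫ biprod.inl) (biprod.snd ≫ t.τ.map (t.τ.map b) ≫ biprod.inl)
    (biprod.snd⟦(1 : ℤ)⟧' ≫ b⟦(1 : ℤ)⟧' ≫ biprod.inl)
    ?_ ?_ ?_ ?_ ?_ ?_ ?_ ?_ ?_ ?_ ?_ ?_⟩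
  · ext <;> simp [-Functor.map_comp, -Functor.map_add, ← Functor.map_comp, ← Functor.map_comp_assoc,
      ← Functor.map_add, t.x_nat, t.x_nat_assoc, t.η_nat, t.η_nat_assoc, hi, hp, hj, hq, hia,
      reassoc_of% haq, reassoc_of% hj, reassoc_of% hi, t.x_τττ_assoc]
  · ext <;> simp [-Functor.map_comp, -Functor.map_add, ← Functor.map_comp, ← Functor.map_comp_assoc,
      ← Functor.map_add, t.x_nat, t.x_nat_assoc, t.η_nat, t.η_nat_assoc, hi, hp, hj, hq, hia,
      reassoc_of% haq, reassoc_of% hj, reassoc_of% hi, t.x_τττ_assoc]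
  · have k : t.τ.map (t.τ.map (biprod.fst ≫ t.τ.map i)) ≫ (t.η M).hom ≫ a⟦(1 : ℤ)⟧' =
        (0 : t.τ.obj (t.τ.obj (t.τ.obj K ⊞ D)) ⟶ N⟦(1 : ℤ)⟧) := by
      rw [← t.η_nat, ← Functor.map_comp_assoc, ← Functor.map_comp, Category.assoc,
        ← Functor.map_comp, hia]
      simp
    apply shift_biprod_hom_ext
    · simp [-Functor.map_comp, -Functor.map_add, ← Functor.map_comp, ← Functor.map_comp_assoc,
      ← Functor.map_add, t.x_nat, t.x_nat_assoc, t.η_nat, t.η_nat_assoc, hi, hp, hj, hq, hia,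
      reassoc_of% haq, reassoc_of% hj, reassoc_of% hi, t.η_shift_x]
    · simp [-Functor.map_comp, -Functor.map_add, ← Functor.map_comp, ← Functor.map_comp_assoc,
      ← Functor.map_add, t.x_nat, t.x_nat_assoc, t.η_nat, t.η_nat_assoc, hi, hp, hj, hq, hia,
      reassoc_of% haq, reassoc_of% hj, reassoc_of% hi, k]
  · ext <;> simp [-Functor.map_comp, -Functor.map_add, ← Functor.map_comp, ← Functor.map_comp_assoc,
      ← Functor.map_add, t.x_nat, t.x_nat_assoc, t.η_nat, t.η_nat_assoc, hi, hp, hj, hq, hia,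
      reassoc_of% haq, reassoc_of% hj, reassoc_of% hi, t.x_τττ_assoc]
  · ext <;> simp [-Functor.map_comp, -Functor.map_add, ← Functor.map_comp, ← Functor.map_comp_assoc,
      ← Functor.map_add, t.x_nat, t.x_nat_assoc, t.η_nat, t.η_nat_assoc, hi, hp, hj, hq, hia,
      reassoc_of% haq, reassoc_of% hj, reassoc_of% hi, t.x_τττ_assoc]
  · have k : ((t.η M).inv ≫ t.τ.map (t.τ.map (t.τ.map p ≫ biprod.inl))) ≫
        t.x (t.τ.obj (t.τ.obj (t.τ.obj K ⊞ D))) ≫ (t.η (t.τ.obj K ⊞ D)).hom =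
        -(t.x M)⟦(1 : ℤ)⟧' ≫ (t.τ.map p ≫ biprod.inl)⟦(1 : ℤ)⟧' := by
      rw [Category.assoc, t.x_nat_assoc, t.η_nat, t.x_τττ_assoc, Preadditive.comp_neg,
        Iso.inv_hom_id_assoc]
    apply biprod.hom_ext'
    · rw [biprod.inl_desc_assoc, biprod.inl_desc_assoc, k]
      apply shift_biprod_hom_ext <;> simp [← Functor.map_comp, haq]
    · apply shift_biprod_hom_ext <;>
      simp [-Functor.map_comp, -Functor.map_add, ← Functor.map_comp, ← Functor.map_comp_assoc,
      ← Functor.map_add, t.x_nat, t.x_nat_assoc, t.η_nat, t.η_nat_assoc, hi, hp, hj, hq, hia,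
      reassoc_of% haq, reassoc_of% hj, reassoc_of% hi]
  · ext <;> simp [-Functor.map_comp, -Functor.map_add, ← Functor.map_comp, ← Functor.map_comp_assoc,
      ← Functor.map_add, t.x_nat, t.x_nat_assoc, t.η_nat, t.η_nat_assoc, hi, hp, hj, hq, hia,
      reassoc_of% haq, reassoc_of% hj, reassoc_of% hi, t.x_τττ_assoc]
  · simp [-Functor.map_comp, -Functor.map_add, ← Functor.map_comp, ← Functor.map_comp_assoc,
      ← Functor.map_add, t.x_nat, t.x_nat_assoc, t.η_nat, t.η_nat_assoc, hi, hp, hj, hq, hia,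
      reassoc_of% haq, reassoc_of% hj, reassoc_of% hi, t.x_τττ_assoc]
  · simp [-Functor.map_comp, -Functor.map_add, ← Functor.map_comp, ← Functor.map_comp_assoc,
      ← Functor.map_add, t.x_nat, t.x_nat_assoc, t.η_nat, t.η_nat_assoc, hi, hp, hj, hq, hia,
      reassoc_of% haq, reassoc_of% hj, reassoc_of% hi, t.x_τττ_assoc]
  · apply shift_biprod_hom_ext <;> apply shift_biprod_hom_ext' <;>
    simp [-Functor.map_comp, -Functor.map_add, ← Functor.map_comp, ← Functor.map_comp_assoc,
      ← Functor.map_add, t.x_nat, t.x_nat_assoc, t.η_nat, t.η_nat_assoc, hi, hp, hj, hq, hia,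
      reassoc_of% haq, reassoc_of% hj, reassoc_of% hi, t.x_τττ_assoc]
  · ext <;> simp [-Functor.map_comp, -Functor.map_add, ← Functor.map_comp, ← Functor.map_comp_assoc,
      ← Functor.map_add, t.x_nat, t.x_nat_assoc, t.η_nat, t.η_nat_assoc, hi, hp, hj, hq, hia,
      reassoc_of% haq, reassoc_of% hj, reassoc_of% hi, t.x_τττ_assoc]
  · ext <;> simp [-Functor.map_comp, -Functor.map_add, ← Functor.map_comp, ← Functor.map_comp_assoc,
      ← Functor.map_add, t.x_nat, t.x_nat_assoc, t.η_nat, t.η_nat_assoc, hi, hp, hj, hq, hia,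
      reassoc_of% haq, reassoc_of% hj, reassoc_of% hi, t.x_τττ_assoc]

end cone

/-- Modulo x the map φ₁ is a regular map a. The corrections c and d, with φ₁ - a = x ≫ c and φ₂ - τa
- c ≫ x = x ≫ d, form a homotopy from the filling to `modelMap a`, whose cone retracts onto a model.
-/
lemma exists_modelHom [IsIdempotentComplete C] {M N : C} (φ₁ : M ⟶ N)
    (φ₂ : t.τ.obj M ⟶ t.τ.obj N) (comm : t.x M ≫ φ₂ = φ₁ ≫ t.x N) :
    ∃ ψ : t.model M ⟶ t.model N, ψ.hom₁ = φ₁ ∧ ψ.hom₂ = φ₂ ∧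
      Elementary (Set.range t.model) (mappingCone ψ) := by
  obtain ⟨b, c, hc, hb⟩ := t.exists_regular φ₁
  obtain ⟨a, ha⟩ : ∃ a, a = φ₁ ≫ b ≫ φ₁ := ⟨_, rfl⟩
  rw [← ha] at hc
  have h₁ : a ≫ b ≫ a = a := by simp [ha, reassoc_of% hb]
  have h₂ : b ≫ a ≫ b = b := by simp [ha, reassoc_of% hb, hb]
  obtain ⟨d, hd⟩ := t.exists_desc (φ₂ - t.τ.map a - c ≫ t.x N) (by
    rw [Preadditive.comp_sub, Preadditive.comp_sub, comm, ← t.x_nat, hc, Preadditive.add_comp,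
      Category.assoc]
    abel)
  have hd' : φ₂ = t.τ.map a + c ≫ t.x N + t.x (t.τ.obj M) ≫ d := by rw [hd]; abel
  let ψ : t.model M ⟶ t.model N :=
    { hom₁ := φ₁
      hom₂ := φ₂
      hom₃ := t.τ.map (t.τ.map a) + d ≫ t.x (t.τ.obj N)
      comm₁ := comm
      comm₂ := by
        change t.x (t.τ.obj M) ≫ (t.τ.map (t.τ.map a) + d ≫ t.x (t.τ.obj N)) =
          φ₂ ≫ t.x (t.τ.obj N)
        rw [hd']
        simp only [Preadditive.comp_add, Preadditive.add_comp, Category.assoc, t.x_x, comp_zero,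
          add_zero, t.x_nat (t.τ.map a)]
      comm₃ := by
        change (t.x (t.τ.obj (t.τ.obj M)) ≫ (t.η M).hom) ≫ φ₁⟦(1 : ℤ)⟧' =
          (t.τ.map (t.τ.map a) + d ≫ t.x (t.τ.obj N)) ≫
            t.x (t.τ.obj (t.τ.obj N)) ≫ (t.η N).hom
        rw [hc]
        simp only [Preadditive.comp_add, Preadditive.add_comp, Category.assoc, t.x_x_assoc,
          comp_zero, add_zero, t.x_nat_assoc (t.τ.map (t.τ.map a)), t.η_nat, Functor.map_add,
          Functor.map_comp, t.x_η_shift_x_assoc] }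
  have H : NullHomotopy (ψ - t.modelMap a) :=
    { s₁ := c
      s₂ := d
      s₃ := 0
      eq₁ := by
        change (φ₁ - a)⟦(1 : ℤ)⟧' = (t.x M)⟦(1 : ℤ)⟧' ≫ c⟦(1 : ℤ)⟧' +
          (0 : M⟦(1 : ℤ)⟧ ⟶ t.τ.obj (t.τ.obj N)) ≫ t.x (t.τ.obj (t.τ.obj N)) ≫ (t.η N).hom
        rw [hc, add_sub_cancel_left, Functor.map_comp, zero_comp, add_zero]
      eq₂ := by
        change φ₂ - t.τ.map a = t.x (t.τ.obj M) ≫ d + c ≫ t.x N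
        rw [hd']
        abel
      eq₃ := by
        change t.τ.map (t.τ.map a) + d ≫ t.x (t.τ.obj N) - t.τ.map (t.τ.map a) =
          (t.x (t.τ.obj (t.τ.obj M)) ≫ (t.η M).hom) ≫
            (0 : M⟦(1 : ℤ)⟧ ⟶ t.τ.obj (t.τ.obj N)) + d ≫ t.x (t.τ.obj N)
        rw [comp_zero, zero_add, add_sub_cancel_left] }
  obtain ⟨K, i, p, hi, hp⟩ := IsIdempotentComplete.idempotents_split M (𝟙 M - a ≫ b)
    (by simp [Preadditive.comp_sub, Preadditive.sub_comp, h₂])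
  obtain ⟨D, j, q, hj, hq⟩ := IsIdempotentComplete.idempotents_split N (𝟙 N - b ≫ a)
    (by simp [Preadditive.comp_sub, Preadditive.sub_comp, h₁])
  obtain ⟨r⟩ := t.nonempty_defRetract_mappingCone (a := a) (b := b) hi (by rw [hp]; abel) hj
    (by rw [hq]; abel)
    (by
      rw [← Category.id_comp i, ← hi, Category.assoc, Category.assoc, reassoc_of% hp]
      simp [Preadditive.sub_comp, h₁])
    (by
      rw [← Category.comp_id q, ← hj, reassoc_of% hq]
      simp [Preadditive.sub_comp, reassoc_of% h₁])
  exact ⟨ψ, rfl, rfl, mappingCone_isComplex ψ (t.model_isComplex M) (t.model_isComplex N), _,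
    ⟨_, rfl⟩, ⟨(DefRetract.ofIso (mappingConeIso H)).trans r⟩⟩

/-- A triangle on a map which is divisible by `x`. -/
lemma exists_elementary_x_comp [IsIdempotentComplete C] {K D : C} (w : t.τ.obj K ⟶ D) :
    ∃ (E : C) (g : D ⟶ E) (h : E ⟶ K⟦(1 : ℤ)⟧),
      Elementary (Set.range t.model) (Triangle.mk (t.x K ≫ w) g h) := by
  obtain ⟨b, d, hd, hb⟩ := t.exists_regular w
  obtain ⟨c, hc⟩ : ∃ c, c = w ≫ b ≫ w := ⟨_, rfl⟩
  -- Since x has square zero, only the regular part c of w contributes.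
  have hxc : t.x K ≫ w = t.x K ≫ c := by
    rw [hd, ← hc, Preadditive.comp_add, t.x_x_assoc, add_zero]
  have h₁ : c ≫ b ≫ c = c := by simp [hc, reassoc_of% hb]
  have h₂ : b ≫ c ≫ b = b := by simp [hc, reassoc_of% hb, hb]
  rw [hxc]
  clear hxc hc hd hb
  -- The idempotent c ≫ b of τK comes from one of K because τ is fully faithful. This splits K as B
  -- ⊞ K' and D as τB ⊞ D', and the map becomes x on B and zero elsewhere.
  obtain ⟨e, he⟩ := t.τ.map_surjective (c ≫ b)
  have he' : e ≫ e = e := t.τ.map_injective (by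
    rw [Functor.map_comp, he, Category.assoc, h₂])
  obtain ⟨B, i, p, hi, hp⟩ := IsIdempotentComplete.idempotents_split K e he'
  obtain ⟨K', i', p', hi', hp'⟩ := IsIdempotentComplete.idempotents_split K (𝟙 K - e)
    (by simp [Preadditive.comp_sub, Preadditive.sub_comp, he'])
  obtain ⟨D', j', q', hj', hq'⟩ := IsIdempotentComplete.idempotents_split D (𝟙 D - b ≫ c)
    (by simp [Preadditive.comp_sub, Preadditive.sub_comp, h₁])
  have hi'p : i' ≫ p = 0 := by
    have h := i' ≫= hp'
    rw [reassoc_of% hi', Preadditive.comp_sub, Category.comp_id, eq_comm, sub_eq_self] at h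
    rw [← Category.comp_id p, ← hi, reassoc_of% hp, reassoc_of% h, zero_comp]
  have hip' : i ≫ p' = 0 := by
    have h := hp' =≫ p'
    rw [Category.assoc, hi', Preadditive.sub_comp, Category.comp_id, Category.id_comp, eq_comm,
      sub_eq_self] at h
    rw [← Category.id_comp i, ← hi, Category.assoc, Category.assoc, reassoc_of% hp, h, comp_zero]
  have hcq : c ≫ q' = 0 := by
    rw [← Category.comp_id q', ← hj', reassoc_of% hq']
    simp [Preadditive.sub_comp, reassoc_of% h₁]
  have hjb : j' ≫ b = 0 := by
    rw [← Category.id_comp j', ← hj', Category.assoc, Category.assoc, reassoc_of% hq']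
    simp [Preadditive.sub_comp, h₂]
  have hjr : (t.τ.map i ≫ c) ≫ b ≫ t.τ.map p = 𝟙 _ := by
    rw [Category.assoc, ← Category.assoc c b, ← he, ← hp]
    simp [← Functor.map_comp, reassoc_of% hi, hi]
  have hrj : (b ≫ t.τ.map p) ≫ t.τ.map i ≫ c = b ≫ c := by
    rw [Category.assoc, ← Functor.map_comp_assoc, hp, he, Category.assoc, h₁]
  have hx : t.x K ≫ c = p ≫ t.x B ≫ t.τ.map i ≫ c := by
    rw [t.x_nat_assoc, ← Functor.map_comp_assoc, hp, he, Category.assoc, h₁]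
  obtain ⟨j, hj⟩ : ∃ j, j = t.τ.map i ≫ c := ⟨_, rfl⟩
  obtain ⟨r, hr⟩ : ∃ r, r = b ≫ t.τ.map p := ⟨_, rfl⟩
  have hjq : j ≫ q' = 0 := by rw [hj, Category.assoc, hcq, comp_zero]
  have hjr' : j' ≫ r = 0 := by rw [hr, reassoc_of% hjb, zero_comp]
  rw [← hj, ← hr] at hjr hrj
  rw [← hj] at hx
  rw [hx]
  have k₁ := congrArg (fun z => z⟦(1 : ℤ)⟧') hi
  have k₂ := congrArg (fun z => z⟦(1 : ℤ)⟧') hi'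
  have k₃ := congrArg (fun z => z⟦(1 : ℤ)⟧') hi'p
  have k₄ := congrArg (fun z => z⟦(1 : ℤ)⟧') hip'
  have k₅ := congrArg (fun z => z⟦(1 : ℤ)⟧') hp
  have k₆ := congrArg (fun z => z⟦(1 : ℤ)⟧') hp'
  simp only [Functor.map_comp, Functor.map_id, Functor.map_zero, Functor.map_sub] at k₁ k₂ k₃ k₄ k₅ k₆
  -- The triangle is the model of B plus the contractible triangles contributed by D' and K'.
  refine ⟨t.τ.obj (t.τ.obj B) ⊞ (D' ⊞ K'⟦(1 : ℤ)⟧),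
    biprod.lift (r ≫ t.x (t.τ.obj B)) (biprod.lift q' 0),
    biprod.desc (t.x (t.τ.obj (t.τ.obj B)) ≫ (t.η B).hom ≫ i⟦(1 : ℤ)⟧')
      (biprod.desc 0 (i'⟦(1 : ℤ)⟧')),
    ⟨?_, ?_, ?_⟩, _, ⟨B, rfl⟩, ⟨DefRetract.ofMaps i j biprod.inl p r biprod.fst 0
      (biprod.snd ≫ biprod.fst ≫ j') (p'⟦(1 : ℤ)⟧' ≫ biprod.inr ≫ biprod.inr)
      ?_ ?_ ?_ ?_ ?_ ?_ ?_ ?_ ?_ ?_ ?_ ?_⟩⟩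
  · change (p ≫ t.x B ≫ j) ≫ biprod.lift (r ≫ t.x (t.τ.obj B)) (biprod.lift q' 0) = 0
    ext <;> simp [reassoc_of% hjr, t.x_x, hjq]
  · change biprod.lift (r ≫ t.x (t.τ.obj B)) (biprod.lift q' 0) ≫
      biprod.desc (t.x (t.τ.obj (t.τ.obj B)) ≫ (t.η B).hom ≫ i⟦(1 : ℤ)⟧')
        (biprod.desc 0 (i'⟦(1 : ℤ)⟧')) = 0
    simp [t.x_x_assoc]
  · change biprod.desc (t.x (t.τ.obj (t.τ.obj B)) ≫ (t.η B).hom ≫ i⟦(1 : ℤ)⟧')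
        (biprod.desc 0 (i'⟦(1 : ℤ)⟧')) ≫ (p ≫ t.x B ≫ j)⟦(1 : ℤ)⟧' = 0
    ext <;> simp [reassoc_of% k₁, t.x_η_shift_x_assoc, reassoc_of% k₃]
  · simp [reassoc_of% hi]
  · ext <;> simp [reassoc_of% hjr, hjq]
  · simp
  · simp [hjr]
  · simp
  · ext <;> simp [k₁, k₃]
  · exact hi
  · exact hjr
  · simp
  · simp [k₅, k₆]
  · simp [hq', hrj]
  · ext <;> simp [reassoc_of% k₄, reassoc_of% hjr', hj', k₂]

/-- The regular part of f is split off as a contractible summand. On the complements K and D only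
the multiple of x survives, and naturality puts x in front, which reduces to
`exists_elementary_x_comp`. -/
lemma exists_elementary [IsIdempotentComplete C] {A B : C} (f : A ⟶ B) :
    ∃ (E : C) (g : B ⟶ E) (h : E ⟶ A⟦(1 : ℤ)⟧),
      Elementary (Set.range t.model) (Triangle.mk f g h) := by
  obtain ⟨b, c, hc, hb⟩ := t.exists_regular f
  obtain ⟨K, i, p, hi, hp⟩ := IsIdempotentComplete.idempotents_split A (𝟙 A - f ≫ b)
    (by simp [Preadditive.comp_sub, Preadditive.sub_comp, hb])
  obtain ⟨D, j, q, hj, hq⟩ := IsIdempotentComplete.idempotents_split B (𝟙 B - b ≫ f)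
    (by simp [Preadditive.comp_sub, Preadditive.sub_comp, reassoc_of% hb])
  have hifb : i ≫ f ≫ b = 0 := by
    rw [← Category.id_comp i, ← hi, Category.assoc, Category.assoc, reassoc_of% hp]
    simp [Preadditive.sub_comp, hb]
  have hbfq : b ≫ f ≫ q = 0 := by
    rw [← Category.comp_id q, ← hj, reassoc_of% hq]
    simp [Preadditive.sub_comp, reassoc_of% hb]
  have hfbi : p ≫ i ≫ f ≫ q = f ≫ q := by
    rw [reassoc_of% hp]
    simp [Preadditive.sub_comp, hbfq]
  have hif : i ≫ f ≫ q ≫ j = i ≫ f := by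
    rw [hq]
    simp [Preadditive.comp_sub, reassoc_of% hifb]
  obtain ⟨E, g, h, hE⟩ : ∃ (E : C) (g : D ⟶ E) (h : E ⟶ K⟦(1 : ℤ)⟧),
      Elementary (Set.range t.model) (Triangle.mk (i ≫ f ≫ q) g h) := by
    have h₀ : i ≫ f ≫ q = t.x K ≫ t.τ.map i ≫ c ≫ q := by
      rw [← t.x_nat_assoc]
      conv_lhs => rw [hc]
      simp [reassoc_of% hifb]
    rw [h₀]
    exact t.exists_elementary_x_comp _
  have z₁ : (i ≫ f ≫ q) ≫ g = 0 := hE.1.zero₁₂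
  have z₂ : g ≫ h = 0 := hE.1.zero₂₃
  have z₃ : h ≫ (i ≫ f ≫ q)⟦(1 : ℤ)⟧' = 0 := hE.1.zero₃₁
  have z₄ : h ≫ (i ≫ f)⟦(1 : ℤ)⟧' = 0 := by
    rw [← hif, show i ≫ f ≫ q ≫ j = (i ≫ f ≫ q) ≫ j by simp, Functor.map_comp,
      reassoc_of% z₃, zero_comp]
  refine ⟨E, q ≫ g, h ≫ i⟦(1 : ℤ)⟧', Elementary.of_defRetract ⟨?_, ?_, ?_⟩
    (DefRetract.ofMaps i j (𝟙 E) p q (𝟙 E) b 0 0 ?_ ?_ ?_ ?_ ?_ ?_ ?_ ?_ ?_ ?_ ?_ ?_) hE⟩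
  · change f ≫ q ≫ g = 0
    rw [← Category.assoc, ← hfbi]
    simpa using p ≫= z₁
  · change (q ≫ g) ≫ h ≫ i⟦(1 : ℤ)⟧' = 0
    rw [Category.assoc, reassoc_of% z₂, zero_comp, comp_zero]
  · change (h ≫ i⟦(1 : ℤ)⟧') ≫ f⟦(1 : ℤ)⟧' = 0
    rw [Category.assoc, ← Functor.map_comp, z₄]
  · simpa using hif
  · simp [reassoc_of% hj]
  · simp
  · exact hfbi.symm
  · simp
  · simp [← Functor.map_comp, hi]
  · exact hi
  · exact hj
  · simp
  · rw [← Functor.map_comp, ← Functor.map_comp, zero_comp, add_zero, ← Functor.map_add, hp,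
      add_sub_cancel, Functor.map_id]
  · rw [comp_zero, zero_add, hq, add_sub_cancel]
  · simp

/-- The model triangles `M ⟶ τ M ⟶ τ² M ⟶ M⟦1⟧` generate a triangulated structure. -/
theorem isTriangleModel [HasZeroObject C] [IsIdempotentComplete C] :
    IsTriangleModel (Set.range t.model) where
  exists_isZero := by
    obtain ⟨Z, hZ⟩ := HasZeroObject.zero (C := C)
    exact ⟨_, ⟨Z, rfl⟩, hZ, t.τ.map_isZero hZ, t.τ.map_isZero (t.τ.map_isZero hZ)⟩
  rotate := by
    rintro _ ⟨M, rfl⟩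
    exact ⟨_, ⟨_, rfl⟩, ⟨(t.modelRotateIso M).symm⟩⟩
  exists_rotate_iso := by
    rintro _ ⟨M, rfl⟩
    exact ⟨_, ⟨t.τ.objPreimage M, rfl⟩,
      ⟨t.modelIso (t.τ.objObjPreimageIso M).symm ≪≫ t.modelRotateIso _⟩⟩
  lift := by
    rintro _ ⟨M, rfl⟩ P (w : P ⟶ M⟦(1 : ℤ)⟧) (hw : w ≫ (t.x M)⟦(1 : ℤ)⟧' = 0)
    obtain ⟨v, hv⟩ := t.exists_lift (w ≫ (t.η M).inv) (by
      rw [← cancel_mono (t.η (t.τ.obj M)).hom, Category.assoc, Category.assoc, t.x_τττ,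
        zero_comp, Preadditive.comp_neg, Preadditive.comp_neg, Iso.inv_hom_id_assoc, neg_eq_zero, hw])
    refine ⟨v, ?_⟩
    change v ≫ t.x _ ≫ (t.η M).hom = w
    rw [reassoc_of% hv, Iso.inv_hom_id, Category.comp_id]
  desc := by
    rintro _ ⟨M, rfl⟩ P w hw
    exact t.exists_desc w hw
  exists_triangle := t.exists_elementary
  exists_hom := by
    rintro _ ⟨M, rfl⟩ _ ⟨N, rfl⟩ φ₁ φ₂ comm
    exact t.exists_modelHom φ₁ φ₂ comm

end SquareZeroTwist
end CategoryTheory.Pretriangulated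

/-! ### Graded modules: homogeneous submodules, split idempotents, biproducts -/

/-- A criterion for internal direct sums in terms of the projections. -/
theorem isInternal_of_proj {M : Type*} [AddCommGroup M] (deg : ℤ → AddSubgroup M)
    (π : ℤ → M →+ M) (h_mem : ∀ i m, m ∈ deg i → π i m = m)
    (h_ne : ∀ i j m, m ∈ deg i → i ≠ j → π j m = 0)
    (h_sup : ∀ m, m ∈ ⨆ i, deg i) : DirectSum.IsInternal deg := by
  have key : ∀ (z : DirectSum ℤ fun i => deg i) (j : ℤ),
      π j (DirectSum.coeAddMonoidHom deg z) = z j := by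
    intro z j
    induction z using DirectSum.induction_on with
    | zero => simp
    | of i m =>
      rw [DirectSum.coeAddMonoidHom_of]
      by_cases h : i = j
      · subst h
        rw [h_mem _ _ m.2, DirectSum.of_eq_same]
      · rw [h_ne i j m m.2 h, DirectSum.of_eq_of_ne _ _ _ (Ne.symm h)]
        rfl
    | add x y hx hy => rw [map_add, map_add, hx, hy]; rfl
  refine ⟨(injective_iff_map_eq_zero _).2 fun z hz => DFinsupp.ext fun j => ?_, fun m => ?_⟩
  · exact Subtype.ext (by rw [← key z j, hz, map_zero]; rfl)
  · refine AddSubgroup.iSup_induction deg (C := fun m => ∃ z,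
      DirectSum.coeAddMonoidHom deg z = m) (h_sup m) (fun i m hm => ?_) ⟨0, map_zero _⟩ ?_
    · exact ⟨DirectSum.of (fun i => deg i) i ⟨m, hm⟩, DirectSum.coeAddMonoidHom_of deg _ _⟩
    · rintro _ _ ⟨x, rfl⟩ ⟨y, rfl⟩
      exact ⟨x + y, map_add _ _ _⟩

namespace GrMod

variable {R : Type u} [Ring R] {𝒜 : ℤ → AddSubgroup R}

noncomputable instance decomposition (M : GrMod 𝒜) : DirectSum.Decomposition M.deg :=
  M.isInternal.chooseDecomposition

/-- The homogeneous part of degree `i`. -/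
noncomputable def proj (M : GrMod 𝒜) (i : ℤ) : M.carrier →+ M.carrier where
  toFun m := (DirectSum.decompose M.deg m i : M.carrier)
  map_zero' := by simp
  map_add' := by simp

variable {M N : GrMod 𝒜}

theorem proj_mem (i : ℤ) (m : M.carrier) : M.proj i m ∈ M.deg i :=
  (DirectSum.decompose M.deg m i).2

theorem proj_of_mem {i : ℤ} {m : M.carrier} (hm : m ∈ M.deg i) : M.proj i m = m :=
  DirectSum.decompose_of_mem_same M.deg hm

theorem proj_of_mem_ne {i j : ℤ} {m : M.carrier} (hm : m ∈ M.deg i) (h : i ≠ j) :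
    M.proj j m = 0 :=
  DirectSum.decompose_of_mem_ne M.deg hm h

@[elab_as_elim]
theorem induction {p : M.carrier → Prop} (m : M.carrier) (zero : p 0)
    (homogeneous : ∀ i m, m ∈ M.deg i → p m) (add : ∀ m m', p m → p m' → p (m + m')) : p m :=
  DirectSum.Decomposition.inductionOn M.deg zero (fun m => homogeneous _ m m.2) add m

theorem mem_of_proj_mem {S : AddSubgroup M.carrier} {m : M.carrier}
    (h : ∀ i, M.proj i m ∈ S) : m ∈ S := by
  classical
  rw [← DirectSum.sum_support_decompose M.deg m]
  exact sum_mem fun i _ => h i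

theorem eq_zero_of_proj {m : M.carrier} (h : ∀ i, M.proj i m = 0) : m = 0 :=
  mem_of_proj_mem (S := ⊥) h

/-- This makes ranges homogeneous, so that images exist as graded modules. -/
theorem map_proj (f : M ⟶ N) (i : ℤ) (m : M.carrier) : f.1 (M.proj i m) = N.proj i (f.1 m) := by
  induction m using induction with
  | zero => simp
  | homogeneous j m hm =>
    by_cases h : j = i
    · subst h
      rw [proj_of_mem hm, proj_of_mem (f.2 _ _ hm)]
    · rw [proj_of_mem_ne hm h, proj_of_mem_ne (f.2 _ _ hm) h, map_zero]
  | add m m' h h' => rw [map_add, map_add, h, h', map_add, map_add]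

/-- A submodule is homogeneous if it contains the homogeneous parts of its elements. -/
def IsHomogeneous (S : Submodule Rᵐᵒᵖ M.carrier) : Prop :=
  ∀ m ∈ S, ∀ i, M.proj i m ∈ S

/-- A homogeneous submodule, as a graded module. -/
def sub (S : Submodule Rᵐᵒᵖ M.carrier) (hS : IsHomogeneous S) : GrMod 𝒜 where
  carrier := S
  deg i := (M.deg i).comap S.subtype.toAddMonoidHom
  isInternal := by
    refine isInternal_of_proj _
      (fun i => ((M.proj i).comp S.subtype.toAddMonoidHom).codRestrict S fun m => hS m m.2 i)
      (fun i m hm => Subtype.ext (proj_of_mem hm))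
      (fun i j m hm h => Subtype.ext (proj_of_mem_ne hm h)) fun m => ?_
    classical
    have h : m = ∑ i ∈ (DirectSum.decompose M.deg (m : M.carrier)).support,
        (⟨M.proj i m, hS m m.2 i⟩ : S) := by
      refine Subtype.ext ?_
      rw [AddSubmonoidClass.coe_finsetSum]
      exact (DirectSum.sum_support_decompose M.deg (m : M.carrier)).symm
    rw [h]
    exact sum_mem fun i _ => AddSubgroup.mem_iSup_of_mem i (proj_mem (M := M) i m)
  smul_mem hm hr := M.smul_mem hm hr

/-- The inclusion of a homogeneous submodule. -/
def subι (S : Submodule Rᵐᵒᵖ M.carrier) (hS : IsHomogeneous S) : sub S hS ⟶ M :=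
  ⟨S.subtype, fun _ _ hm => hm⟩

/-- The factorization of a map through a homogeneous submodule. -/
def subLift (S : Submodule Rᵐᵒᵖ M.carrier) (hS : IsHomogeneous S) (f : N ⟶ M)
    (hf : ∀ n, f.1 n ∈ S) : N ⟶ sub S hS :=
  ⟨f.1.codRestrict S hf, fun i n hn => f.2 i n hn⟩

theorem isHomogeneous_range (f : M ⟶ N) : IsHomogeneous (LinearMap.range f.1) := by
  rintro _ ⟨m, rfl⟩ i
  exact ⟨_, map_proj f i m⟩

theorem epi_of_surjective (f : M ⟶ N) (hf : Function.Surjective f.1) : Epi f where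
  left_cancellation g h e := hom_ext fun n => by
    obtain ⟨m, rfl⟩ := hf n
    exact congrArg (fun z : M ⟶ _ => z.1 m) e

/-- Maps from a projective module lift along maps with a larger range. -/
theorem exists_lift {P : GrMod 𝒜} [Projective P] (f : M ⟶ N) (w : P ⟶ N)
    (h : LinearMap.range w.1 ≤ LinearMap.range f.1) : ∃ v : P ⟶ M, v ≫ f = w := by
  let e : M ⟶ sub _ (isHomogeneous_range f) := subLift _ _ f fun m => ⟨m, rfl⟩
  let w' : P ⟶ sub _ (isHomogeneous_range f) := subLift _ _ w fun m => h ⟨m, rfl⟩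
  have : Epi e := epi_of_surjective e fun ⟨_, m, rfl⟩ => ⟨m, rfl⟩
  refine ⟨Projective.factorThru w' e, ?_⟩
  have h' := congrArg (· ≫ subι _ (isHomogeneous_range f)) (Projective.factorThru_comp w' e)
  exact (Category.assoc _ _ _).symm.trans h'

instance : IsIdempotentComplete (GrMod 𝒜) where
  idempotents_split M p hp := by
    refine ⟨sub _ (isHomogeneous_range p), subι _ _, subLift _ _ p fun m => ⟨m, rfl⟩, ?_, rfl⟩
    refine hom_ext ?_
    rintro ⟨_, m, rfl⟩
    exact Subtype.ext (congrArg (fun z : M ⟶ M => z.1 m) hp)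

theorem isInternal_prod {A B : Type*} [AddCommGroup A] [AddCommGroup B] {a : ℤ → AddSubgroup A}
    {b : ℤ → AddSubgroup B} (ha : DirectSum.IsInternal a) (hb : DirectSum.IsInternal b) :
    DirectSum.IsInternal fun i => (a i).prod (b i) := by
  let _ := ha.chooseDecomposition
  let _ := hb.chooseDecomposition
  let πa : ℤ → A →+ A := fun i =>
    { toFun m := (DirectSum.decompose a m i : A)
      map_zero' := by simp
      map_add' := by simp }
  let πb : ℤ → B →+ B := fun i =>
    { toFun m := (DirectSum.decompose b m i : B)
      map_zero' := by simp
      map_add' := by simp }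
  refine isInternal_of_proj _ (fun i => (πa i).prodMap (πb i)) ?_ ?_ ?_
  · rintro i ⟨m, m'⟩ ⟨hm, hm'⟩
    exact Prod.ext (DirectSum.decompose_of_mem_same a hm) (DirectSum.decompose_of_mem_same b hm')
  · rintro i j ⟨m, m'⟩ ⟨hm, hm'⟩ h
    exact Prod.ext (DirectSum.decompose_of_mem_ne a hm h) (DirectSum.decompose_of_mem_ne b hm' h)
  · rintro ⟨m, m'⟩
    rw [show (m, m') = (m, 0) + (0, m') by simp]
    refine add_mem ?_ ?_
    · induction m using DirectSum.Decomposition.inductionOn a with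
      | zero => exact zero_mem _
      | @homogeneous i m => exact AddSubgroup.mem_iSup_of_mem i ⟨m.2, zero_mem _⟩
      | add m n hm hn => rw [show (m + n, (0 : B)) = (m, 0) + (n, 0) by simp]; exact add_mem hm hn
    · induction m' using DirectSum.Decomposition.inductionOn b with
      | zero => exact zero_mem _
      | @homogeneous i m => exact AddSubgroup.mem_iSup_of_mem i ⟨zero_mem _, m.2⟩
      | add m n hm hn => rw [show ((0 : A), m + n) = (0, m) + (0, n) by simp]; exact add_mem hm hn

/-- The direct sum of two graded modules. -/
def prod (M N : GrMod 𝒜) : GrMod 𝒜 where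
  carrier := M.carrier × N.carrier
  deg i := (M.deg i).prod (N.deg i)
  isInternal := isInternal_prod M.isInternal N.isInternal
  smul_mem hm hr := ⟨M.smul_mem hm.1 hr, N.smul_mem hm.2 hr⟩

/-- The direct sum of two graded modules, as a binary bicone. -/
def bicone (M N : GrMod 𝒜) : BinaryBicone M N where
  pt := prod M N
  fst := ⟨LinearMap.fst _ _ _, fun _ _ hm => hm.1⟩
  snd := ⟨LinearMap.snd _ _ _, fun _ _ hm => hm.2⟩
  inl := ⟨LinearMap.inl _ _ _, fun _ _ hm => ⟨hm, zero_mem _⟩⟩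
  inr := ⟨LinearMap.inr _ _ _, fun _ _ hm => ⟨zero_mem _, hm⟩⟩
  inl_fst := rfl
  inl_snd := rfl
  inr_fst := rfl
  inr_snd := rfl

theorem bicone_total (M N : GrMod 𝒜) : (bicone M N).fst ≫ (bicone M N).inl +
    (bicone M N).snd ≫ (bicone M N).inr = 𝟙 _ :=
  hom_ext fun m => Prod.ext (add_zero m.1) (zero_add m.2)

instance : HasBinaryBiproducts (GrMod 𝒜) where
  has_binary_biproduct M N := ⟨⟨bicone M N, isBinaryBilimitOfTotal _ (bicone_total M N)⟩⟩

end GrMod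

/-! ### The category of projective graded modules -/

section ProjGrMod

variable {R : Type u} [Ring R] {𝒜 : ℤ → AddSubgroup R}

instance (M : ProjGrMod 𝒜) : Projective M.obj := M.property

instance : IsIdempotentComplete (ProjGrMod 𝒜) where
  idempotents_split M p hp := by
    obtain ⟨Y, i, e, h₁, h₂⟩ := IsIdempotentComplete.idempotents_split M.obj p.hom
      (congrArg (fun z : M ⟶ M => z.hom) hp)
    have : Projective Y := (Retract.mk i e h₁).projective
    exact ⟨⟨Y, this⟩, ObjectProperty.homMk i, ObjectProperty.homMk e,
      ObjectProperty.hom_ext _ h₁, ObjectProperty.hom_ext _ h₂⟩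

instance : HasBinaryBiproducts (ProjGrMod 𝒜) where
  has_binary_biproduct M N := by
    let Y : ProjGrMod 𝒜 := ⟨M.obj ⊞ N.obj, (inferInstance : Projective (M.obj ⊞ N.obj))⟩
    let b : BinaryBicone M N :=
      { pt := Y
        fst := ObjectProperty.homMk biprod.fst
        snd := ObjectProperty.homMk biprod.snd
        inl := ObjectProperty.homMk biprod.inl
        inr := ObjectProperty.homMk biprod.inr
        inl_fst := ObjectProperty.hom_ext _ biprod.inl_fst
        inl_snd := ObjectProperty.hom_ext _ biprod.inl_snd
        inr_fst := ObjectProperty.hom_ext _ biprod.inr_fst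
        inr_snd := ObjectProperty.hom_ext _ biprod.inr_snd }
    exact ⟨⟨b, isBinaryBilimitOfTotal b (ObjectProperty.hom_ext _ biprod.total)⟩⟩

/-- The shift of projective graded modules is the shift of the underlying graded modules. -/
noncomputable def ProjGrMod.shiftIso (M : ProjGrMod 𝒜) (n : ℤ) :
    (M⟦n⟧).obj ≅ (GrMod.shiftBy n).obj M.obj :=
  ((isProjective (GrMod 𝒜)).ι.commShiftIso n).app M

theorem ProjGrMod.shiftIso_nat {M N : ProjGrMod 𝒜} (f : M ⟶ N) (n : ℤ) :
    (f⟦n⟧').hom ≫ (N.shiftIso n).hom = (M.shiftIso n).hom ≫ (GrMod.shiftBy n).map f.hom :=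
  ((isProjective (GrMod 𝒜)).ι.commShiftIso n).hom.naturality f

instance (n : ℤ) : HasBinaryBiproducts (PullbackShift (ProjGrMod 𝒜) (zmultiplesHom ℤ n)) :=
  inferInstanceAs (HasBinaryBiproducts (ProjGrMod 𝒜))

instance (n : ℤ) : IsIdempotentComplete (PullbackShift (ProjGrMod 𝒜) (zmultiplesHom ℤ n)) :=
  inferInstanceAs (IsIdempotentComplete (ProjGrMod 𝒜))

end ProjGrMod

/-! ### Homogeneous complements and the graded field case -/

namespace GrMod

variable {R : Type u} [Ring R] {𝒜 : ℤ → AddSubgroup R} {N : GrMod 𝒜}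

theorem IsHomogeneous.sup {S T : Submodule Rᵐᵒᵖ N.carrier} (hS : IsHomogeneous S)
    (hT : IsHomogeneous T) : IsHomogeneous (S ⊔ T) := by
  intro m hm i
  obtain ⟨s, hs, t, ht, rfl⟩ := Submodule.mem_sup.1 hm
  rw [map_add]
  exact Submodule.add_mem_sup (hS s hs i) (hT t ht i)

theorem proj_smul_of_mem [GradedRing 𝒜] {i : ℤ} {p : N.carrier} (hp : p ∈ N.deg i) (r : R) (j : ℤ) :
    N.proj j (MulOpposite.op r • p) =
      MulOpposite.op (DirectSum.decompose 𝒜 r (j - i) : R) • p := by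
  induction r using DirectSum.Decomposition.inductionOn 𝒜 with
  | zero => simp
  | @homogeneous l r =>
    by_cases h : l = j - i
    · subst h
      rw [DirectSum.decompose_of_mem_same 𝒜 r.2, proj_of_mem]
      simpa using N.smul_mem hp r.2
    · rw [DirectSum.decompose_of_mem_ne 𝒜 r.2 h, proj_of_mem_ne (N.smul_mem hp r.2) (by omega)]
      simp
  | add r r' h h' =>
    simp only [MulOpposite.op_add, add_smul, map_add, h, h', DirectSum.decompose_add,
      DirectSum.add_apply, AddSubgroup.coe_add]

theorem isHomogeneous_span_singleton [GradedRing 𝒜] {i : ℤ} {p : N.carrier} (hp : p ∈ N.deg i) :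
    IsHomogeneous (Submodule.span Rᵐᵒᵖ {p}) := by
  intro m hm j
  obtain ⟨⟨r⟩, rfl⟩ := Submodule.mem_span_singleton.1 hm
  exact Submodule.mem_span_singleton.2 ⟨_, (proj_smul_of_mem hp r j).symm⟩

/-- If the nonzero homogeneous multiples of the homogeneous elements of a graded module are
generators of the same cyclic submodules, then the homogeneous submodules have homogeneous
complements. -/
theorem exists_isCompl [GradedRing 𝒜]
    (H : ∀ (i j : ℤ) (p : N.carrier) (r : R), p ∈ N.deg i → r ∈ 𝒜 j → MulOpposite.op r • p ≠ 0 →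
      ∃ r' : R, MulOpposite.op r' • MulOpposite.op r • p = p)
    {T : Submodule Rᵐᵒᵖ N.carrier} (hT : IsHomogeneous T) :
    ∃ S, IsHomogeneous S ∧ IsCompl T S := by
  -- S is maximal among the homogeneous submodules meeting T trivially.
  obtain ⟨S, -, ⟨hS, hd⟩, hmax⟩ := zorn_le_nonempty₀
    {S : Submodule Rᵐᵒᵖ N.carrier | IsHomogeneous S ∧ Disjoint T S} (by
      intro c hc hchain y hy
      have hdir := hchain.directedOn
      refine ⟨sSup c, ⟨fun m hm i => ?_, ?_⟩, fun z hz => le_sSup hz⟩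
      · obtain ⟨S, hS, hm⟩ := (Submodule.mem_sSup_of_directed ⟨y, hy⟩ hdir).1 hm
        exact (Submodule.mem_sSup_of_directed ⟨y, hy⟩ hdir).2 ⟨S, hS, (hc hS).1 m hm i⟩
      · rw [Submodule.disjoint_def]
        intro m hm hm'
        obtain ⟨S, hS, hm'⟩ := (Submodule.mem_sSup_of_directed ⟨y, hy⟩ hdir).1 hm'
        exact Submodule.disjoint_def.1 (hc hS).2 m hm hm') ⊥
    ⟨fun m hm i => by rw [(Submodule.mem_bot _).1 hm, map_zero]; exact zero_mem _, disjoint_bot_right⟩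
  refine ⟨S, hS, hd, codisjoint_iff.2 (eq_top_iff.2 fun m _ => ?_)⟩
  induction m using induction with
  | zero => exact zero_mem _
  | add m m' h h' => exact add_mem (h trivial) (h' trivial)
  | homogeneous i p hp =>
    by_contra hpST
    have hS' := hS.sup (isHomogeneous_span_singleton hp)
    have hnd : ¬ Disjoint T (S ⊔ Submodule.span Rᵐᵒᵖ {p}) := fun h => hpST <|
      Submodule.mem_sup_right (hmax (y := S ⊔ Submodule.span Rᵐᵒᵖ {p}) ⟨hS', h⟩ le_sup_left
        (Submodule.mem_sup_right (Submodule.mem_span_singleton_self p)))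
    rw [Submodule.disjoint_def] at hnd
    push Not at hnd
    obtain ⟨t, htT, htS, ht⟩ := hnd
    -- A nonzero homogeneous component of t has the form s + p·r with r homogeneous. If p·r = 0 it
    -- lies in both T and S, which is excluded; otherwise H recovers p from p·r, so p lies in T ⊔ S
    -- after all.
    obtain ⟨j, hj⟩ : ∃ j, N.proj j t ≠ 0 := by
      by_contra! h
      exact ht (eq_zero_of_proj h)
    obtain ⟨s, hs, y, hy, rfl⟩ := Submodule.mem_sup.1 htS
    obtain ⟨⟨r⟩, rfl⟩ := Submodule.mem_span_singleton.1 hy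
    have e := (N.proj j).map_add s (MulOpposite.op r • p)
    rw [proj_smul_of_mem hp] at e
    have hsj := hS s hs j
    have htj := hT _ htT j
    change N.proj j (s + MulOpposite.op r • p) ≠ 0 at hj
    change N.proj j (s + MulOpposite.op r • p) ∈ T at htj
    rw [e] at hj htj
    by_cases h0 : MulOpposite.op (DirectSum.decompose 𝒜 r (j - i) : R) • p = 0
    · rw [h0, add_zero] at hj htj
      exact hj (Submodule.disjoint_def.1 hd _ htj hsj)
    · obtain ⟨r', hr'⟩ := H i (j - i) p _ hp (DirectSum.decompose 𝒜 r (j - i)).2 h0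
      refine hpST ?_
      rw [← hr']
      refine Submodule.smul_mem _ _ ?_
      rw [← add_sub_cancel_left (N.proj j s) (MulOpposite.op _ • p)]
      exact sub_mem (Submodule.mem_sup_left htj) (Submodule.mem_sup_right hsj)

/-- A homogeneous submodule with a homogeneous complement is the image of a homogeneous
projection. -/
theorem exists_projection {T S : Submodule Rᵐᵒᵖ N.carrier} (hT : IsHomogeneous T)
    (hS : IsHomogeneous S) (h : IsCompl T S) :
    ∃ ρ : N ⟶ N, (∀ n, ρ.1 n ∈ T) ∧ ∀ t ∈ T, ρ.1 t = t := by
  have key : ∀ n, n - (T.projectionOnto S h n : N.carrier) ∈ S := fun n =>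
    (Submodule.projectionOnto_apply_eq_zero_iff h).1 (by
      rw [map_sub, Submodule.projectionOnto_apply_left, sub_self])
  refine ⟨⟨T.subtype.comp (T.projectionOnto S h), fun i n hn => ?_⟩, fun n => Subtype.prop _,
    fun t ht => congrArg Subtype.val (Submodule.projectionOnto_apply_of_mem_left h ht)⟩
  change (T.projectionOnto S h n : N.carrier) ∈ N.deg i
  -- For n of degree i, taking the degree i part of n - ρn ∈ S and subtracting shows that ρn minus
  -- its degree i part lies in T ⊓ S, hence vanishes. So the projection preserves degrees.
  have h₁ := key n
  have h₂ := hS _ h₁ i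
  rw [map_sub, proj_of_mem hn] at h₂
  have h₃ := sub_mem h₂ h₁
  rw [sub_sub_sub_cancel_left] at h₃
  have h₄ := Submodule.disjoint_def.1 h.disjoint _
    (sub_mem (T.projectionOnto S h n).2 (hT _ (T.projectionOnto S h n).2 i)) h₃
  rw [sub_eq_zero.1 h₄]
  exact proj_mem _ _

/-- Every map of projective graded modules over a graded field is von Neumann regular. -/
theorem exists_regular {k : Type u} [Ring k] {𝒦 : ℤ → AddSubgroup k} [GradedRing 𝒦]
    (hk : IsGradedField 𝒦) {M N : GrMod 𝒦} [Projective N] (a : M ⟶ N) :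
    ∃ b : N ⟶ M, a ≫ b ≫ a = a := by
  obtain ⟨S, hS, hc⟩ := exists_isCompl (fun i j p r _ hr hrp => by
    have hr0 : r ≠ 0 := by
      rintro rfl
      exact hrp (by simp)
    obtain ⟨r', hr'⟩ := (hk.isUnit j r hr hr0).exists_right_inv
    refine ⟨r', ?_⟩
    rw [smul_smul, ← MulOpposite.op_mul, hr', MulOpposite.op_one, one_smul])
    (isHomogeneous_range a)
  obtain ⟨ρ, hρ, hρ'⟩ := exists_projection (isHomogeneous_range a) hS hc
  -- Projectivity of N lifts the projection ρ onto the range of a to a map b with b ≫ a = ρ.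
  obtain ⟨b, hb⟩ := exists_lift a ρ (by
    rintro _ ⟨n, rfl⟩
    exact hρ n)
  exact ⟨b, hb ▸ hom_ext fun m => hρ' _ ⟨m, rfl⟩⟩

end GrMod

theorem ProjGrMod.exists_regular {k : Type u} [Ring k] {𝒦 : ℤ → AddSubgroup k} [GradedRing 𝒦]
    (hk : IsGradedField 𝒦) {A B : ProjGrMod 𝒦} (f : A ⟶ B) : ∃ b : B ⟶ A, f ≫ b ≫ f = f := by
  obtain ⟨b, hb⟩ := GrMod.exists_regular hk f.hom
  exact ⟨ObjectProperty.homMk b, ObjectProperty.hom_ext _ hb⟩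

/-- Graded fields are `Δⁿ`-rings. -/
theorem IsGradedField.isDeltaRing {k : Type u} [Ring k] {𝒦 : ℤ → AddSubgroup k} [GradedRing 𝒦]
    (hk : IsGradedField 𝒦) (n : ℤ) : IsDeltaRing 𝒦 n := by
  have h := Pretriangulated.isTriangleModel_of_regular
    (C := PullbackShift (ProjGrMod 𝒦) (zmultiplesHom ℤ n)) (ProjGrMod.exists_regular hk)
  exact h.exists_isTriangulated

/-! ### Signs, induced modules and exactness of multiplication by x -/

namespace GrMod

open MulOpposite

section sign

variable {R : Type u} [Ring R] {𝒜 : ℤ → AddSubgroup R} (M : GrMod 𝒜)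

/-- The sign operator, `m ↦ (-1)^|m| m`. -/
noncomputable def sign : M.carrier →+ M.carrier :=
  (DirectSum.toAddMonoid fun j : ℤ =>
      j.negOnePow • (M.deg j).subtype).comp (DirectSum.decomposeAddEquiv M.deg).toAddMonoidHom

variable {M} {N : GrMod 𝒜}

theorem sign_of_mem {j : ℤ} {m : M.carrier} (hm : m ∈ M.deg j) :
    M.sign m = j.negOnePow • m := by
  change DirectSum.toAddMonoid _ (DirectSum.decompose M.deg m) = _
  rw [DirectSum.decompose_of_mem M.deg hm, DirectSum.toAddMonoid_of]
  rfl

theorem sign_mem {j : ℤ} {m : M.carrier} (hm : m ∈ M.deg j) : M.sign m ∈ M.deg j := by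
  rw [sign_of_mem hm]
  rcases Int.even_or_odd j with h | h
  · rwa [Int.negOnePow_even _ h, one_smul]
  · rw [Int.negOnePow_odd _ h, Units.neg_smul, one_smul]
    exact neg_mem hm

theorem sign_sign (m : M.carrier) : M.sign (M.sign m) = m := by
  induction m using induction with
  | zero => simp
  | homogeneous j m hm =>
    rw [sign_of_mem (sign_mem hm), sign_of_mem hm, smul_smul, ← Int.negOnePow_add,
      Int.negOnePow_even _ ⟨j, rfl⟩, one_smul]
  | add m m' h h' => rw [map_add, map_add, h, h']

theorem map_sign (f : M ⟶ N) (m : M.carrier) : f.1 (M.sign m) = N.sign (f.1 m) := by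
  induction m using induction with
  | zero => simp
  | homogeneous j m hm =>
    rw [sign_of_mem hm, sign_of_mem (f.2 _ _ hm), Units.smul_def, Units.smul_def, map_zsmul]
  | add m m' h h' => rw [map_add, map_add, h, h', map_add, map_add]

theorem sign_smul {j : ℤ} {r : R} (hr : r ∈ 𝒜 j) (m : M.carrier) :
    M.sign (op r • m) = j.negOnePow • op r • M.sign m := by
  induction m using induction with
  | zero => simp
  | homogeneous l m hm =>
    rw [sign_of_mem hm, sign_of_mem (M.smul_mem hm hr), add_comm, Int.negOnePow_add, mul_smul,
      smul_comm l.negOnePow (op r)]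
  | add m m' h h' => rw [smul_add, map_add, map_add, h, h', smul_add, smul_add]

/-- A shift by n changes all degrees by n. This factor is the source of the sign that rotation
requires. -/
theorem sign_shiftObj (n : ℤ) (m : M.carrier) :
    (M.shiftObj n).sign m = n.negOnePow • M.sign m := by
  induction m using induction with
  | zero => exact (map_zero (M.shiftObj n).sign).trans ((smul_zero n.negOnePow).symm.trans
    (congrArg _ (map_zero M.sign).symm))
  | homogeneous l m hm =>
    have hm' : m ∈ (M.shiftObj n).deg (l + n) := by
      change m ∈ M.deg (l + n - n)
      rwa [add_sub_cancel_right]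
    refine (sign_of_mem hm').trans ?_
    rw [sign_of_mem hm, add_comm, Int.negOnePow_add]
    exact mul_smul n.negOnePow l.negOnePow m
  | add m m' h h' => 
    refine ((map_add (M.shiftObj n).sign m m').trans (congrArg₂ (· + ·) h h')).trans ?_
    rw [map_add]
    exact (smul_add n.negOnePow (M.sign m) (M.sign m')).symm

end sign

section exterior

variable {k : Type u} [Ring k] {𝒦 : ℤ → AddSubgroup k} {i : ℤ}

theorem inl_mem_exteriorGrading {j : ℤ} {a : k} (ha : a ∈ 𝒦 j) :
    (TrivSqZeroExt.inl a : DualNumber k) ∈ exteriorGrading 𝒦 i j :=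
  ⟨ha, zero_mem _⟩

variable [GradedRing 𝒦]

theorem eps_mem_exteriorGrading : (DualNumber.eps : DualNumber k) ∈ exteriorGrading 𝒦 i i :=
  ⟨zero_mem _, by
    change (1 : k) ∈ 𝒦 (i - i)
    rw [sub_self]
    exact SetLike.GradedOne.one_mem⟩

theorem mul_eps (r : DualNumber k) : r * DualNumber.eps = TrivSqZeroExt.inr r.fst :=
  TrivSqZeroExt.ext (by simp) (by simp)

theorem eps_mul (r : DualNumber k) : DualNumber.eps * r = TrivSqZeroExt.inr r.fst :=
  TrivSqZeroExt.ext (by simp) (by simp)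

/-- The elements `m ⊗ 1 + m' ⊗ x` of the induced module `M ⊗ₖ k[x]/(x²)`. -/
def Induced (A : Type u) : Type u := A × A

instance (A : Type u) [AddCommGroup A] : AddCommGroup (Induced A) :=
  inferInstanceAs (AddCommGroup (A × A))

instance (A : Type u) [AddCommGroup A] [Module (DualNumber k)ᵐᵒᵖ A] :
    Module (DualNumber k)ᵐᵒᵖ (Induced A) where
  smul r m := (op (TrivSqZeroExt.inl r.unop.fst : DualNumber k) • m.1,
    op (TrivSqZeroExt.inl r.unop.fst : DualNumber k) • m.2 +
      op (TrivSqZeroExt.inl r.unop.snd : DualNumber k) • m.1)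
  one_smul m := by
    refine Prod.ext (one_smul _ m.1) ?_
    change op (TrivSqZeroExt.inl (1 : k) : DualNumber k) • m.2 +
      op (TrivSqZeroExt.inl (0 : k) : DualNumber k) • m.1 = m.2
    simp
  mul_smul r s m := by
    refine Prod.ext ?_ ?_
    · change op (TrivSqZeroExt.inl (s.unop * r.unop).fst : DualNumber k) • m.1 =
        op (TrivSqZeroExt.inl r.unop.fst : DualNumber k) •
          op (TrivSqZeroExt.inl s.unop.fst : DualNumber k) • m.1
      rw [smul_smul, ← op_mul, ← TrivSqZeroExt.inl_mul, TrivSqZeroExt.fst_mul]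
    · change op (TrivSqZeroExt.inl (s.unop * r.unop).fst : DualNumber k) • m.2 +
          op (TrivSqZeroExt.inl (s.unop * r.unop).snd : DualNumber k) • m.1 =
        op (TrivSqZeroExt.inl r.unop.fst : DualNumber k) •
          (op (TrivSqZeroExt.inl s.unop.fst : DualNumber k) • m.2 +
            op (TrivSqZeroExt.inl s.unop.snd : DualNumber k) • m.1) +
        op (TrivSqZeroExt.inl r.unop.snd : DualNumber k) •
          op (TrivSqZeroExt.inl s.unop.fst : DualNumber k) • m.1
      simp only [smul_add, smul_smul, ← op_mul, ← TrivSqZeroExt.inl_mul, TrivSqZeroExt.fst_mul,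
        TrivSqZeroExt.snd_mul, smul_eq_mul, op_smul_eq_mul, TrivSqZeroExt.inl_add, MulOpposite.op_add, add_smul]
      abel
  smul_zero r := by
    refine Prod.ext (smul_zero _) ?_
    change _ • (0 : A) + _ • (0 : A) = 0
    rw [smul_zero, smul_zero, add_zero]
  smul_add r m m' := by
    refine Prod.ext (smul_add _ m.1 m'.1) ?_
    change _ • (m.2 + m'.2) + _ • (m.1 + m'.1) = (_ • m.2 + _ • m.1) + (_ • m'.2 + _ • m'.1)
    rw [smul_add, smul_add, add_add_add_comm]
  add_smul r s m := by
    refine Prod.ext ?_ ?_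
    · change op (TrivSqZeroExt.inl (r.unop + s.unop).fst : DualNumber k) • m.1 =
        op (TrivSqZeroExt.inl r.unop.fst : DualNumber k) • m.1 +
          op (TrivSqZeroExt.inl s.unop.fst : DualNumber k) • m.1
      rw [TrivSqZeroExt.fst_add, TrivSqZeroExt.inl_add, MulOpposite.op_add, add_smul]
    · change op (TrivSqZeroExt.inl (r.unop + s.unop).fst : DualNumber k) • m.2 +
          op (TrivSqZeroExt.inl (r.unop + s.unop).snd : DualNumber k) • m.1 =
        (op (TrivSqZeroExt.inl r.unop.fst : DualNumber k) • m.2 +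
          op (TrivSqZeroExt.inl r.unop.snd : DualNumber k) • m.1) +
        (op (TrivSqZeroExt.inl s.unop.fst : DualNumber k) • m.2 +
          op (TrivSqZeroExt.inl s.unop.snd : DualNumber k) • m.1)
      rw [TrivSqZeroExt.fst_add, TrivSqZeroExt.inl_add, MulOpposite.op_add, add_smul, TrivSqZeroExt.snd_add,
        TrivSqZeroExt.inl_add, MulOpposite.op_add, add_smul, add_add_add_comm]
  zero_smul m := by
    refine Prod.ext (zero_smul _ m.1) ?_
    change op (TrivSqZeroExt.inl (0 : k) : DualNumber k) • m.2 +
      op (TrivSqZeroExt.inl (0 : k) : DualNumber k) • m.1 = 0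
    simp

/-- The graded module induced from the underlying graded `k`-module. -/
def induced (M : GrMod (exteriorGrading 𝒦 i)) : GrMod (exteriorGrading 𝒦 i) where
  carrier := Induced M.carrier
  deg j := (M.deg j).prod (M.deg (j - i))
  isInternal := isInternal_prod M.isInternal (isInternal_sub M.isInternal i)
  smul_mem {j l m r} hm hr := by
    refine ⟨M.smul_mem hm.1 (inl_mem_exteriorGrading hr.1), add_mem ?_ ?_⟩
    · have h := M.smul_mem hm.2 (inl_mem_exteriorGrading (i := i) hr.1)
      rwa [show j - i + l = j + l - i by ring] at h
    · have h := M.smul_mem hm.1 (inl_mem_exteriorGrading (i := i) hr.2)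
      rwa [show j + (l - i) = j + l - i by ring] at h

/-- The canonical map from the induced module. -/
def inducedMap (M : GrMod (exteriorGrading 𝒦 i)) : induced M ⟶ M :=
  ⟨{ toFun := fun m => m.1 + op (DualNumber.eps : DualNumber k) • m.2
     map_add' := fun m m' => by
       change (m.1 + m'.1) + _ • (m.2 + m'.2) = (m.1 + _ • m.2) + (m'.1 + _ • m'.2)
       rw [smul_add, add_add_add_comm]
     map_smul' := fun ⟨r⟩ m => by
       change op (TrivSqZeroExt.inl r.fst : DualNumber k) • m.1 + op (DualNumber.eps : DualNumber k) •
           (op (TrivSqZeroExt.inl r.fst : DualNumber k) • m.2 +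
             op (TrivSqZeroExt.inl r.snd : DualNumber k) • m.1) =
         op r • (m.1 + op (DualNumber.eps : DualNumber k) • m.2)
       simp only [smul_add, smul_smul, ← op_mul, mul_eps, eps_mul, TrivSqZeroExt.fst_inl]
       have hr : op r • m.1 = op (TrivSqZeroExt.inl r.fst : DualNumber k) • m.1 +
           op (TrivSqZeroExt.inr r.snd : DualNumber k) • m.1 := by
         rw [← add_smul, ← MulOpposite.op_add]
         exact congrArg (op · • m.1) (TrivSqZeroExt.inl_fst_add_inr_snd_eq r).symm
       rw [hr]
       abel }, fun j m hm => by
    refine add_mem hm.1 ?_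
    have h := M.smul_mem hm.2 (eps_mem_exteriorGrading (𝒦 := 𝒦) (i := i))
    rwa [sub_add_cancel] at h⟩

/-- The kernel and the image of the multiplication by `x` on a projective module agree. -/
theorem exists_eps_smul_eq (M : GrMod (exteriorGrading 𝒦 i)) [Projective M] {m : M.carrier}
    (hm : op (DualNumber.eps : DualNumber k) • m = 0) :
    ∃ m', op (DualNumber.eps : DualNumber k) • m' = m := by
  have : Epi (inducedMap M) := epi_of_surjective _ fun m =>
    ⟨(m, 0), (congrArg (m + ·) (smul_zero _)).trans (add_zero m)⟩
  let s := Projective.factorThru (𝟙 M) (inducedMap M)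
  have h : (inducedMap M).1 (s.1 m) = m :=
    congrArg (fun z : M ⟶ M => z.1 m) (Projective.factorThru_comp (𝟙 M) (inducedMap M))
  -- A projective M is a retract of its induced module, on which x sends (m₁, m₂) to (0, m₁). Being
  -- killed by x therefore forces the first component of s m to vanish, and its image in M is then a
  -- multiple of x.
  have h₁ : op (DualNumber.eps : DualNumber k) • s.1 m = 0 := by
    rw [← map_smul, hm, map_zero]
  have h₂ : (s.1 m).1 = 0 := by
    have h₃ : op (TrivSqZeroExt.inl (0 : k) : DualNumber k) • (s.1 m).2 +
        op (TrivSqZeroExt.inl (1 : k) : DualNumber k) • (s.1 m).1 = 0 :=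
      congrArg (fun z : Induced M.carrier => z.2) h₁
    simpa using h₃
  refine ⟨(s.1 m).2, ?_⟩
  refine Eq.trans ?_ h
  change _ = (s.1 m).1 + op (DualNumber.eps : DualNumber k) • (s.1 m).2
  rw [h₂, zero_add]

end exterior
end GrMod

/-! ### Units and parity in graded fields -/

section gradedField

variable {k : Type u} [Ring k] {𝒦 : ℤ → AddSubgroup k} [GradedRing 𝒦]

theorem IsGradedField.negOnePow_smul (hk : IsGradedField 𝒦) {j : ℤ} {a : k} (ha : a ∈ 𝒦 j) :
    j.negOnePow • a = a := by
  simpa using hk.sign_smul ha 1 1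

/-- The homogeneous elements of a graded field are central. -/
theorem IsGradedField.mul_comm_of_mem (hk : IsGradedField 𝒦) {j : ℤ} {a : k} (ha : a ∈ 𝒦 j)
    (b : k) : a * b = b * a := by
  induction b using DirectSum.Decomposition.inductionOn 𝒦 with
  | zero => simp
  | homogeneous b => exact hk.comm ha b.2
  | add b b' h h' => rw [mul_add, add_mul, h, h']

theorem IsGradedField.inl_mul_comm_of_mem (hk : IsGradedField 𝒦) {j : ℤ} {a : k} (ha : a ∈ 𝒦 j)
    (r : DualNumber k) : (TrivSqZeroExt.inl a : DualNumber k) * r = r * TrivSqZeroExt.inl a :=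
  TrivSqZeroExt.ext (by simpa using hk.mul_comm_of_mem ha r.fst)
    (by simpa using hk.mul_comm_of_mem ha r.snd)

/-- The degree -d part of any inverse is already an inverse, by comparing degree 0 parts in a * c =
1. -/
theorem exists_mul_eq_one_of_mem {d : ℤ} {a : k} (ha : a ∈ 𝒦 d) (hu : IsUnit a) :
    ∃ b ∈ 𝒦 (-d), a * b = 1 := by
  obtain ⟨c, hc⟩ := hu.exists_right_inv
  refine ⟨DirectSum.decompose 𝒦 c (-d), Subtype.prop _, ?_⟩
  rw [← DirectSum.coe_decompose_mul_add_of_left_mem 𝒦 ha, hc, add_neg_cancel,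
    DirectSum.decompose_of_mem_same 𝒦 SetLike.GradedOne.one_mem]

/-- The existence of a unit of odd degree forces characteristic two. -/
theorem IsGradedField.two_eq_zero (hk : IsGradedField 𝒦) {d : ℤ} {a : k} (ha : a ∈ 𝒦 d)
    (hu : IsUnit a) (hd : Odd d) : (1 + 1 : k) = 0 := by
  have h := hk.negOnePow_smul ha
  rw [Int.negOnePow_odd _ hd, Units.neg_smul, one_smul] at h
  refine hu.mul_right_eq_zero.1 ?_
  rw [mul_add, mul_one]
  exact add_eq_zero_iff_neg_eq.2 h

end gradedField

/-! ### The signed multiplication by x and the cube root of the suspension -/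

namespace GrMod

open MulOpposite

section

variable {k : Type u} [Ring k] {𝒦 : ℤ → AddSubgroup k} {i : ℤ}

theorem negOnePow_smul_eq_neg (h : Odd i ∨ (1 + 1 : k) = 0) (M : GrMod (exteriorGrading 𝒦 i))
    (m : M.carrier) : i.negOnePow • m = -m := by
  rcases h with h | h
  · rw [Int.negOnePow_odd _ h, Units.neg_smul, one_smul]
  · have h₂ : m + m = 0 := by
      have h₁ : (1 + 1 : DualNumber k) = 0 := by
        rw [← TrivSqZeroExt.inl_one, ← TrivSqZeroExt.inl_add, h, TrivSqZeroExt.inl_zero]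
      have := congrArg (fun r => op r • m) h₁
      simpa [add_smul] using this
    rcases Int.units_eq_one_or i.negOnePow with e | e <;> rw [e]
    · rw [one_smul]
      exact eq_neg_of_add_eq_zero_left h₂
    · rw [Units.neg_smul, one_smul]

variable [GradedRing 𝒦] (hk : IsGradedField 𝒦)

-- Both x * r and r * x only see the component of r in k, and the sign (-1)^j produced by moving r
-- past the sign operator is invisible on elements of degree j of k.
include hk in
theorem eps_smul_sign_smul (M : GrMod (exteriorGrading 𝒦 i)) (r : DualNumber k) (m : M.carrier) :
    op (DualNumber.eps : DualNumber k) • M.sign (op r • m) =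
      op r • op (DualNumber.eps : DualNumber k) • M.sign m := by
  induction r using DirectSum.Decomposition.inductionOn (exteriorGrading 𝒦 i) with
  | zero => simp
  | add r r' h h' => rw [MulOpposite.op_add, add_smul, add_smul, map_add, smul_add, h, h']
  | @homogeneous j r =>
    rw [sign_smul r.2, smul_comm _ j.negOnePow, smul_smul, smul_smul, ← op_mul, ← op_mul,
      mul_eps, eps_mul]
    have h := hk.negOnePow_smul r.2.1
    rcases Int.units_eq_one_or j.negOnePow with e | e <;> rw [e] at h ⊢
    · rw [one_smul]
    · rw [Units.neg_smul, one_smul] at h ⊢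
      rw [← neg_smul, ← MulOpposite.op_neg, ← TrivSqZeroExt.inr_neg, h]

/-- The multiplication by `x`, with a sign making it linear. -/
noncomputable def signedEps (M : GrMod (exteriorGrading 𝒦 i)) : M ⟶ (shiftBy (-i)).obj M :=
  ⟨{ toFun := fun m => op (DualNumber.eps : DualNumber k) • M.sign m
     map_add' := fun m m' => by rw [map_add, smul_add]; rfl
     map_smul' := fun r m => eps_smul_sign_smul hk M r.unop m }, fun j m hm => by
    have h := M.smul_mem (sign_mem hm) (eps_mem_exteriorGrading (𝒦 := 𝒦) (i := i))
    change _ ∈ M.deg (j - -i)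
    rwa [sub_neg_eq_add]⟩

theorem signedEps_val (M : GrMod (exteriorGrading 𝒦 i)) (m : M.carrier) :
    (signedEps hk M).1 m = op (DualNumber.eps : DualNumber k) • M.sign m := rfl

theorem signedEps_nat {M N : GrMod (exteriorGrading 𝒦 i)} (f : M ⟶ N) :
    f ≫ signedEps hk N = signedEps hk M ≫ (shiftBy (-i)).map f :=
  hom_ext fun m => by
    change op (DualNumber.eps : DualNumber k) • N.sign (f.1 m) =
      f.1 (op (DualNumber.eps : DualNumber k) • M.sign m)
    rw [map_smul, map_sign]

theorem signedEps_shift_val (M : GrMod (exteriorGrading 𝒦 i)) (m : M.carrier) :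
    (signedEps hk ((shiftBy (-i)).obj M)).1 m =
      (i.negOnePow • op (DualNumber.eps : DualNumber k) • M.sign m : M.carrier) := by
  refine Eq.trans (congrArg (op (DualNumber.eps : DualNumber k) • ·)
    (sign_shiftObj (M := M) (-i) m) :) ?_
  rw [Int.negOnePow_neg]
  exact smul_comm (op (DualNumber.eps : DualNumber k)) i.negOnePow (M.sign m)

/-- Shifting by -i multiplies the sign operator by (-1)^i, and the parity hypothesis makes this
factor act as -1. This is where the condition on the degree of x and the characteristic enters. -/
theorem signedEps_shift (h : Odd i ∨ (1 + 1 : k) = 0) (M : GrMod (exteriorGrading 𝒦 i)) :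
    signedEps hk ((shiftBy (-i)).obj M) = -(shiftBy (-i)).map (signedEps hk M) :=
  hom_ext fun m => (signedEps_shift_val hk M m).trans (negOnePow_smul_eq_neg h M _)

theorem signedEps_signedEps (M : GrMod (exteriorGrading 𝒦 i)) :
    signedEps hk M ≫ signedEps hk ((shiftBy (-i)).obj M) = 0 :=
  hom_ext fun m => by
    refine (signedEps_shift_val hk M _).trans ?_
    rw [signedEps_val, sign_smul eps_mem_exteriorGrading,
      smul_comm (op (DualNumber.eps : DualNumber k)) i.negOnePow, smul_smul (op _) (op _),
      ← op_mul, DualNumber.eps_mul_eps, MulOpposite.op_zero, zero_smul, smul_zero, smul_zero]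
    rfl

/-- On the projective module M the kernel of x equals its image, so the range of w lies in that of
the signed multiplication, and projectivity of P gives the lift. -/
theorem exists_comp_signedEps {P M : GrMod (exteriorGrading 𝒦 i)} [Projective P] [Projective M]
    (w : P ⟶ (shiftBy (-i)).obj M) (hw : w ≫ signedEps hk ((shiftBy (-i)).obj M) = 0) :
    ∃ v, v ≫ signedEps hk M = w := by
  refine exists_lift _ w ?_
  rintro _ ⟨p, rfl⟩
  obtain ⟨y, hy⟩ : ∃ y : M.carrier, y = w.1 p := ⟨_, rfl⟩
  have h₁ : i.negOnePow • op (DualNumber.eps : DualNumber k) • M.sign y = 0 := by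
    rw [hy]
    exact (signedEps_shift_val hk M _).symm.trans (congrArg (fun z : P ⟶ _ => z.1 p) hw)
  obtain ⟨m, hm⟩ := exists_eps_smul_eq M ((smul_eq_zero_iff_eq _).1 h₁)
  -- The factor (-1)^i cancels the sign from moving the sign operator past x.
  refine ⟨i.negOnePow • m, Eq.trans ?_ hy⟩
  rw [signedEps_val, ← sign_sign y, ← hm, sign_smul eps_mem_exteriorGrading, Units.smul_def,
    Units.smul_def, map_zsmul, smul_comm]

/-- On the image U of x the element x acts as zero, so U is in effect a graded vector space over k
and its homogeneous submodules split. The argument for graded fields then applies to the composite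
of a with B ⟶ U, using projectivity of B. -/
theorem exists_regular_mod_signedEps {A B : GrMod (exteriorGrading 𝒦 i)} [Projective B]
    (a : A ⟶ B) : ∃ b : B ⟶ A, (a ≫ b ≫ a) ≫ signedEps hk B = a ≫ signedEps hk B := by
  let U := sub _ (isHomogeneous_range (signedEps hk B))
  let e : B ⟶ U := subLift _ _ (signedEps hk B) fun m => ⟨m, rfl⟩
  have he : e ≫ subι _ _ = signedEps hk B := rfl
  obtain ⟨S, hS, hc⟩ := exists_isCompl (N := U) (fun l j p r _ hr hrp => by
    obtain ⟨_, m, rfl⟩ := p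
    have h₁ : r.fst ≠ 0 := by
      intro h
      refine hrp (Subtype.ext ?_)
      change op r • op (DualNumber.eps : DualNumber k) • B.sign m = 0
      rw [smul_smul, ← op_mul, eps_mul, h, TrivSqZeroExt.inr_zero, MulOpposite.op_zero, zero_smul]
    obtain ⟨c, h₂⟩ := (hk.isUnit j _ hr.1 h₁).exists_right_inv
    refine ⟨TrivSqZeroExt.inl c, Subtype.ext ?_⟩
    change op (TrivSqZeroExt.inl c : DualNumber k) • op r •
      op (DualNumber.eps : DualNumber k) • B.sign m =
        op (DualNumber.eps : DualNumber k) • B.sign m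
    rw [smul_smul, smul_smul, ← op_mul, ← op_mul, eps_mul,
      TrivSqZeroExt.fst_mul, TrivSqZeroExt.fst_inl, h₂]
    rfl) (isHomogeneous_range (a ≫ e))
  obtain ⟨ρ, hρ, hρ'⟩ := exists_projection (isHomogeneous_range (a ≫ e)) hS hc
  obtain ⟨b, hb⟩ := exists_lift (a ≫ e) (e ≫ ρ) (by
    rintro _ ⟨m, rfl⟩
    exact hρ (e.1 m))
  refine ⟨b, ?_⟩
  have h : (a ≫ b ≫ a) ≫ e = a ≫ e := by
    rw [Category.assoc, Category.assoc, hb]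
    exact hom_ext fun m => hρ' _ ⟨m, rfl⟩
  rw [← he, ← Category.assoc, h, Category.assoc]

end

/-- The multiplication by a central homogeneous unit, as an isomorphism between shifts. -/
def tripleShiftIso {R : Type u} [Ring R] {𝒜 : ℤ → AddSubgroup R} {i n : ℤ} {a b : R}
    (ha : a ∈ 𝒜 (3 * i + n)) (hb : b ∈ 𝒜 (-(3 * i + n))) (ha' : ∀ r, a * r = r * a)
    (hb' : ∀ r, b * r = r * b) (hab : a * b = 1) (M : GrMod 𝒜) :
    (shiftBy (-i)).obj ((shiftBy (-i)).obj ((shiftBy (-i)).obj M)) ≅ (shiftBy n).obj M where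
  hom := ⟨{ toFun := fun m => op b • (show M.carrier from m)
            map_add' := fun m m' => smul_add (op b) (show M.carrier from m) m'
            map_smul' := fun r m => by
              change op b • r • (show M.carrier from m) = r • op b • (show M.carrier from m)
              rw [smul_smul, smul_smul, ← op_unop r, ← op_mul, ← op_mul, hb'] },
    fun j m hm => by
      have h := M.smul_mem (m := m) (i := j - -i - -i - -i) hm hb
      change _ ∈ M.deg (j - n)
      rwa [show j - -i - -i - -i + -(3 * i + n) = j - n by ring] at h⟩
  inv := ⟨{ toFun := fun m => op a • (show M.carrier from m)
            map_add' := fun m m' => smul_add (op a) (show M.carrier from m) m'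
            map_smul' := fun r m => by
              change op a • r • (show M.carrier from m) = r • op a • (show M.carrier from m)
              rw [smul_smul, smul_smul, ← op_unop r, ← op_mul, ← op_mul, ha'] },
    fun j m hm => by
      have h := M.smul_mem (m := m) (i := j - n) hm ha
      change _ ∈ M.deg (j - -i - -i - -i)
      rwa [show j - n + (3 * i + n) = j - -i - -i - -i by ring] at h⟩
  hom_inv_id := hom_ext fun m => by
    change op a • op b • (show M.carrier from m) = m
    rw [smul_smul, ← op_mul, ← ha', hab, op_one, one_smul]
  inv_hom_id := hom_ext fun m => by
    change op b • op a • (show M.carrier from m) = m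
    rw [smul_smul, ← op_mul, hab, op_one, one_smul]

end GrMod

/-! ### The square-zero twist on projective modules over k[x]/(x²) -/

namespace ProjGrMod

section

variable {R : Type u} [Ring R] {𝒜 : ℤ → AddSubgroup R}

/-- The shift, with an explicit underlying graded module. -/
def shiftBy (𝒜 : ℤ → AddSubgroup R) (n : ℤ) : ProjGrMod 𝒜 ⥤ ProjGrMod 𝒜 :=
  (isProjective (GrMod 𝒜)).lift ((isProjective (GrMod 𝒜)).ι ⋙ GrMod.shiftBy n) fun M =>
    (isProjective (GrMod 𝒜)).le_shift n _ M.2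

/-- The explicit shift is isomorphic to the shift. -/
noncomputable def shiftByIso (n : ℤ) : shiftBy 𝒜 n ≅ shiftFunctor (ProjGrMod 𝒜) n :=
  NatIso.ofComponents (fun M => (isProjective (GrMod 𝒜)).isoMk (M.shiftIso n).symm) fun {M N} f =>
    ObjectProperty.hom_ext _ (by
      change (GrMod.shiftBy n).map f.hom ≫ (N.shiftIso n).inv = (M.shiftIso n).inv ≫ (f⟦n⟧').hom
      rw [Iso.comp_inv_eq, Category.assoc, shiftIso_nat, Iso.inv_hom_id_assoc])

instance (n : ℤ) : (shiftBy 𝒜 n).IsEquivalence :=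
  Functor.isEquivalence_of_iso (shiftByIso n).symm

instance (n : ℤ) : (shiftBy 𝒜 n).Additive where
  map_add := rfl

end

variable {k : Type u} [Ring k] {𝒦 : ℤ → AddSubgroup k} [GradedRing 𝒦] {i n : ℤ}

/-- The multiplication by a homogeneous unit, on projective modules. -/
noncomputable def tripleShiftIso (hk : IsGradedField 𝒦) {a b : k}
    (ha : a ∈ 𝒦 (3 * i + n)) (hb : b ∈ 𝒦 (-(3 * i + n))) (hab : a * b = 1) :
    shiftBy (exteriorGrading 𝒦 i) (-i) ⋙ shiftBy (exteriorGrading 𝒦 i) (-i) ⋙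
      shiftBy (exteriorGrading 𝒦 i) (-i) ≅ shiftBy (exteriorGrading 𝒦 i) n :=
  NatIso.ofComponents (fun M => (isProjective (GrMod (exteriorGrading 𝒦 i))).isoMk
    (GrMod.tripleShiftIso (GrMod.inl_mem_exteriorGrading ha) (GrMod.inl_mem_exteriorGrading hb)
      (hk.inl_mul_comm_of_mem ha) (hk.inl_mul_comm_of_mem hb)
      (by rw [← TrivSqZeroExt.inl_mul, hab, TrivSqZeroExt.inl_one]) M.obj))
    fun f => ObjectProperty.hom_ext _ (GrMod.hom_ext fun m => (map_smul f.hom.1 _ _).symm)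

/-- The structure on projective modules over the exterior algebra given by the shift by the degree
of `x`, the multiplication by `x` and the multiplication by a homogeneous unit. -/
noncomputable def squareZeroTwist (hk : IsGradedField 𝒦) (h : Odd i ∨ (1 + 1 : k) = 0) {a b : k}
    (ha : a ∈ 𝒦 (3 * i + n)) (hb : b ∈ 𝒦 (-(3 * i + n))) (hab : a * b = 1) :
    Pretriangulated.SquareZeroTwist
      (PullbackShift (ProjGrMod (exteriorGrading 𝒦 i)) (zmultiplesHom ℤ n)) where
  τ := shiftBy (exteriorGrading 𝒦 i) (-i)
  isEquivalence := inferInstanceAs (shiftBy (exteriorGrading 𝒦 i) (-i)).IsEquivalence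
  additive := inferInstanceAs (shiftBy (exteriorGrading 𝒦 i) (-i)).Additive
  x M := ObjectProperty.homMk (GrMod.signedEps hk _)
  -- The integer 1 acts in the pulled back shift through 1 • n, hence the transport along
  -- `one_zsmul`.
  η M := (tripleShiftIso hk ha hb hab ≪≫ shiftByIso n ≪≫
    eqToIso (congrArg (shiftFunctor (ProjGrMod (exteriorGrading 𝒦 i))) (one_zsmul n).symm)).app M
  x_nat f := ObjectProperty.hom_ext _ (GrMod.signedEps_nat hk f.hom)
  η_nat f := (tripleShiftIso hk ha hb hab ≪≫ shiftByIso n ≪≫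
    eqToIso (congrArg (shiftFunctor (ProjGrMod (exteriorGrading 𝒦 i)))
      (one_zsmul n).symm)).hom.naturality f
  x_τ M := ObjectProperty.hom_ext _ (GrMod.signedEps_shift hk h _)
  x_x M := ObjectProperty.hom_ext _ (GrMod.signedEps_signedEps hk _)
  exists_lift {P M} w hw := by
    have : Projective P.obj := P.property
    have : Projective M.obj := M.property
    obtain ⟨v, hv⟩ := GrMod.exists_comp_signedEps hk (P := P.obj) (M := M.obj) w.hom
      (congrArg (fun z => z.hom) hw)
    exact ⟨ObjectProperty.homMk v, ObjectProperty.hom_ext _ hv⟩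
  exists_regular_mod {A B} f := by
    have : Projective B.obj := B.property
    obtain ⟨b, hb⟩ := GrMod.exists_regular_mod_signedEps hk (A := A.obj) (B := B.obj) f.hom
    exact ⟨ObjectProperty.homMk b, ObjectProperty.hom_ext _ hb⟩

end ProjGrMod

/-- Exterior algebras on one generator over a graded field are `Δⁿ`-rings, provided that they have a
unit of suitable degree. -/
theorem IsGradedField.isDeltaRing_exteriorGrading {k : Type u} [Ring k] {𝒦 : ℤ → AddSubgroup k}
    [GradedRing 𝒦] (hk : IsGradedField 𝒦) {i n : ℤ} {v : DualNumber k}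
    (hv : v ∈ exteriorGrading 𝒦 i (3 * i + n)) (hu : IsUnit v)
    (h : ringChar k ≠ 2 → ¬ (Even n ∧ Even i)) : IsDeltaRing (exteriorGrading 𝒦 i) n := by
  -- The given unit may have an x-component. Its component in k is a unit of the same degree, and
  -- being central it can define a linear isomorphism.
  have hu' : IsUnit v.fst := by
    obtain ⟨w, h₁, h₂⟩ := isUnit_iff_exists.1 hu
    exact isUnit_iff_exists.2 ⟨w.fst, congrArg TrivSqZeroExt.fst h₁, congrArg TrivSqZeroExt.fst h₂⟩
  obtain ⟨b, hb, hab⟩ := exists_mul_eq_one_of_mem hv.1 hu'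
  have h₂ : Odd i ∨ (1 + 1 : k) = 0 := by
    by_cases hc : ringChar k = 2
    · right
      have := ringChar.Nat.cast_ringChar (R := k)
      rw [hc] at this
      rw [one_add_one_eq_two]
      exact_mod_cast this
    · rcases Int.even_or_odd i with hi | hi
      -- If i is even and the characteristic is not 2, then n is odd, so the unit has odd degree 3i
      -- + n and 2 = 0 in k.
      · refine Or.inr (hk.two_eq_zero hv.1 hu' ((hi.mul_left 3).add_odd ?_))
        exact Int.not_even_iff_odd.1 fun hn => h hc ⟨hn, hi⟩
      · exact Or.inl hi
  have ht := (ProjGrMod.squareZeroTwist hk h₂ hv.1 hb hab).isTriangleModel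
  exact ht.exists_isTriangulated

theorem proposition2p7 {k : Type u} [Ring k] (𝒦 : ℤ → AddSubgroup k) [GradedRing 𝒦]
    (hk : IsGradedField 𝒦) :
    (∀ n : ℤ, IsDeltaRing 𝒦 n) ∧
    ∀ i n : ℤ, (∃ v : DualNumber k, v ∈ exteriorGrading 𝒦 i (3 * i + n) ∧ IsUnit v) →
      (ringChar k ≠ 2 → ¬ (Even n ∧ Even i)) →
      IsDeltaRing (exteriorGrading 𝒦 i) n :=
  ⟨hk.isDeltaRing, fun _ _ ⟨_, hv, hu⟩ h => hk.isDeltaRing_exteriorGrading hv hu h⟩
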